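/- Let $K$ be an algebraically closed field of characteristic $p\neq 0,2,3$, and let $E_i: y^2=x^3+A_ix+B_i$ $(i=1,2)$ be elliptic curves over $K$ with points at infinity $O$. Let $K[\varepsilon]$, $\varepsilon^2=0$, be the dual numbers. The canonical lift $\tilde E_i$ is the same equation over $K[\varepsilon]$; its points are the affine points $(x:y:1)$ with $x,y\in K[\varepsilon]$ and the points at infinity $O_k=(k\varepsilon:1:0)$, $k\in K$, which form a subgroup $\Theta_i\cong K^+$. Every point of $\tilde E_i$ is uniquely $P+O_k$ with $P\in E_i(K)$ and $k\in K$. The pairing. Assume that $E=E_i$ is ordinary. Fix a point $T$ of order two, a point $R\in E[p]\setminus E[2]$, and a decomposition $C$ of $p$ into a sum of $p$ ones by steps $i+j\mapsto i,j$. For $P\in E[p]$ let $\ell_{i,j}$ be the line through $iP$ and $jP$, $v_i$ the vertical line through $iP$, $\tau$ the translation by $-T$, and $h_{i,j}=(\ell_{i,j}/v_{i+j})\circ\tau$ if $i+j\ne p$, $h_{i,j}=v_i\circ\tau$ if $i+j=p$. Put $e(P,O_k)=\prod_C h_{i,j}(O_k+R)/h_{i,j}(R)$ if $P\neq O$ and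 $k\ne 0$, and $e(P,O_k)=1$ otherwise. The pairing $e_p$ on $\tilde E[p]=E[p]\oplus\Theta$, with values in $K[\varepsilon]^\times$, is the bilinear antisymmetric extension of $e$ that is trivial on $E[p]\times E[p]$ and on $\Theta\times\Theta$, that is, $e_p(P+O_k,Q+O_j)=e(P,O_j)\,e(Q,O_k)^{-1}$. The extension of an isogeny. Let $\phi:E_1\to E_2$ be a (nonconstant) isogeny, and let $t_i=-x_i/y_i$ be the uniformizer at the point at infinity of $E_i$. Proposition. There is exactly one $m\in K$ with $t_2\circ\phi=m\,t_1+O(t_1^2)$ at the point at infinity of $E_1$. There is exactly one map $\tilde\phi:\tilde E_1\to\tilde E_2$ such that * $\tilde\phi(O_k)=O_{mk}$ for all $k\in K$; * for an affine point $\tilde P$ over a point $P\in E_1(K)\setminus\ker\phi$, $\tilde\phi(\tilde P)$ is the affine point whose coordinates are the values of the rational functions $x_2\circ\phi$, $y_2\circ\phi$ at $\tilde P$; * for an affine point $\tilde P$ over a point $P\in\ker\phi$ and every $T\in E_1(K)\setminus\ker\phi$, $\tilde\phi(\tilde P)=\tilde\phi(\tilde P+T)+\phi(-T)$. The map $\tilde\phi$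 is a homomorphism, it coincides with $\phi$ on $E_1(K)$, and it maps $\tilde E_1[p]$ to $\tilde E_2[p]$. If the curves are ordinary, then, for all choices of $(T,R,C)$ in the definitions of the pairings of $E_1$ and of $E_2$, $$e(\phi(P),O_{mk})=e(P,O_k)^{\deg\phi}\qquad (P\in E_1[p],\ k\in K),$$ $$e_p(\tilde\phi(\tilde P),\tilde\phi(\tilde Q))=e_p(\tilde P,\tilde Q)^{\deg\phi}\qquad (\tilde P,\tilde Q\in\tilde E_1[p]).$$ -/

import Mathlib

open Polynomial WeierstrassCurve DualNumber
open scoped Polynomial.Bivariate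

namespace DualWeil

variable {K : Type*} [Field K]

/-! ## Rational functions on a curve and their values

Throughout, an elliptic curve `y² = x³ + Ax + B` is a `W : WeierstrassCurve K` with
`[W.IsShortNF] [W.IsElliptic]`, so that `A = W.a₄` and `B = W.a₆`, the group `E(K)` is
`W.toAffine.Point` and the function field `K(E)` is `W.toAffine.FunctionField`. -/

section FunctionField

variable (W : WeierstrassCurve K)

/-- The polynomial `p(x, y)` as a function on the curve. -/
noncomputable def polyFun (p : K[X][Y]) : W.toAffine.FunctionField :=
  algebraMap W.toAffine.CoordinateRing W.toAffine.FunctionField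
    (Affine.CoordinateRing.mk W.toAffine p)

/-- The coordinate function `x`. -/
noncomputable def xFun : W.toAffine.FunctionField := polyFun W (C X)

/-- The coordinate function `y`. -/
noncomputable def yFun : W.toAffine.FunctionField := polyFun W Y

/-- The uniformizer `t = -x/y` at the point at infinity `O = (0 : 1 : 0)`. -/
noncomputable def tFun : W.toAffine.FunctionField := -(xFun W / yFun W)

/-- The function `w = -1/y`. In the chart around `O` with coordinates `(t, w)` the curve is a plane
curve which passes through the origin, and the origin is `O`. -/
noncomputable def wFun : W.toAffine.FunctionField := -(1 / yFun W)

variable {W}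

/-- The rational function `g` is defined at the affine point `(x, y)`, with coordinates in the
`K`-algebra `R`, and has the value `v` there: `g = a/b` with polynomials `a`, `b` such that `b(x, y)`
is invertible and `v = a(x, y)/b(x, y)`. -/
def HasValue {R : Type*} [CommRing R] [Algebra K R]
    (g : W.toAffine.FunctionField) (x y v : R) : Prop :=
  ∃ a b : K[X][Y], IsUnit (aevalAeval x y b) ∧ g * polyFun W b = polyFun W a ∧
    v * aevalAeval x y b = aevalAeval x y a

/-- `g = O(tⁿ)` at the point at infinity: `g` is `tⁿ` times a function that is regular at `O`, that
is, a quotient of two polynomials in `(t, w)` whose denominator does not vanish at the origin. -/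
def IsBigOInfty (g : W.toAffine.FunctionField) (n : ℕ) : Prop :=
  ∃ a b : K[X][Y], aevalAeval (0 : K) (0 : K) b ≠ 0 ∧
    g * aevalAeval (tFun W) (wFun W) b = tFun W ^ n * aevalAeval (tFun W) (wFun W) a

end FunctionField

/-! ## Isogenies -/

/-- An isogeny `φ : E₁ → E₂`, that is, a nonconstant morphism with `φ(O) = O`. It is given by the
embedding `g ↦ g ∘ φ` of function fields; `φ(O) = O` says that the coordinates `(t₂, w₂)` of the
chart around the point at infinity of `E₂`, composed with `φ`, vanish at that of `E₁`. -/
structure Isogeny (W₁ W₂ : WeierstrassCurve K) where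
  /-- Composition with the isogeny, `g ↦ g ∘ φ`. -/
  pullback : W₂.toAffine.FunctionField →ₐ[K] W₁.toAffine.FunctionField
  tFun_infty : IsBigOInfty (pullback (tFun W₂)) 1
  wFun_infty : IsBigOInfty (pullback (wFun W₂)) 1

namespace Isogeny

variable {W₁ W₂ : WeierstrassCurve K} (φ : Isogeny W₁ W₂)

/-- The degree `[K(E₁) : φ^* K(E₂)]`. -/
noncomputable def degree : ℕ :=
  Module.finrank φ.pullback.fieldRange W₁.toAffine.FunctionField

/-- The condition `t₂ ∘ φ = m t₁ + O(t₁²)`. -/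
def HasLinearCoeff (m : K) : Prop :=
  IsBigOInfty (φ.pullback (tFun W₂) - algebraMap K W₁.toAffine.FunctionField m * tFun W₁) 2

open Classical in
/-- The map `φ : E₁(K) → E₂(K)`: an affine point is sent to the point whose coordinates are the
values of `x₂ ∘ φ` and `y₂ ∘ φ`, if both functions are defined there, and to `O` otherwise. -/
noncomputable def toFun : W₁.toAffine.Point → W₂.toAffine.Point
  | .zero => .zero
  | .some x y _ =>
    if h : ∃ q : K × K, W₂.toAffine.Nonsingular q.1 q.2 ∧
        HasValue (φ.pullback (xFun W₂)) x y q.1 ∧ HasValue (φ.pullback (yFun W₂)) x y q.2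
    then .some h.choose.1 h.choose.2 h.choose_spec.1
    else .zero

end Isogeny

/-! ## The canonical lift -/

/-- The points over `K[ε]` of the canonical lift of `y² = x³ + Ax + B`: the affine points
`(x : y : 1)` with `x, y ∈ K[ε]`, and the points at infinity `O_k = (kε : 1 : 0)` with `k ∈ K`. -/
inductive Lift (W : WeierstrassCurve K) : Type _
  | affine (x y : K[ε])
      (h : y ^ 2 = x ^ 3 + TrivSqZeroExt.inl W.a₄ * x + TrivSqZeroExt.inl W.a₆) : Lift W
  | infty (k : K) : Lift W

lemma dual_isUnit {a : K[ε]} (h : a.fst ≠ 0) : a⁻¹ * a = 1 :=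
  TrivSqZeroExt.inv_mul_cancel h

lemma dual_cancel {a b : K[ε]} (h : a.fst ≠ 0) (hab : a * b = 0) : b = 0 := by
  have := congrArg (fun t => a⁻¹ * t) hab
  simpa [← mul_assoc, dual_isUnit h] using this

/-- The third point on a line of slope `l` through two points of the curve, reflected, is a point of
the curve. -/
lemma add_equation {R : Type*} [CommRing R] {A B x₁ y₁ x₂ y₂ l : R}
    (h₁ : y₁ ^ 2 = x₁ ^ 3 + A * x₁ + B) (hc : l * (x₁ - x₂) = y₁ - y₂)
    (ht : l * (y₁ + y₂) = x₁ ^ 2 + x₁ * x₂ + x₂ ^ 2 + A) :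
    (l * (x₁ - (l ^ 2 - x₁ - x₂)) - y₁) ^ 2 =
      (l ^ 2 - x₁ - x₂) ^ 3 + A * (l ^ 2 - x₁ - x₂) + B := by
  linear_combination h₁ - (l ^ 2 - 2 * x₁ - x₂) * (-ht) - (l ^ 2 - 2 * x₁ - x₂) * l * hc

lemma translate_equation {A B x y e : K[ε]} (h : y ^ 2 = x ^ 3 + A * x + B) (he : e ^ 2 = 0) :
    (y - (3 * x ^ 2 + A) * e) ^ 2 = (x - 2 * y * e) ^ 3 + A * (x - 2 * y * e) + B := by
  linear_combination h + ((3 * x ^ 2 + A) ^ 2 - 12 * x * y ^ 2 + 8 * y ^ 3 * e) * he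

namespace Lift

variable {W : WeierstrassCurve K}

/-- The affine point `(x, y) + O_k = (x - 2ykε, y - (3x² + A)kε)`. -/
def translate (x y : K[ε])
    (h : y ^ 2 = x ^ 3 + TrivSqZeroExt.inl W.a₄ * x + TrivSqZeroExt.inl W.a₆) (k : K) : Lift W :=
  affine (x - 2 * y * TrivSqZeroExt.inr k)
    (y - (3 * x ^ 2 + TrivSqZeroExt.inl W.a₄) * TrivSqZeroExt.inr k)
    (translate_equation h (by rw [pow_two, TrivSqZeroExt.inr_mul_inr]))

open Classical in
/-- The addition law of the curve over the local ring `K[ε]`. Two affine points are joined by the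
line whose slope is given by one of the two expressions
`(y₁ - y₂)/(x₁ - x₂) = (x₁² + x₁x₂ + x₂² + A)/(y₁ + y₂)`, whichever has an invertible denominator; if
there is none, the line meets the line `z = 0` in a point at infinity `O_k`, where `-kε` is the
reciprocal of the slope, given by whichever of these expressions has an invertible numerator. -/
noncomputable def add : Lift W → Lift W → Lift W
  | infty k, infty j => infty (k + j)
  | infty k, affine x y h => translate x y h k
  | affine x y h, infty k => translate x y h k
  | affine x₁ y₁ h₁, affine x₂ y₂ h₂ =>
    if hx : (x₁ - x₂).fst ≠ 0 then
      affine (((y₁ - y₂) * (x₁ - x₂)⁻¹) ^ 2 - x₁ - x₂)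
        (((y₁ - y₂) * (x₁ - x₂)⁻¹) * (x₁ - (((y₁ - y₂) * (x₁ - x₂)⁻¹) ^ 2 - x₁ - x₂)) - y₁)
        (by
          have hi := dual_isUnit hx
          have hc : (y₁ - y₂) * (x₁ - x₂)⁻¹ * (x₁ - x₂) = y₁ - y₂ := by
            rw [mul_assoc, hi, mul_one]
          refine add_equation h₁ hc (sub_eq_zero.mp (dual_cancel hx ?_))
          linear_combination (y₁ + y₂) * hc + h₁ - h₂)
    else if hy : (y₁ + y₂).fst ≠ 0 then
      affine
        (((x₁ ^ 2 + x₁ * x₂ + x₂ ^ 2 + TrivSqZeroExt.inl W.a₄) * (y₁ + y₂)⁻¹) ^ 2 - x₁ - x₂)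
        (((x₁ ^ 2 + x₁ * x₂ + x₂ ^ 2 + TrivSqZeroExt.inl W.a₄) * (y₁ + y₂)⁻¹) *
          (x₁ - (((x₁ ^ 2 + x₁ * x₂ + x₂ ^ 2 + TrivSqZeroExt.inl W.a₄) * (y₁ + y₂)⁻¹) ^ 2
            - x₁ - x₂)) - y₁)
        (by
          have hi := dual_isUnit hy
          have ht : (x₁ ^ 2 + x₁ * x₂ + x₂ ^ 2 + TrivSqZeroExt.inl W.a₄) * (y₁ + y₂)⁻¹ *
              (y₁ + y₂) = x₁ ^ 2 + x₁ * x₂ + x₂ ^ 2 + TrivSqZeroExt.inl W.a₄ := by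
            rw [mul_assoc, hi, mul_one]
          refine add_equation h₁ (sub_eq_zero.mp (dual_cancel hy ?_)) ht
          linear_combination (x₁ - x₂) * ht - h₁ + h₂)
    else if (y₁ - y₂).fst ≠ 0 then
      infty (-((x₁ - x₂) * (y₁ - y₂)⁻¹)).snd
    else
      infty (-((y₁ + y₂) * (x₁ ^ 2 + x₁ * x₂ + x₂ ^ 2 + TrivSqZeroExt.inl W.a₄)⁻¹)).snd

noncomputable instance : Add (Lift W) := ⟨add⟩

/-- The neutral element is `O = O_0`. -/
instance : Zero (Lift W) := ⟨infty 0⟩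

instance : Neg (Lift W) where
  neg
    | affine x y h => affine x (-y) (by rw [neg_sq, h])
    | infty k => infty (-k)

/-- The multiple `nP = P + ⋯ + P`. -/
noncomputable def mulNat (n : ℕ) (P : Lift W) : Lift W := (fun Q => P + Q)^[n] 0

section Short

variable [W.IsShortNF]

/-- The inclusion `E(K) → Ẽ(K[ε])`. -/
def ofPoint : W.toAffine.Point → Lift W
  | .zero => infty 0
  | .some x y h => affine (TrivSqZeroExt.inl x) (TrivSqZeroExt.inl y) (by
      have := (Affine.equation_iff ..).mp h.1
      simp only [a₁_of_isShortNF, a₂_of_isShortNF, a₃_of_isShortNF, zero_mul, add_zero] at this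
      ext <;> simp [this])

/-- The reduction `Ẽ(K[ε]) → E(K)`. -/
def toPoint [W.IsElliptic] : Lift W → W.toAffine.Point
  | infty _ => .zero
  | affine x y h => .some x.fst y.fst ((Affine.equation_iff_nonsingular (W := W.toAffine)).mp (by
      rw [Affine.equation_iff]
      have := congrArg TrivSqZeroExt.fst h
      simp only [TrivSqZeroExt.fst_pow, TrivSqZeroExt.fst_add, TrivSqZeroExt.fst_mul,
        TrivSqZeroExt.fst_inl] at this
      simp [this]))

/-- The `k ∈ K` with `P̃ = P + O_k`, where `P ∈ E(K)` is the reduction of `P̃`; that is,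
`P̃ - P = O_k`. -/
noncomputable def theta [W.IsElliptic] (P : Lift W) : K :=
  match P + -ofPoint P.toPoint with
  | infty k => k
  | affine _ _ _ => 0

end Short

end Lift

/-! ## The pairing -/

/-- A decomposition of `n` into a sum of `n` ones through steps `k ↦ i, j` with `k = i + j`. -/
inductive ChainDecomp : ℕ → Type
  | one : ChainDecomp 1
  | step {i j : ℕ} (c : ChainDecomp i) (d : ChainDecomp j) : ChainDecomp (i + j)

/-- The product of `f i j` over the steps `i + j ↦ i, j` of a decomposition. -/
def ChainDecomp.prod {M : Type*} [CommMonoid M] (f : ℕ → ℕ → M) : {n : ℕ} → ChainDecomp n → M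
  | _, .one => 1
  | _, .step (i := i) (j := j) c d => f i j * (c.prod f * d.prod f)

section Pairing

variable {W : WeierstrassCurve K} [DecidableEq K]

/-- The line `y - y(P) - m(x - x(P))` through the affine points `P` and `Q ≠ -P`, evaluated at
`(x, y)`. (It is only used for such points.) -/
noncomputable def lineAt : W.toAffine.Point → W.toAffine.Point → K[ε] → K[ε] → K[ε]
  | .some x₁ y₁ _, .some x₂ y₂ _, x, y =>
    y - TrivSqZeroExt.inl y₁ -
      TrivSqZeroExt.inl (W.toAffine.slope x₁ x₂ y₁ y₂) * (x - TrivSqZeroExt.inl x₁)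
  | _, _, _, _ => 1

/-- The vertical line `x - x(P)` through the affine point `P`, evaluated at `(x, y)`. (It is only
used for such points.) -/
def verticalAt : W.toAffine.Point → K[ε] → K[ε]
  | .some x₁ _ _, x => x - TrivSqZeroExt.inl x₁
  | .zero, _ => 1

variable [W.IsShortNF]

/-- The value at `S` of `h_{i,j} = (ℓ_{i,j} / v_{i+j}) ∘ τ` for `i + j ≠ p` and `h_{i,j} = v_i ∘ τ` for
`i + j = p`, where `ℓ_{i,j}` is the line through `iP` and `jP`, `v_i` is the vertical line through
`iP`, and `τ` is the translation by `-T`. (It is only used where `S - T` is affine.) -/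
noncomputable def hAt (p : ℕ) (T P : W.toAffine.Point) (i j : ℕ) (S : Lift W) : K[ε] :=
  match S + -Lift.ofPoint T with
  | .affine x y _ =>
    if i + j = p then verticalAt (i • P) x
    else lineAt (i • P) (j • P) x y * (verticalAt ((i + j) • P) x)⁻¹
  | .infty _ => 1

/-- The choices that enter the computation of the pairing: a point `T` of order two, a point
`R ∈ E[p]` that is not in `E[2]`, and an addition chain decomposition of `p`. -/
structure PairingData (p : ℕ) (W : WeierstrassCurve K) where
  T : W.toAffine.Point
  R : W.toAffine.Point
  C : ChainDecomp p
  two_T : 2 • T = 0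
  T_ne_zero : T ≠ 0
  p_R : p • R = 0
  two_R : 2 • R ≠ 0

namespace PairingData

variable {p : ℕ} (D : PairingData p W)

/-- The pairing `e(P, O_k) = ∏_C h_{i,j}(O_k + R) / h_{i,j}(R)` of `P ∈ E[p]` and `O_k ∈ Θ`, which is
`1` if `P = O` or `O_k = O`. -/
noncomputable def e (P : W.toAffine.Point) (k : K) : K[ε] :=
  if P = 0 ∨ k = 0 then 1
  else D.C.prod fun i j =>
    hAt p D.T P i j (Lift.infty k + Lift.ofPoint D.R) * (hAt p D.T P i j (Lift.ofPoint D.R))⁻¹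

/-- The Weil pairing `e_p` on `Ẽ[p]`: the bilinear antisymmetric extension of `e` that is trivial on
`E[p] × E[p]` and on `Θ × Θ`, that is,
`e_p(P + O_k, Q + O_j) = e(P, O_j) e(Q, O_k)⁻¹`. -/
noncomputable def ep [W.IsElliptic] (P Q : Lift W) : K[ε] :=
  D.e P.toPoint Q.theta * (D.e Q.toPoint P.theta)⁻¹

end PairingData

end Pairing

/-! ## The extension of an isogeny to the canonical lifts -/

/-- `F` is the extension `φ̃ : Ẽ₁ → Ẽ₂` of the isogeny `φ` with `t₂ ∘ φ = m t₁ + O(t₁²)`: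
it sends `O_k` to `O_{mk}`; it sends an affine `P̃` over a point `P ∉ ker φ` to `φ(P̃)`, the point whose
coordinates are the values of `x₂ ∘ φ` and `y₂ ∘ φ` at `P̃`; and it sends an affine `P̃` over a point
`P ∈ ker φ` to `φ(P̃ + T) + φ(-T)`, for every `T ∉ ker φ`. -/
structure IsExtension {W₁ W₂ : WeierstrassCurve K} [W₁.IsShortNF] [W₁.IsElliptic] [W₂.IsShortNF]
    (φ : Isogeny W₁ W₂) (m : K) (F : Lift W₁ → Lift W₂) : Prop where
  map_infty : ∀ k, F (.infty k) = .infty (m * k)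
  map_affine : ∀ x y h, φ.toFun (Lift.affine x y h).toPoint ≠ 0 → ∃ u v h',
    F (.affine x y h) = .affine u v h' ∧
      HasValue (φ.pullback (xFun W₂)) x y u ∧ HasValue (φ.pullback (yFun W₂)) x y v
  map_ker : ∀ x y h T, φ.toFun (Lift.affine x y h).toPoint = 0 → φ.toFun T ≠ 0 →
    F (.affine x y h) =
      F (.affine x y h + Lift.ofPoint T) + Lift.ofPoint (φ.toFun (-T))

end DualWeil

namespace DualWeil

/-! Let `D = invDer` be the invariant derivation, with `D x = 2y` and `D y = 3x² + A`. Every point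
of the lift is `P + O_k`, which is the tangent vector `-k D` at `P` (`Lift.exists_eq_mk`). Addition
is componentwise in `(P, k)` (`Lift.mk_add_mk`), and a function `g` regular at the affine point `P`
has the value `g(P) - k (D g)(P) ε` at `P + O_k` (`HasVal.hasValue_translate`).

An isogeny scales `D`: `D(g ∘ φ) = m · (D g) ∘ φ` (`Isogeny.invDer_pullback`). The ratio of the two
sides does not depend on `g`, is regular at every point of `E₁`, hence is constant, and its value at
`O` is `m` because `D t` is 1 there. So the extension must be `P + O_k ↦ φ(P) + O_{mk}`, and it is a
homomorphism as soon as `φ` is one on `E₁(K)`.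

For the pairing, the product over the chain telescopes to a function `f` with divisor `p(P) - p(O)`,
and `e(P, O_k)` is `f(Q + O_k)/f(Q) = 1 - k (D f/f)(Q) ε` with `Q = R - T`. In characteristic `p`
the derivation kills `p`-th powers, so `D f/f` has no affine poles; at infinity its pole order is at
most one, and on a curve of genus one such a function is a constant `c`. Hence `e(P, O_k) = 1 - k c
ε`, whatever `T`, `R` and `C` are (`PairingData.e_eq`).

The norm of `f` along `φ` has divisor `p(φ(P)) - p(O)`, and its logarithmic derivative, with respect
to `m D`, is `(deg φ) c` (`derivation_norm`). So the constant `c'` of `φ(P)` satisfies `m c' = (deg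
φ) c`, which is the compatibility of the pairings; separability of `φ` plays no role. The same norm
on ideals sends the ideal of `P` to that of `φ(P)` (`Isogeny.exists_norm`); since the group law is
that of the ideal class group, this also shows that `φ` is additive. -/

theorem bivariate_induction {R : Type*} [CommSemiring R] {motive : R[X][Y] → Prop}
    (const : ∀ c, motive (C (C c))) (var_x : motive (C X)) (var_y : motive Y)
    (add : ∀ f g, motive f → motive g → motive (f + g))
    (mul : ∀ f g, motive f → motive g → motive (f * g)) (f : R[X][Y]) : motive f := by
  have pow (g : R[X][Y]) (hg : motive g) (n : ℕ) : motive (g ^ n) := by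
    induction n with
    | zero => simpa using const 1
    | succ n ih => rw [pow_succ]; exact mul _ _ ih hg
  have hC (p : R[X]) : motive (C p) := by
    induction p using Polynomial.induction_on' with
    | add p q hp hq => rw [C_add]; exact add _ _ hp hq
    | monomial n a =>
      rw [← C_mul_X_pow_eq_monomial, C_mul, C_pow]
      exact mul _ _ (const a) (pow _ var_x n)
  induction f using Polynomial.induction_on' with
  | add p q hp hq => exact add _ _ hp hq
  | monomial n a =>
    rw [← C_mul_X_pow_eq_monomial]
    exact mul _ _ (hC a) (pow _ var_y n)

theorem algHom_aevalAeval {R A B : Type*} [CommSemiring R] [CommSemiring A] [CommSemiring B]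
    [Algebra R A] [Algebra R B] (σ : A →ₐ[R] B) (x y : A) (f : R[X][Y]) :
    σ (aevalAeval x y f) = aevalAeval (σ x) (σ y) f := by
  induction f using bivariate_induction with
  | const c => simp
  | var_x => simp
  | var_y => simp
  | add f g hf hg => simp only [map_add, hf, hg]
  | mul f g hf hg => simp only [map_mul, hf, hg]

/-! ### The local ring of a point in a plane chart -/

section LocalRing

variable {K L : Type*} [Field K] [Field L] [Algebra K L]

/-- Every polynomial relation between `ξ` and `η` holds at the point `(x, y)`. -/
def Specializes (ξ η : L) (x y : K) : Prop :=
  ∀ f : K[X][Y], aevalAeval ξ η f = 0 → aevalAeval x y f = 0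

/-- `g` is a quotient of polynomials in `ξ`, `η`, the denominator being nonzero at `(x, y)`, and
the value of this quotient at `(x, y)` is `v`. -/
def HasVal (ξ η : L) (x y : K) (g : L) (v : K) : Prop :=
  ∃ a b : K[X][Y], aevalAeval x y b ≠ 0 ∧ g * aevalAeval ξ η b = aevalAeval ξ η a ∧
    v * aevalAeval x y b = aevalAeval x y a

variable {ξ η : L} {x y : K} {g h : L} {v w : K}

namespace HasVal

theorem of_aevalAeval (ξ η : L) (x y : K) (f : K[X][Y]) :
    HasVal ξ η x y (aevalAeval ξ η f) (aevalAeval x y f) :=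
  ⟨f, 1, by simp, by simp, by simp⟩

theorem fst (ξ η : L) (x y : K) : HasVal ξ η x y ξ x := by
  simpa using of_aevalAeval ξ η x y (C X)

theorem snd (ξ η : L) (x y : K) : HasVal ξ η x y η y := by
  simpa using of_aevalAeval ξ η x y Y

theorem const (c : K) : HasVal ξ η x y (algebraMap K L c) c := by
  simpa using of_aevalAeval ξ η x y (C (C c))

theorem one : HasVal ξ η x y (1 : L) 1 := by
  simpa using of_aevalAeval ξ η x y 1

theorem add (hg : HasVal ξ η x y g v) (hh : HasVal ξ η x y h w) :
    HasVal ξ η x y (g + h) (v + w) := by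
  obtain ⟨a, b, hb, h₁, h₂⟩ := hg
  obtain ⟨c, d, hd, h₃, h₄⟩ := hh
  refine ⟨a * d + c * b, b * d, by simpa using ⟨hb, hd⟩, ?_, ?_⟩
  · simp only [map_add, map_mul]; linear_combination
      aevalAeval ξ η d * h₁ + aevalAeval ξ η b * h₃
  · simp only [map_add, map_mul]; linear_combination
      aevalAeval x y d * h₂ + aevalAeval x y b * h₄

theorem mul (hg : HasVal ξ η x y g v) (hh : HasVal ξ η x y h w) :
    HasVal ξ η x y (g * h) (v * w) := by
  obtain ⟨a, b, hb, h₁, h₂⟩ := hg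
  obtain ⟨c, d, hd, h₃, h₄⟩ := hh
  refine ⟨a * c, b * d, by simpa using ⟨hb, hd⟩, ?_, ?_⟩
  · simp only [map_mul, ← h₁, ← h₃]; ring
  · simp only [map_mul, ← h₂, ← h₄]; ring

theorem pow (hg : HasVal ξ η x y g v) (n : ℕ) : HasVal ξ η x y (g ^ n) (v ^ n) := by
  induction n with
  | zero => simpa using one
  | succ n ih => rw [pow_succ, pow_succ]; exact ih.mul hg

theorem const_mul (c : K) (hg : HasVal ξ η x y g v) :
    HasVal ξ η x y (algebraMap K L c * g) (c * v) :=
  (const c).mul hg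

theorem neg (hg : HasVal ξ η x y g v) : HasVal ξ η x y (-g) (-v) := by
  simpa using const_mul (-1) hg

theorem sub (hg : HasVal ξ η x y g v) (hh : HasVal ξ η x y h w) :
    HasVal ξ η x y (g - h) (v - w) := by
  simpa [sub_eq_add_neg] using hg.add hh.neg

theorem comp_polynomial (hg : HasVal ξ η x y g v) (hh : HasVal ξ η x y h w) (f : K[X][Y]) :
    HasVal ξ η x y (aevalAeval g h f) (aevalAeval v w f) := by
  induction f using bivariate_induction with
  | const c => simpa using HasVal.const c
  | var_x => simpa using hg
  | var_y => simpa using hh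
  | add f g hf hg => simpa using hf.add hg
  | mul f g hf hg => simpa using hf.mul hg

/-- A function that is zero specializes to zero, so a denominator that does not vanish at the point
is a nonzero function. This makes values invertible and unique. -/
theorem ne_zero (hs : Specializes ξ η x y) (hg : HasVal ξ η x y g v) (hv : v ≠ 0) : g ≠ 0 := by
  obtain ⟨a, b, hb, h₁, h₂⟩ := hg
  rintro rfl
  rw [zero_mul] at h₁
  rw [hs a h₁.symm] at h₂
  exact mul_ne_zero hv hb h₂

theorem inv (hs : Specializes ξ η x y) (hg : HasVal ξ η x y g v) (hv : v ≠ 0) :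
    HasVal ξ η x y g⁻¹ v⁻¹ := by
  have hg0 := hg.ne_zero hs hv
  obtain ⟨a, b, hb, h₁, h₂⟩ := hg
  refine ⟨b, a, h₂ ▸ mul_ne_zero hv hb, ?_, ?_⟩
  · rw [← h₁]; field_simp
  · rw [← h₂]; field_simp

theorem div (hs : Specializes ξ η x y) (hg : HasVal ξ η x y g v) (hh : HasVal ξ η x y h w)
    (hw : w ≠ 0) : HasVal ξ η x y (g / h) (v / w) := by
  simpa [div_eq_mul_inv] using hg.mul (hh.inv hs hw)

theorem unique (hs : Specializes ξ η x y) (hg : HasVal ξ η x y g v) (hg' : HasVal ξ η x y g w) :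
    v = w := by
  by_contra hne
  exact (hg.sub hg').ne_zero hs (sub_ne_zero.mpr hne) (sub_self g)

end HasVal

/-- The polynomial in `ξ`, `η` that is the derivative of `f` along a derivation under which `ξ` and
`η` have polynomial derivatives; it is also the derivative of `f` in the direction of the vector
field `(a₁, a₂)` at every point of the plane. -/
theorem exists_derivation_aevalAeval (D : Derivation K L L) (a₁ a₂ : K[X][Y])
    (h₁ : D ξ = aevalAeval ξ η a₁) (h₂ : D η = aevalAeval ξ η a₂) (f : K[X][Y]) :
    ∃ f' : K[X][Y], D (aevalAeval ξ η f) = aevalAeval ξ η f' ∧ ∀ x y k : K,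
      aevalAeval (TrivSqZeroExt.inl x - TrivSqZeroExt.inr (k * aevalAeval x y a₁) : K[ε])
        (TrivSqZeroExt.inl y - TrivSqZeroExt.inr (k * aevalAeval x y a₂)) f =
      TrivSqZeroExt.inl (aevalAeval x y f) - TrivSqZeroExt.inr (k * aevalAeval x y f') := by
  induction f using bivariate_induction with
  | const c => exact ⟨0, by simp, by intros; simp; rfl⟩
  | var_x => exact ⟨a₁, by simpa using h₁, by intros; simp⟩
  | var_y => exact ⟨a₂, by simpa using h₂, by intros; simp⟩
  | add f g hf hg =>
    obtain ⟨f', hf, hf'⟩ := hf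
    obtain ⟨g', hg, hg'⟩ := hg
    refine ⟨f' + g', by simp only [map_add, hf, hg], fun x y k => ?_⟩
    simp only [map_add, hf', hg', mul_add, TrivSqZeroExt.inl_add, TrivSqZeroExt.inr_add]
    ring
  | mul f g hf hg =>
    obtain ⟨f', hf, hf'⟩ := hf
    obtain ⟨g', hg, hg'⟩ := hg
    refine ⟨f * g' + g * f', by simp only [map_add, map_mul, D.leibniz, hf, hg, smul_eq_mul],
      fun x y k => ?_⟩
    rw [map_mul, hf', hg']
    ext <;> simp
    ring

/-- Quotient rule: the local ring at the point is stable under `D` because `D` maps the chart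
coordinates to polynomials in them. -/
theorem HasVal.derivation {D : Derivation K L L} {a₁ a₂ : K[X][Y]}
    (h₁ : D ξ = aevalAeval ξ η a₁) (h₂ : D η = aevalAeval ξ η a₂)
    (hs : Specializes ξ η x y) (hg : HasVal ξ η x y g v) : ∃ v', HasVal ξ η x y (D g) v' := by
  obtain ⟨a, b, hb, e₁, e₂⟩ := hg
  obtain ⟨a', ha', -⟩ := exists_derivation_aevalAeval D a₁ a₂ h₁ h₂ a
  obtain ⟨b', hb', -⟩ := exists_derivation_aevalAeval D a₁ a₂ h₁ h₂ b
  have hB := HasVal.of_aevalAeval ξ η x y b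
  have hB0 := hB.ne_zero hs hb
  have key : D g = (aevalAeval ξ η a' - g * aevalAeval ξ η b') /
      aevalAeval ξ η b := by
    have := congrArg D e₁
    rw [D.leibniz, ha', hb', smul_eq_mul, smul_eq_mul] at this
    rw [eq_div_iff hB0]
    linear_combination this
  exact ⟨_, key ▸ (((of_aevalAeval ξ η x y a').sub (HasVal.mul ⟨a, b, hb, e₁, e₂⟩
    (of_aevalAeval ξ η x y b'))).div hs hB hb)⟩

end LocalRing

/-! ### Functions on the affine curve and their values -/

section Coordinates

variable {K : Type*} [Field K] (W : WeierstrassCurve K)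

theorem polyFun_eq_aevalAeval (f : K[X][Y]) :
    polyFun W f = aevalAeval (xFun W) (yFun W) f := by
  induction f using bivariate_induction with
  | const c =>
    simp only [polyFun, aevalAeval_C, aeval_C]
    rw [IsScalarTower.algebraMap_apply K W.toAffine.CoordinateRing W.toAffine.FunctionField]
    rfl
  | var_x => rw [aevalAeval_X]; rfl
  | var_y => rw [aevalAeval_Y]; rfl
  | add f g hf hg => simp only [map_add, ← hf, ← hg, polyFun]
  | mul f g hf hg => simp only [map_mul, ← hf, ← hg, polyFun]

theorem polyFun_eq_zero_iff {f : K[X][Y]} :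
    polyFun W f = 0 ↔ Affine.CoordinateRing.mk W.toAffine f = 0 :=
  (injective_iff_map_eq_zero' _).mp (IsFractionRing.injective _ _) _

theorem exists_polyFun_div (g : W.toAffine.FunctionField) :
    ∃ a b : K[X][Y], polyFun W b ≠ 0 ∧ g = polyFun W a / polyFun W b := by
  obtain ⟨a, b, hb, rfl⟩ := IsFractionRing.div_surjective (A := W.toAffine.CoordinateRing) g
  obtain ⟨a, rfl⟩ := AdjoinRoot.mk_surjective a
  obtain ⟨b, rfl⟩ := AdjoinRoot.mk_surjective b
  refine ⟨a, b, ?_, rfl⟩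
  rw [Ne, polyFun_eq_zero_iff]
  exact nonZeroDivisors.ne_zero hb

theorem hasValue_iff_hasVal {g : W.toAffine.FunctionField} {x y v : K} :
    HasValue g x y v ↔ HasVal (xFun W) (yFun W) x y g v := by
  simp only [HasValue, HasVal, polyFun_eq_aevalAeval, isUnit_iff_ne_zero]

variable [W.IsShortNF]

theorem yFun_sq : yFun W ^ 2 = xFun W ^ 3 + algebraMap K _ W.a₄ * xFun W
    + algebraMap K _ W.a₆ := by
  have h : polyFun W W.toAffine.polynomial = 0 := by
    rw [polyFun_eq_zero_iff]; exact AdjoinRoot.mk_self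
  rw [polyFun_eq_aevalAeval] at h
  simp only [Affine.polynomial, a₁_of_isShortNF, a₂_of_isShortNF, a₃_of_isShortNF, map_add, map_sub, map_mul,
    map_pow, aevalAeval_C, aevalAeval_Y, aeval_X, aeval_C, zero_mul, map_zero, add_zero]
    at h
  linear_combination h

theorem equation_iff_short {x y : K} :
    W.toAffine.Equation x y ↔ y ^ 2 = x ^ 3 + W.a₄ * x + W.a₆ := by
  simp [Affine.equation_iff]

theorem nonsingular_iff_short [W.IsElliptic] {x y : K} :
    W.toAffine.Nonsingular x y ↔ y ^ 2 = x ^ 3 + W.a₄ * x + W.a₆ := by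
  rw [← equation_iff_short W]
  exact (Affine.equation_iff_nonsingular (W := W.toAffine)).symm

/-- The difference is a multiple of the Weierstrass polynomial, which vanishes at every point with
coordinates in `R`. The case `R = K[ε]` makes values at points of the lift well defined. -/
theorem aevalAeval_eq_of_polyFun_eq {R : Type*} [CommRing R] [Algebra K R] {x y : R}
    (h : y ^ 2 = x ^ 3 + algebraMap K R W.a₄ * x + algebraMap K R W.a₆) {f g : K[X][Y]}
    (hf : polyFun W f = polyFun W g) : aevalAeval x y f = aevalAeval x y g := by
  have h0 : polyFun W (f - g) = 0 := by
    rw [polyFun_eq_aevalAeval] at *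
    rw [map_sub, hf, polyFun_eq_aevalAeval, sub_self]
  rw [polyFun_eq_zero_iff] at h0
  obtain ⟨c, hc⟩ := AdjoinRoot.mk_eq_zero.mp h0
  rw [← sub_eq_zero, ← map_sub, hc, map_mul]
  suffices aevalAeval x y W.toAffine.polynomial = 0 by rw [this, zero_mul]
  rw [Affine.polynomial]
  simp only [a₁_of_isShortNF, a₂_of_isShortNF, a₃_of_isShortNF, map_add, map_sub, map_mul,
    map_pow, aevalAeval_C, aevalAeval_Y, aeval_X, aeval_C, zero_mul, map_zero, add_zero]
  linear_combination h

theorem specializes_of_equation {x y : K} (h : W.toAffine.Equation x y) :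
    Specializes (xFun W) (yFun W) x y := by
  intro f hf
  rw [equation_iff_short] at h
  have := aevalAeval_eq_of_polyFun_eq W (R := K) (x := x) (y := y) h (f := f) (g := 0)
    (by rw [polyFun_eq_aevalAeval, hf, polyFun_eq_aevalAeval, map_zero])
  rw [this, map_zero]

theorem HasValue.unique {W : WeierstrassCurve K} [W.IsShortNF] {R : Type*} [CommRing R] [Algebra K R] {x y u v : R}
    (h : y ^ 2 = x ^ 3 + algebraMap K R W.a₄ * x + algebraMap K R W.a₆)
    {g : W.toAffine.FunctionField} (hu : HasValue g x y u) (hv : HasValue g x y v) : u = v := by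
  obtain ⟨a, b, hb, h₁, h₂⟩ := hu
  obtain ⟨c, d, hd, h₃, h₄⟩ := hv
  have key : polyFun W (a * d) = polyFun W (c * b) := by
    simp only [polyFun_eq_aevalAeval, map_mul] at *
    rw [← h₁, ← h₃]; ring
  have := aevalAeval_eq_of_polyFun_eq W h key
  rw [map_mul, map_mul, ← h₂, ← h₄] at this
  have h' : (u - v) * (aevalAeval x y b * aevalAeval x y d) = 0 := by linear_combination this
  exact sub_eq_zero.mp ((IsUnit.mul_left_eq_zero (hb.mul hd)).mp h')

end Coordinates

/-! ### The pole order at infinity -/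

section PoleOrder

variable {K : Type*} [Field K] (W : WeierstrassCurve K)

/-- The order of the pole of `a` at infinity. -/
noncomputable def poleOrder (a : W.toAffine.CoordinateRing) : WithBot ℕ :=
  (Algebra.norm K[X] a).degree

variable {W}

theorem poleOrder_mul (a b : W.toAffine.CoordinateRing) :
    poleOrder W (a * b) = poleOrder W a + poleOrder W b := by
  simp [poleOrder]

theorem poleOrder_pow (a : W.toAffine.CoordinateRing) (n : ℕ) :
    poleOrder W (a ^ n) = n • poleOrder W a := by
  simp [poleOrder]

/-- The two summands have pole orders of different parity, so they cannot cancel. -/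
theorem poleOrder_le_iff (p q : K[X]) (n : WithBot ℕ) :
    poleOrder W (p • (1 : W.toAffine.CoordinateRing) + q • Affine.CoordinateRing.mk W.toAffine Y)
      ≤ n ↔ 2 • p.degree ≤ n ∧ 2 • q.degree + 3 ≤ n := by
  rw [poleOrder, Affine.CoordinateRing.degree_norm_smul_basis, max_le_iff]

theorem poleOrder_eq_bot_iff {a : W.toAffine.CoordinateRing} : poleOrder W a = ⊥ ↔ a = 0 := by
  constructor
  · intro h
    obtain ⟨p, q, rfl⟩ := Affine.CoordinateRing.exists_smul_basis_eq a
    obtain ⟨h₁, h₂⟩ := (poleOrder_le_iff ..).mp h.le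
    have hp : p = 0 := by
      rw [← degree_eq_bot]
      cases hp : p.degree with
      | bot => rfl
      | coe n => rw [hp] at h₁; norm_cast at h₁
    have hq : q = 0 := by
      rw [← degree_eq_bot]
      cases hq : q.degree with
      | bot => rfl
      | coe n => rw [hq] at h₂; norm_cast at h₂
    simp [hp, hq]
  · rintro rfl
    have := poleOrder_le_iff (W := W) 0 0 ⊥
    rw [zero_smul, zero_smul, add_zero] at this
    exact le_bot_iff.mp (this.mpr (by simp))

/-- The norm is not additive, so the ultrametric inequality is read off from the coordinates in the
basis `1, y`. -/
theorem poleOrder_add_le {a b : W.toAffine.CoordinateRing} {n : WithBot ℕ}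
    (ha : poleOrder W a ≤ n) (hb : poleOrder W b ≤ n) : poleOrder W (a + b) ≤ n := by
  obtain ⟨p, q, rfl⟩ := Affine.CoordinateRing.exists_smul_basis_eq a
  obtain ⟨r, s, rfl⟩ := Affine.CoordinateRing.exists_smul_basis_eq b
  rw [poleOrder_le_iff] at ha hb
  rw [add_add_add_comm, ← add_smul, ← add_smul, poleOrder_le_iff]
  constructor
  · rcases le_max_iff.mp (degree_add_le p r) with h | h
    · exact (nsmul_le_nsmul_right h 2).trans ha.1
    · exact (nsmul_le_nsmul_right h 2).trans hb.1
  · rcases le_max_iff.mp (degree_add_le q s) with h | h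
    · exact (add_le_add_left (nsmul_le_nsmul_right h 2) 3).trans ha.2
    · exact (add_le_add_left (nsmul_le_nsmul_right h 2) 3).trans hb.2

theorem poleOrder_neg (a : W.toAffine.CoordinateRing) : poleOrder W (-a) = poleOrder W a := by
  have h := poleOrder_mul (-a) (-a)
  rw [neg_mul_neg, poleOrder_mul] at h
  cases ha : poleOrder W a with
  | bot => rw [poleOrder_eq_bot_iff] at ha ⊢; simpa using ha
  | coe m =>
    cases hb : poleOrder W (-a) with
    | bot => rw [poleOrder_eq_bot_iff] at hb; rw [neg_eq_zero.mp hb, poleOrder_eq_bot_iff.mpr rfl] at ha; simp at ha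
    | coe n => rw [ha, hb] at h; norm_cast at h ⊢; omega

theorem poleOrder_mk_Y : poleOrder W (Affine.CoordinateRing.mk W.toAffine Y) = 3 := by
  have := Affine.CoordinateRing.degree_norm_smul_basis (W' := W.toAffine) 0 1
  rw [zero_smul, one_smul, zero_add] at this
  rw [poleOrder, this]; simp

theorem poleOrder_mk_X : poleOrder W (Affine.CoordinateRing.mk W.toAffine (C X)) = 2 := by
  have := Affine.CoordinateRing.degree_norm_smul_basis (W' := W.toAffine) X 0
  rw [zero_smul, add_zero, Affine.CoordinateRing.smul, mul_one] at this
  rw [poleOrder, this]; simp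

theorem poleOrder_algebraMap {c : K} (hc : c ≠ 0) :
    poleOrder W (algebraMap K W.toAffine.CoordinateRing c) = 0 := by
  rw [poleOrder, IsScalarTower.algebraMap_apply K K[X], Algebra.norm_algebraMap, degree_pow,
    algebraMap_eq, degree_C hc, nsmul_zero]

/-- The possible pole orders are 0, 2, 3, …; the gap at 1 expresses that the curve has genus one. It
is what forces logarithmic derivatives to be constant later. -/
theorem exists_eq_algebraMap_of_poleOrder_le_one {a : W.toAffine.CoordinateRing}
    (h : poleOrder W a ≤ 1) : ∃ c : K, a = algebraMap K _ c := by
  obtain ⟨p, q, rfl⟩ := Affine.CoordinateRing.exists_smul_basis_eq a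
  obtain ⟨h₁, h₂⟩ := (poleOrder_le_iff ..).mp h
  have hq : q = 0 := by
    rw [← degree_eq_bot]
    cases hq : q.degree with
    | bot => rfl
    | coe n => rw [hq] at h₂; norm_cast at h₂
  have hp : p.degree ≤ 0 := by
    cases hp : p.degree with
    | bot => exact bot_le
    | coe n => 
      rw [hp, two_nsmul] at h₁
      have h₁' : ((n + n : ℕ) : WithBot ℕ) ≤ ((1 : ℕ) : WithBot ℕ) := h₁
      have : n = 0 := by
        have : n + n ≤ 1 := by exact_mod_cast h₁'
        omega
      rw [this]; rfl
  obtain ⟨c, rfl⟩ : ∃ c, p = C c := ⟨_, eq_C_of_degree_le_zero hp⟩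
  refine ⟨c, ?_⟩
  rw [hq, zero_smul, add_zero, IsScalarTower.algebraMap_apply K K[X], Algebra.algebraMap_eq_smul_one]
  rfl

theorem exists_eq_algebraMap_of_isUnit {a : W.toAffine.CoordinateRing}
    (h : IsUnit a) : ∃ c : K, c ≠ 0 ∧ a = algebraMap K _ c := by
  have := degree_eq_zero_of_isUnit (h.map (Algebra.norm K[X]))
  obtain ⟨c, rfl⟩ := exists_eq_algebraMap_of_poleOrder_le_one (a := a)
    (by rw [poleOrder, this]; exact zero_le_one)
  refine ⟨c, ?_, rfl⟩
  rintro rfl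
  simp at h

end PoleOrder

/-! ### Functions near the point at infinity -/

section Infinity

variable {K : Type*} [Field K] (W : WeierstrassCurve K)

theorem xFun_ne_zero : xFun W ≠ 0 := by
  rw [xFun, Ne, polyFun_eq_zero_iff, ← poleOrder_eq_bot_iff, poleOrder_mk_X]; simp

theorem yFun_ne_zero : yFun W ≠ 0 := by
  rw [yFun, Ne, polyFun_eq_zero_iff, ← poleOrder_eq_bot_iff, poleOrder_mk_Y]
  exact WithBot.coe_ne_bot (a := 3)

theorem tFun_ne_zero : tFun W ≠ 0 :=
  neg_ne_zero.mpr (div_ne_zero (xFun_ne_zero W) (yFun_ne_zero W))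

theorem wFun_eq [W.IsShortNF] : wFun W = tFun W ^ 3 + algebraMap K _ W.a₄ * tFun W * wFun W ^ 2
    + algebraMap K _ W.a₆ * wFun W ^ 3 := by
  have h := yFun_sq W
  have h0 := yFun_ne_zero W
  rw [tFun, wFun]
  field_simp
  linear_combination -h

/-- A polynomial in `t`, `w` becomes, after multiplication by a power of `y`, a regular function
whose leading term at infinity is the constant term. -/
theorem exists_homogenization (f : K[X][Y]) : ∃ N : ℕ, ∀ M, N ≤ M → ∃ r : W.toAffine.CoordinateRing,
    algebraMap _ W.toAffine.FunctionField r = yFun W ^ M * aevalAeval (tFun W) (wFun W) f ∧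
    poleOrder W (r - algebraMap K _ (aevalAeval (0 : K) (0 : K) f) *
      Affine.CoordinateRing.mk W.toAffine Y ^ M) < ((3 * M : ℕ) : WithBot ℕ) := by
  have hy : algebraMap W.toAffine.CoordinateRing W.toAffine.FunctionField
    (Affine.CoordinateRing.mk W.toAffine Y) = yFun W := rfl
  have hy0 := yFun_ne_zero W
  have hyM (M : ℕ) : poleOrder W (Affine.CoordinateRing.mk W.toAffine Y ^ M) =
      ((3 * M : ℕ) : WithBot ℕ) := by
    rw [poleOrder_pow, poleOrder_mk_Y, nsmul_eq_mul, mul_comm]; norm_cast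
  induction f using bivariate_induction with
  | const c =>
    refine ⟨0, fun M _ => ⟨algebraMap K _ c * Affine.CoordinateRing.mk W.toAffine Y ^ M, ?_, ?_⟩⟩
    · rw [map_mul, map_pow, hy, ← IsScalarTower.algebraMap_apply]
      simp [mul_comm]
    · rw [aevalAeval_C, aeval_C, Algebra.algebraMap_self, RingHom.id_apply, sub_self,
        poleOrder_eq_bot_iff.mpr rfl]
      exact WithBot.bot_lt_coe _
  | var_x =>
    refine ⟨1, fun M hM => ⟨-(Affine.CoordinateRing.mk W.toAffine (C X) *
      Affine.CoordinateRing.mk W.toAffine Y ^ (M - 1)), ?_, ?_⟩⟩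
    · obtain ⟨M, rfl⟩ := Nat.exists_eq_add_of_le' hM
      have hx : algebraMap W.toAffine.CoordinateRing W.toAffine.FunctionField
        (Affine.CoordinateRing.mk W.toAffine (C X)) = xFun W := rfl
      rw [map_neg, map_mul, map_pow, hy, hx, aevalAeval_X, tFun, Nat.add_sub_cancel]
      field_simp
      ring
    · obtain ⟨M, rfl⟩ := Nat.exists_eq_add_of_le' hM
      rw [aevalAeval_X, map_zero, zero_mul, sub_zero, poleOrder_neg, poleOrder_mul, hyM,
        poleOrder_mk_X, Nat.add_sub_cancel]
      norm_cast; omega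
  | var_y =>
    refine ⟨1, fun M hM => ⟨-(Affine.CoordinateRing.mk W.toAffine Y ^ (M - 1)), ?_, ?_⟩⟩
    · obtain ⟨M, rfl⟩ := Nat.exists_eq_add_of_le' hM
      rw [map_neg, map_pow, hy, aevalAeval_Y, wFun, Nat.add_sub_cancel]
      field_simp
      ring
    · obtain ⟨M, rfl⟩ := Nat.exists_eq_add_of_le' hM
      rw [aevalAeval_Y, map_zero, zero_mul, sub_zero, poleOrder_neg, hyM, Nat.add_sub_cancel]
      norm_cast; omega
  -- A sum needs both homogenizations at one exponent, which is why the statement covers every `M ≥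
  -- N`.
  | add f g hf hg =>
    obtain ⟨N₁, hf⟩ := hf
    obtain ⟨N₂, hg⟩ := hg
    refine ⟨max N₁ N₂, fun M hM => ?_⟩
    obtain ⟨r, hr, hr'⟩ := hf M ((le_max_left ..).trans hM)
    obtain ⟨s, hs, hs'⟩ := hg M ((le_max_right ..).trans hM)
    refine ⟨r + s, by simp only [map_add, hr, hs, mul_add], ?_⟩
    rw [map_add, map_add, add_mul, add_sub_add_comm]
    exact (poleOrder_add_le (le_max_left ..) (le_max_right ..)).trans_lt (max_lt hr' hs')
  | mul f g hf hg =>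
    obtain ⟨N₁, hf⟩ := hf
    obtain ⟨N₂, hg⟩ := hg
    refine ⟨N₁ + N₂, fun M hM => ?_⟩
    obtain ⟨M, rfl⟩ := Nat.exists_eq_add_of_le hM
    obtain ⟨r, hr, hr'⟩ := hf N₁ le_rfl
    obtain ⟨s, hs, hs'⟩ := hg (N₂ + M) (Nat.le_add_right ..)
    refine ⟨r * s, by simp only [map_mul, hr, hs]; ring, ?_⟩
    set c := algebraMap K W.toAffine.CoordinateRing (aevalAeval (0 : K) (0 : K) f)
    set d := algebraMap K W.toAffine.CoordinateRing (aevalAeval (0 : K) (0 : K) g)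
    have hc : poleOrder W c ≤ 0 := by
      by_cases h : aevalAeval (0 : K) (0 : K) f = 0
      · simp only [c, h, map_zero]; rw [poleOrder_eq_bot_iff.mpr rfl]; exact bot_le
      · exact (poleOrder_algebraMap h).le
    have hd : poleOrder W d ≤ 0 := by
      by_cases h : aevalAeval (0 : K) (0 : K) g = 0
      · simp only [d, h, map_zero]; rw [poleOrder_eq_bot_iff.mpr rfl]; exact bot_le
      · exact (poleOrder_algebraMap h).le
    -- Each of the two terms contains the error term of `f` or of `g` as a factor, so its pole order
    -- is strictly smaller.
    have e : r * s - algebraMap K W.toAffine.CoordinateRing (aevalAeval (0 : K) (0 : K) (f * g)) *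
        Affine.CoordinateRing.mk W.toAffine Y ^ (N₁ + N₂ + M) =
        (r - c * Affine.CoordinateRing.mk W.toAffine Y ^ N₁) * s +
        c * Affine.CoordinateRing.mk W.toAffine Y ^ N₁ *
          (s - d * Affine.CoordinateRing.mk W.toAffine Y ^ (N₂ + M)) := by
      simp only [map_mul, c, d]; ring
    have hsle : poleOrder W s ≤ ((3 * (N₂ + M) : ℕ) : WithBot ℕ) := by
      have : s = (s - d * Affine.CoordinateRing.mk W.toAffine Y ^ (N₂ + M)) +
        d * Affine.CoordinateRing.mk W.toAffine Y ^ (N₂ + M) := by ring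
      rw [this]
      refine poleOrder_add_le hs'.le ?_
      rw [poleOrder_mul, hyM]
      exact (add_le_add_left hd _).trans (zero_add _).le
    rw [e]
    have hM : ((3 * (N₁ + N₂ + M) : ℕ) : WithBot ℕ) =
      ((3 * N₁ : ℕ) : WithBot ℕ) + ((3 * (N₂ + M) : ℕ) : WithBot ℕ) := by norm_cast; ring
    refine (poleOrder_add_le (le_max_left ..) (le_max_right ..)).trans_lt (max_lt ?_ ?_)
    · rw [poleOrder_mul, hM]
      exact (add_le_add_right hsle _).trans_lt
        (WithBot.add_lt_add_right WithBot.coe_ne_bot hr')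
    · rw [poleOrder_mul, poleOrder_mul, hyM, hM]
      exact (add_le_add_left ((add_le_add_left hc _).trans (zero_add _).le) _).trans_lt
        (WithBot.add_lt_add_left WithBot.coe_ne_bot hs')

/-- If the constant term is nonzero, the main term has pole order exactly `3M` and dominates the
error. -/
theorem exists_homogenization_poleOrder (f : K[X][Y]) : ∃ N : ℕ, ∀ M, N ≤ M →
    ∃ r : W.toAffine.CoordinateRing,
      algebraMap _ W.toAffine.FunctionField r = yFun W ^ M * aevalAeval (tFun W) (wFun W) f ∧
      poleOrder W r ≤ ((3 * M : ℕ) : WithBot ℕ) ∧ (aevalAeval (0 : K) (0 : K) f ≠ 0 →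
        poleOrder W r = ((3 * M : ℕ) : WithBot ℕ)) := by
  obtain ⟨N, hN⟩ := exists_homogenization W f
  refine ⟨N, fun M hM => ?_⟩
  obtain ⟨r, hr, hr'⟩ := hN M hM
  have hyM : poleOrder W (Affine.CoordinateRing.mk W.toAffine Y ^ M) =
      ((3 * M : ℕ) : WithBot ℕ) := by
    rw [poleOrder_pow, poleOrder_mk_Y, nsmul_eq_mul, mul_comm]; norm_cast
  set c := aevalAeval (0 : K) (0 : K) f with hc
  have hcy : c ≠ 0 → poleOrder W (algebraMap K _ c * Affine.CoordinateRing.mk W.toAffine Y ^ M) =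
      ((3 * M : ℕ) : WithBot ℕ) := fun h => by
    rw [poleOrder_mul, hyM, poleOrder_algebraMap h, zero_add]
  have hle : poleOrder W r ≤ ((3 * M : ℕ) : WithBot ℕ) := by
    rw [← sub_add_cancel r (algebraMap K _ c * Affine.CoordinateRing.mk W.toAffine Y ^ M)]
    refine poleOrder_add_le hr'.le ?_
    by_cases h : c = 0
    · rw [h, map_zero, zero_mul, poleOrder_eq_bot_iff.mpr rfl]; exact bot_le
    · exact (hcy h).le
  refine ⟨r, hr, hle, fun h => hle.eq_of_not_lt fun hlt => ?_⟩
  have := poleOrder_add_le (a := -(r - algebraMap K _ c *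
    Affine.CoordinateRing.mk W.toAffine Y ^ M)) (b := r)
    ((poleOrder_neg _).le.trans (le_max_left _ (poleOrder W r))) (le_max_right ..)
  rw [neg_sub, sub_add_cancel, hcy h] at this
  exact (this.trans_lt (max_lt hr' hlt)).false

/-- A relation between `t` and `w` with nonzero constant term would homogenize to the zero function,
which does not have pole order `3M`. -/
theorem specializes_infty : Specializes (tFun W) (wFun W) (0 : K) 0 := by
  intro f hf
  by_contra h
  obtain ⟨N, hN⟩ := exists_homogenization_poleOrder W f
  obtain ⟨r, hr, -, hr'⟩ := hN N le_rfl
  rw [hf, mul_zero, FaithfulSMul.algebraMap_eq_zero_iff] at hr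
  have := hr' h
  rw [hr, poleOrder_eq_bot_iff.mpr rfl] at this
  exact WithBot.bot_ne_coe this

variable {W}

/-- A function that is regular everywhere on the curve is constant. -/
theorem exists_eq_algebraMap_of_hasVal_infty {c : W.toAffine.CoordinateRing} {v : K}
    (h : HasVal (tFun W) (wFun W) (0 : K) 0 (algebraMap _ W.toAffine.FunctionField c) v) :
    c = algebraMap K _ v := by
  suffices ∃ u : K, c = algebraMap K _ u by
    obtain ⟨u, rfl⟩ := this
    rw [← IsScalarTower.algebraMap_apply] at h
    rw [h.unique (specializes_infty W) (HasVal.const u)]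
  obtain ⟨a, b, hb, h, -⟩ := h
  obtain ⟨N₁, h₁⟩ := exists_homogenization_poleOrder W a
  obtain ⟨N₂, h₂⟩ := exists_homogenization_poleOrder W b
  obtain ⟨r, hr, hr', -⟩ := h₁ _ (le_max_left N₁ N₂)
  obtain ⟨s, hs, -, hs'⟩ := h₂ _ (le_max_right N₁ N₂)
  -- Numerator and denominator are homogenized with the same exponent `M`, whence `poleOrder c + 3M
  -- ≤ 3M`.
  have key : c * s = r := by
    apply IsFractionRing.injective W.toAffine.CoordinateRing W.toAffine.FunctionField
    rw [map_mul, hs, hr, ← h]; ring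
  rw [← key, poleOrder_mul, hs' hb] at hr'
  apply exists_eq_algebraMap_of_poleOrder_le_one
  cases hc : poleOrder W c with
  | bot => exact bot_le
  | coe n => 
    rw [hc] at hr'
    have hr'' : ((n + 3 * max N₁ N₂ : ℕ) : WithBot ℕ) ≤ ((3 * max N₁ N₂ : ℕ) : WithBot ℕ) := hr'
    have : n = 0 := by
      have : n + 3 * max N₁ N₂ ≤ 3 * max N₁ N₂ := by exact_mod_cast hr''
      omega
    rw [this]
    exact zero_le_one

theorem isBigOInfty_iff {g : W.toAffine.FunctionField} {n : ℕ} :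
    IsBigOInfty g n ↔ ∃ r, ∃ v : K, g = tFun W ^ n * r ∧ HasVal (tFun W) (wFun W) (0 : K) 0 r v := by
  constructor
  · rintro ⟨a, b, hb, h⟩
    have hB := HasVal.of_aevalAeval (tFun W) (wFun W) (0 : K) 0 b
    have hB0 := hB.ne_zero (specializes_infty W) hb
    refine ⟨_, _, ?_, (HasVal.of_aevalAeval (tFun W) (wFun W) (0 : K) 0 a).div
      (specializes_infty W) hB hb⟩
    rw [← mul_div_assoc, ← h, mul_div_cancel_right₀ _ hB0]
  · rintro ⟨r, v, rfl, a, b, hb, h, -⟩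
    exact ⟨a, b, hb, by rw [mul_assoc, h]⟩

theorem IsBigOInfty.hasVal {g : W.toAffine.FunctionField} {n : ℕ} (h : IsBigOInfty g (n + 1)) :
    HasVal (tFun W) (wFun W) (0 : K) 0 g 0 := by
  obtain ⟨r, v, rfl, hr⟩ := isBigOInfty_iff.mp h
  simpa using ((HasVal.fst (tFun W) (wFun W) (0 : K) 0).pow (n + 1)).mul hr

/-- A function that vanishes at infinity is divisible by the uniformizer. -/
theorem HasVal.isBigOInfty [W.IsShortNF] {g : W.toAffine.FunctionField}
    (h : HasVal (tFun W) (wFun W) (0 : K) 0 g 0) :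
    ∃ r, ∃ v : K, g = tFun W * r ∧ HasVal (tFun W) (wFun W) (0 : K) 0 r v := by
  obtain ⟨a, b, hb, h₁, h₂⟩ := h
  rw [zero_mul] at h₂
  have hB := HasVal.of_aevalAeval (tFun W) (wFun W) (0 : K) 0 b
  have hB0 := hB.ne_zero (specializes_infty W) hb
  suffices ∃ r, ∃ v : K, aevalAeval (tFun W) (wFun W) a = tFun W * r ∧
      HasVal (tFun W) (wFun W) (0 : K) 0 r v by
    obtain ⟨r, v, e, hr⟩ := this
    refine ⟨_, _, ?_, hr.div (specializes_infty W) hB hb⟩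
    rw [← mul_div_assoc, ← e, ← h₁, mul_div_cancel_right₀ _ hB0]
  have key (f : K[X][Y]) : ∃ r, ∃ v : K, aevalAeval (tFun W) (wFun W) f =
      algebraMap K _ (aevalAeval (0 : K) (0 : K) f) + tFun W * r ∧
      HasVal (tFun W) (wFun W) (0 : K) 0 r v := by
    have ht := HasVal.fst (tFun W) (wFun W) (0 : K) 0
    have hw := HasVal.snd (tFun W) (wFun W) (0 : K) 0
    induction f using bivariate_induction with
    | const c => exact ⟨0, 0, by simp, by
      simpa using HasVal.const (ξ := tFun W) (η := wFun W) (x := (0 : K)) (y := 0) 0⟩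
    | var_x => exact ⟨1, 1, by rw [aevalAeval_X, aevalAeval_X]; simp, HasVal.one⟩
    -- The curve equation reads `w (1 - A t w - B w²) = t³`, and the bracket has the value 1 at `O`.
    | var_y =>
      have hu : HasVal (tFun W) (wFun W) (0 : K) 0 (1 - algebraMap K W.toAffine.FunctionField W.a₄ * tFun W * wFun W
          - algebraMap K W.toAffine.FunctionField W.a₆ * wFun W ^ 2) (1 - W.a₄ * 0 * 0 - W.a₆ * 0 ^ 2) :=
        (HasVal.one.sub ((ht.const_mul _).mul hw)).sub ((hw.pow 2).const_mul _)
      have hu' : (1 - W.a₄ * 0 * 0 - W.a₆ * 0 ^ 2 : K) ≠ 0 := by simp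
      refine ⟨_, _, ?_, (ht.pow 2).div (specializes_infty W) hu hu'⟩
      have hu0 := hu.ne_zero (specializes_infty W) hu'
      rw [aevalAeval_Y, aevalAeval_Y, map_zero, zero_add, ← mul_div_assoc, eq_div_iff hu0]
      linear_combination wFun_eq W
    | add f g hf hg =>
      obtain ⟨r, v, e, hr⟩ := hf
      obtain ⟨s, u, e', hs⟩ := hg
      exact ⟨r + s, v + u, by simp only [map_add, e, e']; ring, hr.add hs⟩
    | mul f g hf hg =>
      obtain ⟨r, v, e, hr⟩ := hf
      obtain ⟨s, u, e', hs⟩ := hg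
      refine ⟨_, _, ?_, ((hs.const_mul (aevalAeval (0 : K) (0 : K) f)).add
        (hr.const_mul (aevalAeval (0 : K) (0 : K) g))).add ((ht.mul hr).mul hs)⟩
      simp only [map_mul, e, e']; ring
  obtain ⟨r, v, e, hr⟩ := key a
  exact ⟨r, v, by rw [e, ← h₂, map_zero, zero_add], hr⟩

end Infinity

/-! ### The invariant derivation and values at infinitesimal translates -/

section InvariantDerivation

variable {K : Type*} [Field K] (W : WeierstrassCurve K) [W.IsShortNF]

/-- The first order deformation of the coordinate ring along the invariant vector field
`2y ∂/∂x + (3x² + A) ∂/∂y`. -/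
noncomputable def deformCoordinateRing : W.toAffine.CoordinateRing →+* W.toAffine.FunctionField[ε] :=
  -- The map is well defined because the vector field is tangent to the curve: the `ε`-part of the
  -- equation is `2y (3x² + A) = (3x² + A) 2y`.
  AdjoinRoot.lift
    (aeval (R := K) (TrivSqZeroExt.inl (xFun W) + TrivSqZeroExt.inr (2 * yFun W) :
      W.toAffine.FunctionField[ε])).toRingHom
    (TrivSqZeroExt.inl (yFun W) + TrivSqZeroExt.inr (3 * xFun W ^ 2 + algebraMap K _ W.a₄))
    (by
      have h := yFun_sq W
      simp only [Affine.polynomial, a₁_of_isShortNF, a₂_of_isShortNF, a₃_of_isShortNF, C_0, zero_mul, add_zero,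
        eval₂_sub, eval₂_pow, eval₂_X, eval₂_C]
      simp only [AlgHom.toRingHom_eq_coe, RingHom.coe_coe, map_add, map_mul, map_pow, aeval_X,
        aeval_C]
      ext
      · simp [TrivSqZeroExt.algebraMap_eq_inl']
        linear_combination h
      · simp [TrivSqZeroExt.algebraMap_eq_inl', pow_succ]
        ring)

theorem deformCoordinateRing_mk (f : K[X][Y]) :
    deformCoordinateRing W (Affine.CoordinateRing.mk W.toAffine f) =
      aevalAeval (TrivSqZeroExt.inl (xFun W) + TrivSqZeroExt.inr (2 * yFun W) :
        W.toAffine.FunctionField[ε]) (TrivSqZeroExt.inl (yFun W) +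
          TrivSqZeroExt.inr (3 * xFun W ^ 2 + algebraMap K _ W.a₄)) f := by
  induction f using bivariate_induction with
  | const c => simp [deformCoordinateRing]
  | var_x => rw [aevalAeval_X]; simp [deformCoordinateRing]
  | var_y => rw [aevalAeval_Y]; simp [deformCoordinateRing]
  | add f g hf hg => rw [map_add, map_add, map_add, hf, hg]
  | mul f g hf hg => rw [map_mul, map_mul, map_mul, hf, hg]

theorem fst_deformCoordinateRing (a : W.toAffine.CoordinateRing) :
    (deformCoordinateRing W a).fst = algebraMap _ W.toAffine.FunctionField a := by
  obtain ⟨f, rfl⟩ := AdjoinRoot.mk_surjective a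
  rw [deformCoordinateRing_mk]
  have := algHom_aevalAeval (TrivSqZeroExt.fstHom K W.toAffine.FunctionField
    W.toAffine.FunctionField) (TrivSqZeroExt.inl (xFun W) + TrivSqZeroExt.inr (2 * yFun W))
    (TrivSqZeroExt.inl (yFun W) +
          TrivSqZeroExt.inr (3 * xFun W ^ 2 + algebraMap K _ W.a₄)) f
  rw [TrivSqZeroExt.fstHom_apply] at this
  rw [this]
  simp only [TrivSqZeroExt.fstHom_apply, TrivSqZeroExt.fst_add, TrivSqZeroExt.fst_inl,
    TrivSqZeroExt.fst_inr, add_zero]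
  rw [← polyFun_eq_aevalAeval]
  rfl

/-- The first order deformation of the function field along the invariant vector field. -/
noncomputable def deform : W.toAffine.FunctionField →+* W.toAffine.FunctionField[ε] :=
  IsLocalization.lift (M := nonZeroDivisors W.toAffine.CoordinateRing)
    -- A dual number with invertible first component is a unit, so the deformation extends to
    -- fractions.
    (g := deformCoordinateRing W) fun a => by
      rw [TrivSqZeroExt.isUnit_iff_isUnit_fst, fst_deformCoordinateRing, isUnit_iff_ne_zero]
      exact IsFractionRing.to_map_ne_zero_of_mem_nonZeroDivisors a.2

theorem deform_algebraMap (a : W.toAffine.CoordinateRing) :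
    deform W (algebraMap _ _ a) = deformCoordinateRing W a :=
  IsLocalization.lift_eq _ _

theorem fst_deform (g : W.toAffine.FunctionField) : (deform W g).fst = g := by
  have : ((TrivSqZeroExt.fstHom K W.toAffine.FunctionField W.toAffine.FunctionField :
      W.toAffine.FunctionField[ε] →+* W.toAffine.FunctionField).comp (deform W)) =
      RingHom.id _ := by
    refine IsLocalization.ringHom_ext (nonZeroDivisors W.toAffine.CoordinateRing)
      (RingHom.ext fun a => ?_)
    simp only [RingHom.comp_apply, deform_algebraMap, RingHom.id_apply, RingHom.coe_coe,
      TrivSqZeroExt.fstHom_apply, fst_deformCoordinateRing]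
  exact congr($this g)

/-- The invariant derivation `2y d/dx = (3x² + A) d/dy` of the function field. -/
noncomputable def invDer :
    Derivation K W.toAffine.FunctionField W.toAffine.FunctionField :=
  Derivation.mk'
    { toFun := fun g => (deform W g).snd
      map_add' := fun g h => by rw [map_add, TrivSqZeroExt.snd_add]
      map_smul' := fun c g => by
        have hc : deform W (algebraMap K _ c) = TrivSqZeroExt.inl (algebraMap K _ c) := by
          rw [IsScalarTower.algebraMap_apply K W.toAffine.CoordinateRing W.toAffine.FunctionField,
            deform_algebraMap]
          have := deformCoordinateRing_mk W (C (C c))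
          rw [aevalAeval_C, aeval_C] at this
          rw [← IsScalarTower.algebraMap_apply]
          exact this
        rw [Algebra.smul_def, map_mul, hc]
        simp [Algebra.smul_def] }
    (fun g h => by
      simp [fst_deform, mul_comm])

theorem invDer_apply (g : W.toAffine.FunctionField) : invDer W g = (deform W g).snd := rfl

theorem invDer_xFun : invDer W (xFun W) = 2 * yFun W := by
  rw [invDer_apply, xFun, polyFun, deform_algebraMap, deformCoordinateRing_mk, aevalAeval_X]
  simp [yFun]

theorem invDer_yFun : invDer W (yFun W) = 3 * xFun W ^ 2 + algebraMap K _ W.a₄ := by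
  rw [invDer_apply, yFun, polyFun, deform_algebraMap, deformCoordinateRing_mk, aevalAeval_Y]
  simp

theorem invDer_wFun : invDer W (wFun W) = 3 * tFun W ^ 2 + algebraMap K _ W.a₄ * wFun W ^ 2 := by
  have hy := yFun_ne_zero W
  have h : wFun W * yFun W = -1 := by rw [wFun]; field_simp
  have h' := congrArg (invDer W) h
  rw [Derivation.leibniz, invDer_yFun, map_neg, Derivation.map_one_eq_zero, neg_zero, smul_eq_mul,
    smul_eq_mul] at h'
  have : invDer W (wFun W) = -wFun W * (3 * xFun W ^ 2 + algebraMap K _ W.a₄) / yFun W := by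
    rw [eq_div_iff hy]; linear_combination h'
  rw [this, wFun, tFun]; field_simp

/-- The right side is regular at `O` with value 1. Hence the leading coefficient of `t₂ ∘ φ` is also
the factor by which `φ` scales `D`. -/
theorem invDer_tFun : invDer W (tFun W) = 1 - 2 * algebraMap K _ W.a₄ * tFun W * wFun W
    - 3 * algebraMap K _ W.a₆ * wFun W ^ 2 := by
  have h : tFun W = xFun W * wFun W := by
    rw [tFun, wFun]; ring
  have hy := yFun_ne_zero W
  rw [h, Derivation.leibniz, invDer_xFun, invDer_wFun, smul_eq_mul, smul_eq_mul, tFun, wFun]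
  field_simp
  linear_combination -3 * yFun_sq W

/-- The derivatives of `x` and `y` as polynomials in `x` and `y`. -/
noncomputable def dxPoly (_ : WeierstrassCurve K) : K[X][Y] := 2 * Y

noncomputable def dyPoly (W : WeierstrassCurve K) : K[X][Y] := 3 * (C X) ^ 2 + C (C W.a₄)

theorem invDer_xFun_eq : invDer W (xFun W) = aevalAeval (xFun W) (yFun W) (dxPoly W) := by
  rw [invDer_xFun, dxPoly, map_mul, aevalAeval_Y, map_ofNat]

theorem invDer_yFun_eq : invDer W (yFun W) = aevalAeval (xFun W) (yFun W) (dyPoly W) := by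
  rw [invDer_yFun, dyPoly, map_add, map_mul, map_pow, aevalAeval_X, map_ofNat]; simp

variable {W}

theorem HasVal.invDer_affine {x y v : K} (h : W.toAffine.Equation x y)
    {g : W.toAffine.FunctionField} (hg : HasVal (xFun W) (yFun W) x y g v) :
    ∃ v', HasVal (xFun W) (yFun W) x y (invDer W g) v' :=
  hg.derivation (invDer_xFun_eq W) (invDer_yFun_eq W) (specializes_of_equation W h)

theorem HasVal.invDer_infty {v : K}
    {g : W.toAffine.FunctionField} (hg : HasVal (tFun W) (wFun W) (0 : K) 0 g v) :
    ∃ v', HasVal (tFun W) (wFun W) (0 : K) 0 (invDer W g) v' :=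
  hg.derivation
    (a₁ := 1 - 2 * C (C W.a₄) * C X * Y - 3 * C (C W.a₆) * Y ^ 2)
    (a₂ := 3 * (C X) ^ 2 + C (C W.a₄) * Y ^ 2)
    (by
      rw [invDer_tFun]
      simp only [map_sub, map_mul, map_one, map_pow, map_ofNat, aevalAeval_Y,
        aevalAeval_C, aeval_C, aeval_X])
    (by
      rw [invDer_wFun]
      simp only [map_add, map_mul, map_pow, map_ofNat, aevalAeval_Y,
        aevalAeval_C, aeval_C, aeval_X])
    (specializes_infty W)

/-- The value of `g` at `P + O_k` is `g(P) - k (D g)(P) ε`. -/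
theorem HasVal.hasValue_translate {x y v v' : K} (h : W.toAffine.Equation x y)
    {g : W.toAffine.FunctionField} (hg : HasVal (xFun W) (yFun W) x y g v)
    (hg' : HasVal (xFun W) (yFun W) x y (invDer W g) v') (k : K) :
    HasValue g (TrivSqZeroExt.inl x - TrivSqZeroExt.inr (k * (2 * y)) : K[ε])
      (TrivSqZeroExt.inl y - TrivSqZeroExt.inr (k * (3 * x ^ 2 + W.a₄)))
      (TrivSqZeroExt.inl v - TrivSqZeroExt.inr (k * v')) := by
  have hs := specializes_of_equation W h
  obtain ⟨a, b, hb, e₁, e₂⟩ := id hg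
  obtain ⟨a', ha', ha⟩ := exists_derivation_aevalAeval (invDer W) _ _ (invDer_xFun_eq W)
    (invDer_yFun_eq W) a
  obtain ⟨b', hb', hbb⟩ := exists_derivation_aevalAeval (invDer W) _ _ (invDer_xFun_eq W)
    (invDer_yFun_eq W) b
  have hx : aevalAeval x y (dxPoly W) = 2 * y := by
    rw [dxPoly, map_mul, aevalAeval_Y, map_ofNat]
  have hy : aevalAeval x y (dyPoly W) = 3 * x ^ 2 + W.a₄ := by
    rw [dyPoly, map_add, map_mul, map_pow, aevalAeval_X, map_ofNat]; simp
  have ha := ha x y k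
  have hbb := hbb x y k
  rw [hx, hy] at ha hbb
  -- The derivative of `g b = a`, evaluated at the point. This is the `ε`-part of the equation to be
  -- shown.
  have key : v' * aevalAeval x y b = aevalAeval x y a' - v * aevalAeval x y b' := by
    refine HasVal.unique hs (hg'.mul (.of_aevalAeval _ _ _ _ b)) ?_
    have e := congrArg (invDer W) e₁
    rw [Derivation.leibniz, ha', hb', smul_eq_mul, smul_eq_mul] at e
    have : invDer W g * aevalAeval (xFun W) (yFun W) b =
      aevalAeval (xFun W) (yFun W) a' - g * aevalAeval (xFun W) (yFun W) b' := by
      linear_combination e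
    rw [this]
    exact (HasVal.of_aevalAeval _ _ _ _ a').sub (hg.mul (.of_aevalAeval _ _ _ _ b'))
  refine ⟨a, b, ?_, ?_, ?_⟩
  · rw [hbb, TrivSqZeroExt.isUnit_iff_isUnit_fst]
    simpa using hb
  · rw [polyFun_eq_aevalAeval, polyFun_eq_aevalAeval, e₁]
  · rw [hbb, ha, ← e₂]
    clear hbb ha
    generalize aevalAeval x y b = β at *
    generalize aevalAeval x y b' = β' at *
    generalize aevalAeval x y a' = α' at *
    ext
    · simp
    · simp
      linear_combination -k * key

/-- Both sides are derivations along `σ`, so agreement on the generators `x`, `y` extends to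
polynomials by the product rule and to fractions by the quotient rule. -/
theorem invDer_eq_of_eq_on {L : Type*} [Field L] [Algebra K L] (σ : W.toAffine.FunctionField →ₐ[K] L)
    (D : Derivation K L L) (m : L)
    (hx : D (σ (xFun W)) = m * σ (invDer W (xFun W)))
    (hy : D (σ (yFun W)) = m * σ (invDer W (yFun W))) (g : W.toAffine.FunctionField) :
    D (σ g) = m * σ (invDer W g) := by
  have hp (f : K[X][Y]) : D (σ (polyFun W f)) = m * σ (invDer W (polyFun W f)) := by
    simp only [polyFun_eq_aevalAeval]
    induction f using bivariate_induction with
    | const c => simp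
    | var_x => simpa only [aevalAeval_X] using hx
    | var_y => simpa only [aevalAeval_Y] using hy
    | add f g hf hg => simp only [map_add, hf, hg, mul_add]
    | mul f g hf hg =>
      simp only [map_mul, Derivation.leibniz, map_add, hf, hg, smul_eq_mul]; ring
  obtain ⟨a, b, hb, rfl⟩ := exists_polyFun_div W g
  have hb' : σ (polyFun W b) ≠ 0 := (map_ne_zero σ).mpr hb
  have e : polyFun W a / polyFun W b * polyFun W b = polyFun W a := div_mul_cancel₀ _ hb
  set g := polyFun W a / polyFun W b
  have h₁ := congrArg (fun z => D (σ z)) e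
  have h₂ := congrArg (fun z => m * σ (invDer W z)) e
  simp only [map_mul, Derivation.leibniz, hp, smul_eq_mul, map_add] at h₁ h₂
  apply mul_right_cancel₀ hb'
  linear_combination h₁ - h₂

/-- In characteristic `p` the degree may drop by more than one, so only an inequality holds. Writing
the degree as `d + 1` avoids subtraction in `WithBot ℕ`. -/
theorem derivative_eq_zero_or_degree {R : Type*} [CommRing R] (q : R[X]) :
    derivative q = 0 ∨ ∃ d : ℕ, q.degree = ((d + 1 : ℕ) : WithBot ℕ) ∧
      (derivative q).degree ≤ (d : WithBot ℕ) := by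
  refine or_iff_not_imp_left.mpr fun h => ?_
  have h0 : q.natDegree ≠ 0 := fun h0 => h (by
    rw [natDegree_eq_zero] at h0
    obtain ⟨c, rfl⟩ := h0
    exact derivative_C)
  refine ⟨q.natDegree - 1, ?_, ?_⟩
  · rw [Nat.sub_add_cancel (Nat.one_le_iff_ne_zero.mpr h0)]
    exact degree_eq_natDegree fun h' => h (by rw [h', derivative_zero])
  · exact degree_le_natDegree.trans (by exact_mod_cast natDegree_derivative_le q)

/-- The invariant derivation raises the pole order at infinity by at most one. -/
theorem exists_invDer_coordinateRing (a : W.toAffine.CoordinateRing) :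
    ∃ a' : W.toAffine.CoordinateRing, invDer W (algebraMap _ _ a) = algebraMap _ _ a' ∧
      poleOrder W a' ≤ poleOrder W a + 1 := by
  obtain ⟨p, q, rfl⟩ := Affine.CoordinateRing.exists_smul_basis_eq a
  have hmap (r s : K[X]) : algebraMap W.toAffine.CoordinateRing W.toAffine.FunctionField
      (r • (1 : W.toAffine.CoordinateRing) + s • Affine.CoordinateRing.mk W.toAffine Y) =
      aeval (xFun W) r + aeval (xFun W) s * yFun W := by
    rw [Affine.CoordinateRing.smul, Affine.CoordinateRing.smul, mul_one, ← map_mul, ← map_add]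
    refine (polyFun_eq_aevalAeval W _).trans ?_
    rw [map_add, map_mul, aevalAeval_C, aevalAeval_C, aevalAeval_Y]
  -- `D(p + q y) = 2 p' y + 2 q' y² + q (3x² + A)`, with `y²` replaced by the cubic in `x`.
  refine ⟨(2 * derivative q * (X ^ 3 + C W.a₄ * X + C W.a₆) + q * (3 * X ^ 2 + C W.a₄)) •
    (1 : W.toAffine.CoordinateRing) + (2 * derivative p) • Affine.CoordinateRing.mk W.toAffine Y,
    ?_, ?_⟩
  · rw [hmap, hmap, map_add, Derivation.leibniz, Derivation.map_aeval, Derivation.map_aeval,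
      invDer_xFun, invDer_yFun]
    simp only [map_add, map_mul, map_pow, aeval_X, aeval_C, map_ofNat, smul_eq_mul]
    linear_combination 2 * aeval (xFun W) (derivative q) * yFun_sq W
  · obtain ⟨h₁, h₂⟩ := (poleOrder_le_iff p q _).mp
      (le_refl (poleOrder W (p • 1 + q • Affine.CoordinateRing.mk W.toAffine Y)))
    rw [poleOrder_le_iff]
    have hc2 : (2 : K[X]).degree ≤ 0 := degree_C_le (a := (2 : K))
    constructor
    · refine le_trans ?_ (add_le_add_left h₂ 1)
      have hd : (2 * derivative q * (X ^ 3 + C W.a₄ * X + C W.a₆) +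
          q * (3 * X ^ 2 + C W.a₄)).degree ≤ q.degree + 2 := by
        have hq : (3 * X ^ 2 + C W.a₄ : K[X]).degree ≤ 2 := by compute_degree
        refine (degree_add_le _ _).trans (max_le ?_ ?_)
        · rcases derivative_eq_zero_or_degree q with h | ⟨d, h, h'⟩
          · rw [h]; simp
          · have h3 : (X ^ 3 + C W.a₄ * X + C W.a₆ : K[X]).degree ≤ 3 := by compute_degree
            rw [degree_mul, degree_mul, h]
            refine (add_le_add (add_le_add hc2 h') h3).trans ?_
            rw [zero_add]
            norm_cast
        · rw [degree_mul]
          exact add_le_add_right hq _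
      refine (nsmul_le_nsmul_right hd 2).trans ?_
      rw [nsmul_add, add_assoc]
      exact add_le_add_right (by norm_num) _
    · refine le_trans ?_ (add_le_add_left h₁ 1)
      rcases derivative_eq_zero_or_degree p with h | ⟨d, h, h'⟩
      · rw [h]; simp
      · rw [degree_mul, h]
        refine (add_le_add_left (nsmul_le_nsmul_right (add_le_add hc2 h') 2) 3).trans ?_
        rw [zero_add, two_nsmul, two_nsmul]
        norm_cast
        omega

end InvariantDerivation

/-! ### Points, maximal ideals and the class group -/

section PointIdeal

open Affine Affine.CoordinateRing

variable {K : Type*} [Field K] (W : WeierstrassCurve K)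

theorem finite_coordinateRing : Module.Finite K[X] W.toAffine.CoordinateRing :=
  .of_basis (CoordinateRing.basis W.toAffine)

instance : IsNoetherianRing W.toAffine.CoordinateRing :=
  have := finite_coordinateRing W
  IsNoetherianRing.of_finite K[X] _

instance : Algebra.FiniteType K W.toAffine.CoordinateRing :=
  have := finite_coordinateRing W
  .trans (S := K[X]) inferInstance inferInstance

theorem isMaximal_of_isPrime_of_ne_bot {P : Ideal W.toAffine.CoordinateRing} [hP : P.IsPrime]
    (h : P ≠ ⊥) : P.IsMaximal := by
  have := finite_coordinateRing W
  obtain ⟨a, ha, ha0⟩ := Submodule.exists_mem_ne_zero_of_ne_bot h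
  have hc : P.comap (algebraMap K[X] W.toAffine.CoordinateRing) ≠ ⊥ :=
    Ideal.comap_ne_bot_of_integral_mem ha0 ha (Algebra.IsIntegral.isIntegral a)
  have : (P.comap (algebraMap K[X] W.toAffine.CoordinateRing)).IsMaximal :=
    Ideal.IsPrime.isMaximal inferInstance hc
  exact Ideal.isMaximal_of_isIntegral_of_isMaximal_comap P this

theorem isMaximal_XYIdeal {x y : K} (h : W.toAffine.Equation x y) :
    (XYIdeal W.toAffine x (C y)).IsMaximal := by
  have e := quotientXYIdealEquiv (W' := W.toAffine) (x := x) (y := C y) h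
  exact Ideal.Quotient.maximal_of_isField _ (e.toMulEquiv.isField (Field.toIsField K))

variable [W.IsShortNF]

theorem mk_mem_XYIdeal_iff {x y : K} (h : W.toAffine.Equation x y) (f : K[X][Y]) :
    CoordinateRing.mk W.toAffine f ∈ XYIdeal W.toAffine x (C y) ↔ aevalAeval x y f = 0 := by
  constructor
  · intro hf
    obtain ⟨a, b, hab⟩ := Ideal.mem_span_pair.mp hf
    obtain ⟨a, rfl⟩ := AdjoinRoot.mk_surjective a
    obtain ⟨b, rfl⟩ := AdjoinRoot.mk_surjective b
    have := aevalAeval_eq_of_polyFun_eq W (R := K) ((equation_iff_short W).mp h) (f := f)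
      (g := a * C (X - C x) + b * (Y - C (C y)))
      (congrArg (algebraMap _ W.toAffine.FunctionField)
        (hab.symm.trans (by rw [map_add, map_mul, map_mul]; rfl)))
    rw [this]
    simp only [map_add, map_mul, map_sub, aevalAeval_C, aevalAeval_Y, aeval_X, aeval_C,
      Algebra.algebraMap_self, RingHom.id_apply, sub_self, mul_zero, add_zero]
  · intro hf
    -- Modulo the ideal of the point every function is congruent to its value.
    have key (f : K[X][Y]) : CoordinateRing.mk W.toAffine (f - C (C (aevalAeval x y f))) ∈
        XYIdeal W.toAffine x (C y) := by
      induction f using bivariate_induction with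
      | const c => simp
      | var_x =>
        rw [aevalAeval_X, ← C_sub]
        exact Ideal.subset_span (by simp [XClass])
      | var_y =>
        rw [aevalAeval_Y]
        exact Ideal.subset_span (by simp [YClass])
      | add f g hf hg =>
        have := add_mem hf hg
        rw [← map_add] at this
        convert this using 2
        simp only [map_add]; ring
      | mul f g hf hg =>
        have := add_mem (Ideal.mul_mem_right (CoordinateRing.mk W.toAffine g) _ hf)
          (Ideal.mul_mem_left _ (CoordinateRing.mk W.toAffine (C (C (aevalAeval x y f)))) hg)
        rw [← map_mul, ← map_mul, ← map_add] at this
        convert this using 2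
        simp only [map_mul]; ring
    simpa [hf] using key f

theorem hasVal_iff_exists_mem {x y : K} (h : W.toAffine.Equation x y)
    {g : W.toAffine.FunctionField} : (∃ v, HasVal (xFun W) (yFun W) x y g v) ↔
      ∃ s ∉ XYIdeal W.toAffine x (C y), ∃ r : W.toAffine.CoordinateRing,
        g * algebraMap _ _ s = algebraMap _ _ r := by
  constructor
  · rintro ⟨v, a, b, hb, h₁, -⟩
    refine ⟨CoordinateRing.mk _ b, by rwa [mk_mem_XYIdeal_iff W h], CoordinateRing.mk _ a, ?_⟩
    rw [← polyFun_eq_aevalAeval, ← polyFun_eq_aevalAeval] at h₁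
    exact h₁
  · rintro ⟨s, hs, r, e⟩
    obtain ⟨b, rfl⟩ := AdjoinRoot.mk_surjective s
    obtain ⟨a, rfl⟩ := AdjoinRoot.mk_surjective r
    have hb : aevalAeval x y b ≠ 0 := fun h0 => hs ((mk_mem_XYIdeal_iff W h b).mpr h0)
    refine ⟨aevalAeval x y a / aevalAeval x y b, a, b, hb, ?_, div_mul_cancel₀ _ hb⟩
    rw [← polyFun_eq_aevalAeval, ← polyFun_eq_aevalAeval]
    exact e

theorem hasVal_zero_iff_mem {x y : K} (h : W.toAffine.Equation x y)
    (a : W.toAffine.CoordinateRing) :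
    HasVal (xFun W) (yFun W) x y (algebraMap _ W.toAffine.FunctionField a) 0 ↔
      a ∈ XYIdeal W.toAffine x (C y) := by
  obtain ⟨f, rfl⟩ := AdjoinRoot.mk_surjective a
  have hf : HasVal (xFun W) (yFun W) x y (polyFun W f) (aevalAeval x y f) := by
    rw [polyFun_eq_aevalAeval]; exact .of_aevalAeval ..
  rw [mk_mem_XYIdeal_iff W h]
  constructor
  · intro h0
    exact hf.unique (specializes_of_equation W h) h0
  · intro h0
    rw [h0] at hf
    exact hf

omit [W.IsShortNF] in
/-- The ideal of an affine point is locally principal at that point. -/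
theorem exists_local_generator {x y : K} (h : W.toAffine.Nonsingular x y) :
    ∃ π ∈ XYIdeal W.toAffine x (C y), ∃ s ∉ XYIdeal W.toAffine x (C y),
      ∀ i ∈ XYIdeal W.toAffine x (C y), ∃ r, s * i = r * π := by
  set I := XYIdeal W.toAffine x (C y) with hI
  have hmul := XYIdeal_neg_mul h
  have hX0 : XClass W.toAffine x ≠ 0 := XClass_ne_zero x
  have hdvd {j i : W.toAffine.CoordinateRing} (hj : j ∈ XYIdeal W.toAffine x (C (W.toAffine.negY x y)))
      (hi : i ∈ I) : ∃ s, j * i = XClass W.toAffine x * s := by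
    have : j * i ∈ XIdeal W.toAffine x := hmul ▸ Ideal.mul_mem_mul hj hi
    obtain ⟨s, hs⟩ := Ideal.mem_span_singleton.mp this
    exact ⟨s, hs⟩
  -- The ideal `I` of the point times the ideal of the opposite point is generated by `X - x`. If
  -- every product `j i` were `(X - x) s` with `s ∈ I`, then `(X - x) ⊆ (X - x) I`, which is
  -- impossible. An `i` with `s ∉ I` generates `I` locally.
  have hex : ∃ j ∈ XYIdeal W.toAffine x (C (W.toAffine.negY x y)), ∃ i ∈ I, ∃ s ∉ I,
      j * i = XClass W.toAffine x * s := by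
    by_contra! hcon
    have hle : XIdeal W.toAffine x ≤ XIdeal W.toAffine x * I := by
      conv_lhs => rw [← hmul]
      refine Ideal.mul_le.mpr fun j hj i hi => ?_
      obtain ⟨s, hs⟩ := hdvd hj hi
      have hsI : s ∈ I := by
        by_contra hsI
        exact hcon j hj i hi s hsI hs
      rw [hs]
      exact Ideal.mul_mem_mul (Ideal.mem_span_singleton_self _) hsI
    obtain ⟨z, hz, hz'⟩ := Ideal.mem_span_singleton_mul.mp
      (hle (Ideal.mem_span_singleton_self _))
    have : z = 1 := mul_left_cancel₀ hX0 (hz'.trans (mul_one _).symm)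
    exact (isMaximal_XYIdeal W h.1).ne_top ((Ideal.eq_top_iff_one _).mpr (this ▸ hz))
  obtain ⟨j, hj, i, hi, s, hs, hjs⟩ := hex
  refine ⟨i, hi, s, hs, fun k hk => ?_⟩
  obtain ⟨r, hr⟩ := hdvd hj hk
  refine ⟨r, mul_left_cancel₀ hX0 ?_⟩
  linear_combination i * hr - k * hjs

variable [IsAlgClosed K]

-- Nullstellensatz: the residue field is finite over `K`, hence equal to the algebraically closed
-- field `K`.
omit [W.IsShortNF] in
theorem algebraMap_quotient_surjective {A : Type*} [CommRing A] [Algebra K A]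
    [Algebra.FiniteType K A] (M : Ideal A) [hM : M.IsMaximal] :
    Function.Surjective (algebraMap K (A ⧸ M)) := by
  let _ := Ideal.Quotient.field M
  have := finite_of_finite_type_of_isJacobsonRing K (A ⧸ M)
  exact (IsAlgClosed.algebraMap_bijective_of_isIntegral (k := K) (K := A ⧸ M)).2

theorem exists_eq_XYIdeal (M : Ideal W.toAffine.CoordinateRing) [hM : M.IsMaximal] :
    ∃ x y, W.toAffine.Equation x y ∧ M = XYIdeal W.toAffine x (C y) := by
  obtain ⟨x, hx⟩ := algebraMap_quotient_surjective (K := K) M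
    (Ideal.Quotient.mk M (CoordinateRing.mk W.toAffine (C X)))
  obtain ⟨y, hy⟩ := algebraMap_quotient_surjective (K := K) M
    (Ideal.Quotient.mk M (CoordinateRing.mk W.toAffine Y))
  have hev (f : K[X][Y]) : Ideal.Quotient.mk M (CoordinateRing.mk W.toAffine f) =
      algebraMap K _ (aevalAeval x y f) := by
    induction f using bivariate_induction with
    | const c => rw [aevalAeval_C, aeval_C]; rfl
    | var_x => rw [aevalAeval_X, hx]
    | var_y => rw [aevalAeval_Y, hy]
    | add f g hf hg => simp only [map_add, hf, hg]
    | mul f g hf hg => simp only [map_mul, hf, hg]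
  have h : W.toAffine.Equation x y := by
    have h0 := hev W.toAffine.polynomial
    rw [AdjoinRoot.mk_self, map_zero, eq_comm, FaithfulSMul.algebraMap_eq_zero_iff] at h0
    rw [equation_iff_short]
    simp only [Affine.polynomial, a₁_of_isShortNF, a₂_of_isShortNF, a₃_of_isShortNF, map_add,
      map_sub, map_mul, map_pow, aevalAeval_C, aevalAeval_Y, aeval_X, aeval_C, zero_mul, map_zero,
      add_zero] at h0
    exact sub_eq_zero.mp h0
  refine ⟨x, y, h, ((isMaximal_XYIdeal W h).eq_of_le hM.ne_top fun a ha => ?_).symm⟩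
  obtain ⟨f, rfl⟩ := AdjoinRoot.mk_surjective a
  rw [mk_mem_XYIdeal_iff W h] at ha
  rw [← Ideal.Quotient.eq_zero_iff_mem]
  exact (hev f).trans (by rw [ha, map_zero])

variable [W.IsElliptic]

/-- A nonzero prime is the ideal of a point, and a nonsingular point has a locally principal ideal,
so the localizations are discrete valuation rings. -/
instance : IsDedekindDomainDvr W.toAffine.CoordinateRing where
  toIsNoetherian := inferInstanceAs (IsNoetherianRing W.toAffine.CoordinateRing)
  is_dvr_at_nonzero_prime P hP _ := by
    have hmax := isMaximal_of_isPrime_of_ne_bot W hP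
    obtain ⟨x, y, h, rfl⟩ := exists_eq_XYIdeal W P
    have h' := (Affine.equation_iff_nonsingular (W := W.toAffine)).mp h
    set P := XYIdeal W.toAffine x (C y)
    have : IsNoetherianRing (Localization.AtPrime P) :=
      IsLocalization.isNoetherianRing P.primeCompl _ inferInstance
    have hinj : Function.Injective (algebraMap W.toAffine.CoordinateRing
      (Localization.AtPrime P)) :=
      IsLocalization.injective _ P.primeCompl_le_nonZeroDivisors
    have : IsDomain (Localization.AtPrime P) :=
      IsLocalization.isDomain_localization P.primeCompl_le_nonZeroDivisors
    have hnf : ¬ IsField (Localization.AtPrime P) := by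
      rw [IsLocalRing.isField_iff_maximalIdeal_eq, ← Localization.AtPrime.map_eq_maximalIdeal,
        Ideal.map_eq_bot_iff_of_injective hinj]
      exact hP
    refine ((IsDiscreteValuationRing.TFAE _ hnf).out 0 4).mpr ?_
    obtain ⟨π, hπ, s, hs, hdvd⟩ := exists_local_generator W h'
    refine ⟨algebraMap _ _ π, ?_⟩
    rw [← Localization.AtPrime.map_eq_maximalIdeal]
    refine le_antisymm (Ideal.map_le_iff_le_comap.mpr fun i hi => ?_)
      ((Ideal.span_singleton_le_iff_mem _).mpr (Ideal.mem_map_of_mem _ hπ))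
    obtain ⟨r, hr⟩ := hdvd i hi
    have hsu : IsUnit (algebraMap _ (Localization.AtPrime P) s) :=
      IsLocalization.map_units (M := P.primeCompl) (Localization.AtPrime P) ⟨s, hs⟩
    refine Ideal.mem_comap.mpr (Ideal.mem_span_singleton.mpr ?_)
    rw [← hsu.dvd_mul_left, ← map_mul, hr, map_mul]
    exact dvd_mul_left _ _

instance : IsDedekindDomain W.toAffine.CoordinateRing := inferInstance

omit [W.IsElliptic] in
/-- A function that is regular at all affine points belongs to the coordinate ring. -/
theorem exists_eq_algebraMap_of_forall_hasVal {g : W.toAffine.FunctionField}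
    (h : ∀ x y, W.toAffine.Equation x y → ∃ v, HasVal (xFun W) (yFun W) x y g v) :
    ∃ a : W.toAffine.CoordinateRing, g = algebraMap _ _ a := by
  -- The ideal of denominators of `g`. Regularity at each point says that it lies in no maximal
  -- ideal.
  let J : Ideal W.toAffine.CoordinateRing :=
    { carrier := {s | ∃ r : W.toAffine.CoordinateRing, g * algebraMap _ _ s = algebraMap _ _ r}
      add_mem' := by
        rintro s t ⟨r, hr⟩ ⟨r', hr'⟩
        exact ⟨r + r', by rw [map_add, mul_add, hr, hr', map_add]⟩
      zero_mem' := ⟨0, by simp⟩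
      smul_mem' := by
        rintro c s ⟨r, hr⟩
        exact ⟨c * r, by rw [smul_eq_mul, map_mul, map_mul, ← hr]; ring⟩ }
  have hJ : J = ⊤ := by
    by_contra hne
    obtain ⟨M, hM, hle⟩ := Ideal.exists_le_maximal J hne
    obtain ⟨x, y, he, rfl⟩ := exists_eq_XYIdeal W M
    obtain ⟨s, hs, r, hr⟩ := (hasVal_iff_exists_mem W he).mp (h x y he)
    exact hs (hle ⟨r, hr⟩)
  obtain ⟨r, hr⟩ := (Ideal.eq_top_iff_one J).mp hJ
  exact ⟨r, by rw [← hr, map_one, mul_one]⟩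

omit [W.IsShortNF] [IsAlgClosed K] [W.IsElliptic] in
variable {W} in
/-- The ideal of functions in the coordinate ring which vanish at a point. -/
noncomputable def pointIdeal : W.toAffine.Point → Ideal W.toAffine.CoordinateRing
  | .zero => ⊤
  | .some x y _ => XYIdeal W.toAffine x (C y)

variable {W}

omit [W.IsShortNF] [IsAlgClosed K] [W.IsElliptic]

theorem pointIdeal_zero : pointIdeal (0 : W.toAffine.Point) = ⊤ := rfl

theorem pointIdeal_ne_bot (P : W.toAffine.Point) : pointIdeal P ≠ ⊥ := by
  cases P with
  | zero => exact top_ne_bot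
  | some x y h =>
    intro h0
    have : XClass W.toAffine x ∈ pointIdeal (.some x y h) := Ideal.subset_span (by simp)
    rw [h0, Ideal.mem_bot] at this
    exact XClass_ne_zero x this

variable [W.IsShortNF] [IsAlgClosed K] [W.IsElliptic] [DecidableEq K]

theorem toClass_eq_mk0 (P : W.toAffine.Point) : Point.toClass P = Additive.ofMul
    (ClassGroup.mk0 ⟨pointIdeal P, mem_nonZeroDivisors_of_ne_zero (pointIdeal_ne_bot P)⟩) := by
  cases P with
  | zero =>
    have : (⟨pointIdeal .zero, mem_nonZeroDivisors_of_ne_zero (pointIdeal_ne_bot _)⟩ :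
      nonZeroDivisors (Ideal W.toAffine.CoordinateRing)) = 1 :=
      Subtype.ext Ideal.one_eq_top.symm
    rw [this, map_one]
    rfl
  | some x y h =>
    rw [Point.toClass_some, ← ClassGroup.mk_mk0 W.toAffine.FunctionField]
    exact congrArg (fun I => Additive.ofMul (ClassGroup.mk _ I)) (Units.ext rfl)

/-- The group law embeds in the ideal class group, with `O` corresponding to the unit ideal. In this
form it is carried along by any multiplicative map of ideals that preserves nonzero principal
ideals. -/
theorem add_eq_iff_pointIdeal (P Q R : W.toAffine.Point) :
    P + Q = R ↔ ∃ a b : W.toAffine.CoordinateRing, a ≠ 0 ∧ b ≠ 0 ∧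
      Ideal.span {a} * (pointIdeal P * pointIdeal Q) = Ideal.span {b} * pointIdeal R := by
  rw [← Point.toClass_injective.eq_iff, map_add, toClass_eq_mk0, toClass_eq_mk0, toClass_eq_mk0,
    ← ofMul_mul, ← map_mul, Additive.ofMul.injective.eq_iff, ClassGroup.mk0_eq_mk0_iff]
  simp only [Submonoid.coe_mul, exists_prop, exists_and_left]

theorem nsmul_eq_zero_iff_pointIdeal (P : W.toAffine.Point) (n : ℕ) :
    n • P = 0 ↔ ∃ a : W.toAffine.CoordinateRing, a ≠ 0 ∧ pointIdeal P ^ n = Ideal.span {a} := by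
  rw [← Point.toClass_eq_zero, map_nsmul, toClass_eq_mk0, ← ofMul_pow, ← map_pow, ofMul_eq_zero,
    ClassGroup.mk0_eq_one_iff, Submodule.isPrincipal_iff]
  constructor
  · rintro ⟨a, ha⟩
    refine ⟨a, ?_, ha⟩
    rintro rfl
    exact pow_ne_zero n (pointIdeal_ne_bot P) (ha.trans (by simp))
  · rintro ⟨a, -, ha⟩
    exact ⟨a, ha⟩

end PointIdeal

/-! ### Overrings of Dedekind domains -/

section Overring

variable {A L : Type*} [CommRing A] [IsDedekindDomain A] [Field L] [Algebra A L]
  [IsFractionRing A L]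

/-- The ideal of denominators of `z` generates the unit ideal of every overring containing `z`. -/
theorem exists_denominators (z : L) : ∃ s t u r : A, algebraMap A L s * z = algebraMap A L u ∧
    algebraMap A L t * z = algebraMap A L r ∧ u + t = 1 := by
  obtain ⟨a, b, hb, rfl⟩ := IsFractionRing.div_surjective (A := A) z
  have hb0 : b ≠ 0 := nonZeroDivisors.ne_zero hb
  have hb0' : algebraMap A L b ≠ 0 := IsFractionRing.to_map_ne_zero_of_mem_nonZeroDivisors hb
  -- To contain is to divide: `(b) = (a, b) J`, and `J` consists of denominators of `z = a/b`. From
  -- `b = s a + t b` with `s, t ∈ J` follows `1 = s z + t`.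
  obtain ⟨J, hJ⟩ := Ideal.dvd_iff_le.mpr
    (Ideal.span_mono (Set.singleton_subset_iff.mpr (Set.mem_insert_of_mem a rfl)) :
      Ideal.span {b} ≤ Ideal.span {a, b})
  have hden {j : A} (hj : j ∈ J) : ∃ r, j * a = r * b := by
    have : j * a ∈ Ideal.span {b} := by
      rw [hJ, mul_comm j]
      exact Ideal.mul_mem_mul (Ideal.subset_span (by simp)) hj
    obtain ⟨r, hr⟩ := Ideal.mem_span_singleton'.mp this
    exact ⟨r, hr.symm⟩
  have hbJ : b ∈ Ideal.span {a} * J ⊔ Ideal.span {b} * J := by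
    rw [← Ideal.sup_mul, ← Ideal.span_insert, ← hJ]
    exact Ideal.mem_span_singleton_self b
  obtain ⟨_, hx, _, hy, hxy⟩ := Submodule.mem_sup.mp hbJ
  obtain ⟨s, hs, rfl⟩ := Ideal.mem_span_singleton_mul.mp hx
  obtain ⟨t, ht, rfl⟩ := Ideal.mem_span_singleton_mul.mp hy
  obtain ⟨u, hu⟩ := hden hs
  obtain ⟨r, hr⟩ := hden ht
  refine ⟨s, t, u, r, ?_, ?_, ?_⟩
  · rw [← mul_div_assoc, div_eq_iff hb0', ← map_mul, hu, map_mul]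
  · rw [← mul_div_assoc, div_eq_iff hb0', ← map_mul, hr, map_mul]
  · apply mul_right_cancel₀ hb0
    linear_combination hxy - hu

/-- An overring of a Dedekind domain is the intersection of the valuation rings containing it. -/
theorem mem_overring_of_forall_valuationSubring {B : Subring L} (hAB : (algebraMap A L).range ≤ B)
    {z : L} (hz : ∀ V : ValuationSubring L, B ≤ V.toSubring → z ∈ V) : z ∈ B := by
  obtain ⟨s, t, u, r, hs, ht, hut⟩ := exists_denominators (A := A) z
  let s' : B := ⟨algebraMap A L s, hAB ⟨s, rfl⟩⟩
  let t' : B := ⟨algebraMap A L t, hAB ⟨t, rfl⟩⟩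
  have hut' : algebraMap A L u + algebraMap A L t = 1 := by rw [← map_add, hut, map_one]
  have htop : Ideal.span {s', t'} = ⊤ := by
    by_contra hne
    -- In a valuation ring in which `s` and `t` are nonunits and which contains `z`, the sum `1 = s
    -- z + t` would be a nonunit.
    obtain ⟨V, hV, hI⟩ := Ideal.image_subset_nonunits_valuationSubring _ hne
    have h₁ : algebraMap A L s ∈ V.nonunits := hI ⟨s', Ideal.subset_span (by simp), rfl⟩
    have h₂ : algebraMap A L t ∈ V.nonunits := hI ⟨t', Ideal.subset_span (by simp), rfl⟩
    rw [ValuationSubring.mem_nonunits_iff] at h₁ h₂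
    have h₃ : V.valuation (algebraMap A L u) < 1 := by
      rw [← hs, map_mul]
      exact mul_lt_one_of_lt_of_le h₁ ((V.valuation_le_one_iff z).mpr (hz V hV))
    have := (V.valuation.map_add_lt h₃ h₂)
    rw [hut', map_one] at this
    exact this.false
  obtain ⟨b, c, hbc⟩ := Ideal.mem_span_pair.mp ((Ideal.eq_top_iff_one _).mp htop)
  have hbc' : (b : L) * algebraMap A L s + c * algebraMap A L t = 1 := congrArg Subtype.val hbc
  have : z = b * algebraMap A L u + c * algebraMap A L r := by
    rw [← hs, ← ht]
    linear_combination -z * hbc'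
  rw [this]
  exact add_mem (mul_mem b.2 (hAB ⟨u, rfl⟩)) (mul_mem c.2 (hAB ⟨r, rfl⟩))

end Overring

/-! ### Relative norms of maximal ideals -/

section RelNorm

open Ideal Module

variable {R S : Type*} [CommRing R] [IsDedekindDomain R] [CommRing S] [IsDedekindDomain S]
  [Algebra R S] [Module.Finite R S] [IsTorsionFree R S]

/-- The relative norm of a maximal ideal with trivial residue field extensions. -/
theorem relNorm_eq_under_of_surjective
    (hsurj : ∀ Q : Ideal S, Q.IsMaximal → Function.Surjective (algebraMap R (S ⧸ Q)))
    (Q : Ideal S) [hQ : Q.IsMaximal] (hQ0 : Q.under R ≠ ⊥) : relNorm R Q = Q.under R := by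
  set p := Q.under R with hp
  have hpmax : p.IsMaximal := isMaximal_comap_of_isIntegral_of_isMaximal Q
  have hover (P : Ideal S) (hP : P ∈ p.primesOver S) : P.IsMaximal ∧ P.LiesOver p := by
    have := hP.1
    have := hP.2
    exact ⟨IsMaximal.of_liesOver_isMaximal P p, hP.2⟩
  have hs (P : Ideal S) (hP : P ∈ p.primesOver S) : ∃ s, relNorm R P = p ^ s ∧ 1 ≤ s := by
    obtain ⟨hPm, hPo⟩ := hover P hP
    obtain ⟨s, hs⟩ := exists_relNorm_eq_pow_of_isPrime P p
    refine ⟨s, hs, Nat.one_le_iff_ne_zero.mpr ?_⟩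
    rintro rfl
    have hle := relNorm_le_comap R P
    rw [hs, pow_zero, one_eq_top, top_le_iff] at hle
    exact hPm.ne_top ((comap_eq_top_iff).mp hle)
  choose! s hs hs1 using hs
  have hinertia (P : Ideal S) (hP : P ∈ p.primesOver S) : P.inertiaDeg R = 1 := by
    obtain ⟨hPm, hPo⟩ := hover P hP
    rw [inertiaDeg_eq_of_isMaximal p P]
    let _ := Quotient.field p
    let _ := Quotient.field P
    refine finrank_eq_one_iff'.mpr ⟨1, one_ne_zero, fun w => ?_⟩
    obtain ⟨r, hr⟩ := hsurj P hPm w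
    refine ⟨Ideal.Quotient.mk p r, ?_⟩
    rw [Algebra.smul_def, mul_one, ← hr]
    rfl
  have hsum := sum_ramification_inertia_eq_finrank p S
  -- The norm of `p S = ∏ P^{e_P}` gives `∑ e_P s_P = [S : R] = ∑ e_P f_P`. Since all `f_P` are 1
  -- and all `s_P` are at least 1, every `s_P` is 1.
  have hprod := congrArg (relNorm R) (map_algebraMap_eq_finsetProd_pow (R := S) hQ0)
  rw [relNorm_algebraMap, map_prod] at hprod
  rw [← Finset.prod_set_coe] at hprod
  have hterm (P : p.primesOver S) : relNorm R (P.1 ^ P.1.ramificationIdx R) =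
      p ^ (P.1.ramificationIdx R * s P.1) := by
    rw [map_pow, hs P.1 P.2, ← pow_mul, mul_comm]
  simp only [hterm] at hprod
  rw [Finset.prod_pow_eq_pow_sum, (IsLeftCancelMulZero.mul_left_cancel_of_ne_zero hQ0).pow_injective
    (by rw [one_eq_top]; exact hpmax.ne_top) |>.eq_iff, ← hsum] at hprod
  have hle (P : p.primesOver S) (_ : P ∈ Finset.univ) :
      P.1.ramificationIdx R * P.1.inertiaDeg R ≤ P.1.ramificationIdx R * s P.1 := by
    rw [hinertia P.1 P.2]
    exact Nat.mul_le_mul_left _ (hs1 P.1 P.2)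
  have hQp : Q ∈ p.primesOver S := ⟨hQ.isPrime, ⟨rfl⟩⟩
  have heq := (Finset.sum_eq_sum_iff_of_le hle).mp hprod ⟨Q, hQp⟩ (Finset.mem_univ _)
  have hpos : 0 < Q.ramificationIdx R := ramificationIdx_pos Q R
  rw [hinertia Q hQp] at heq
  rw [hs Q hQp, ← Nat.eq_of_mul_eq_mul_left hpos heq, pow_one]

end RelNorm

/-! ### The action of an isogeny on points -/

section IsogenyPoints

variable {K : Type*} [Field K] {W₁ W₂ : WeierstrassCurve K} (φ : Isogeny W₁ W₂)

namespace Isogeny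

theorem toFun_zero : φ.toFun 0 = 0 := rfl

variable [W₁.IsShortNF] [W₂.IsShortNF]

omit [W₁.IsShortNF] in
theorem pullback_yFun_sq : φ.pullback (yFun W₂) ^ 2 = φ.pullback (xFun W₂) ^ 3 +
    algebraMap K _ W₂.a₄ * φ.pullback (xFun W₂) + algebraMap K _ W₂.a₆ := by
  have := congrArg φ.pullback (yFun_sq W₂)
  simpa only [map_add, map_mul, map_pow, AlgHom.commutes] using this

variable [W₂.IsElliptic]

theorem equation_of_hasVal {x y u v : K} (h : W₁.toAffine.Equation x y)
    (hu : HasVal (xFun W₁) (yFun W₁) x y (φ.pullback (xFun W₂)) u)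
    (hv : HasVal (xFun W₁) (yFun W₁) x y (φ.pullback (yFun W₂)) v) :
    W₂.toAffine.Nonsingular u v := by
  rw [nonsingular_iff_short]
  refine HasVal.unique (specializes_of_equation W₁ h) (hv.pow 2) ?_
  rw [φ.pullback_yFun_sq]
  exact ((hu.pow 3).add (hu.const_mul _)).add (HasVal.const _)

theorem toFun_some_of_hasVal {x y u v : K} (h : W₁.toAffine.Nonsingular x y)
    (hu : HasVal (xFun W₁) (yFun W₁) x y (φ.pullback (xFun W₂)) u)
    (hv : HasVal (xFun W₁) (yFun W₁) x y (φ.pullback (yFun W₂)) v) :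
    φ.toFun (.some x y h) = .some u v (φ.equation_of_hasVal h.1 hu hv) := by
  have hex : ∃ q : K × K, W₂.toAffine.Nonsingular q.1 q.2 ∧
      HasValue (φ.pullback (xFun W₂)) x y q.1 ∧ HasValue (φ.pullback (yFun W₂)) x y q.2 :=
    ⟨(u, v), φ.equation_of_hasVal h.1 hu hv, (hasValue_iff_hasVal W₁).mpr hu,
      (hasValue_iff_hasVal W₁).mpr hv⟩
  simp only [toFun, dif_pos hex, Affine.Point.some.injEq]
  have hs := specializes_of_equation W₁ h.1
  exact ⟨((hasValue_iff_hasVal W₁).mp hex.choose_spec.2.1).unique hs hu,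
    ((hasValue_iff_hasVal W₁).mp hex.choose_spec.2.2).unique hs hv⟩

theorem toFun_cases {x y : K} (h : W₁.toAffine.Nonsingular x y) :
    (∃ u v hn, φ.toFun (.some x y h) = .some u v hn ∧
      HasVal (xFun W₁) (yFun W₁) x y (φ.pullback (xFun W₂)) u ∧
      HasVal (xFun W₁) (yFun W₁) x y (φ.pullback (yFun W₂)) v) ∨
    (φ.toFun (.some x y h) = 0 ∧ ((¬ ∃ u, HasVal (xFun W₁) (yFun W₁) x y (φ.pullback (xFun W₂)) u) ∨
      ¬ ∃ v, HasVal (xFun W₁) (yFun W₁) x y (φ.pullback (yFun W₂)) v)) := by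
  by_cases hex : (∃ u, HasVal (xFun W₁) (yFun W₁) x y (φ.pullback (xFun W₂)) u) ∧
      ∃ v, HasVal (xFun W₁) (yFun W₁) x y (φ.pullback (yFun W₂)) v
  · obtain ⟨⟨u, hu⟩, v, hv⟩ := hex
    exact .inl ⟨u, v, _, φ.toFun_some_of_hasVal h hu hv, hu, hv⟩
  · refine .inr ⟨?_, not_and_or.mp hex⟩
    simp only [toFun]
    rw [dif_neg]
    · rfl
    · rintro ⟨q, -, hu, hv⟩
      exact hex ⟨⟨_, (hasValue_iff_hasVal W₁).mp hu⟩, _, (hasValue_iff_hasVal W₁).mp hv⟩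

end Isogeny

end IsogenyPoints

/-! ### Integrality of the coordinate ring over its image under an isogeny -/

section Integrality

variable {K : Type*} [Field K] {W₁ W₂ : WeierstrassCurve K} [W₁.IsShortNF]

/-- If `x` has a pole at `V`, the curve equation gives `v(y)² = v(x)³`, so `t` and `w` have positive
order. Thus `V` is centred at `O`, and a polynomial in `t`, `w` is a unit at `V` if its constant
term is nonzero. -/
theorem valuation_lt_one_of_isBigOInfty (V : ValuationSubring W₁.toAffine.FunctionField)
    (hK : ∀ c : K, algebraMap K _ c ∈ V) (hx : xFun W₁ ∉ V) {g : W₁.toAffine.FunctionField}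
    (hg : IsBigOInfty g 1) : V.valuation g < 1 := by
  set v := V.valuation with hv
  have hKv (c : K) : v (algebraMap K _ c) ≤ 1 := (V.valuation_le_one_iff _).mpr (hK c)
  have hKv1 {c : K} (hc : c ≠ 0) : v (algebraMap K _ c) = 1 := by
    refine le_antisymm (hKv c) ?_
    have h := hKv c⁻¹
    rw [map_inv₀, map_inv₀] at h
    have h0 : v (algebraMap K _ c) ≠ 0 := by
      rw [Ne, map_eq_zero, map_eq_zero]; exact hc
    exact (inv_le_one₀ (zero_lt_iff.mpr h0)).mp h
  have hx1 : 1 < v (xFun W₁) := by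
    rw [← not_le, hv, V.valuation_le_one_iff]; exact hx
  have hlow : v (algebraMap K _ W₁.a₄ * xFun W₁ + algebraMap K _ W₁.a₆) ≤ v (xFun W₁) := by
    refine (v.map_add _ _).trans (max_le ?_ ((hKv _).trans hx1.le))
    rw [map_mul]
    exact (mul_le_mul_left (hKv _) _).trans (one_mul _).le
  have hx3 : v (xFun W₁) < v (xFun W₁) ^ 3 :=
    lt_self_pow₀ hx1 (by norm_num)
  have hy2 : v (yFun W₁) ^ 2 = v (xFun W₁) ^ 3 := by
    rw [← map_pow, yFun_sq, add_assoc, Valuation.map_add_eq_of_lt_left, map_pow]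
    rw [map_pow]
    exact hlow.trans_lt hx3
  have hw : v (wFun W₁) < 1 := by
    by_contra! hcon
    have hwy : v (wFun W₁) * v (yFun W₁) = 1 := by
      have hy := yFun_ne_zero W₁
      rw [← map_mul, wFun, neg_mul, one_div, inv_mul_cancel₀ hy, Valuation.map_neg, map_one]
    have hy1 : 1 < v (yFun W₁) := by
      by_contra! hle
      have := pow_le_one' hle 2
      rw [hy2] at this
      exact (hx1.trans (hx3.trans_le this)).false
    exact (one_lt_mul_of_le_of_lt hcon hy1).ne' hwy
  have ht : v (tFun W₁) < 1 := by
    by_contra! hcon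
    have hty : v (tFun W₁) * v (yFun W₁) = v (xFun W₁) := by
      have hy := yFun_ne_zero W₁
      rw [← map_mul, tFun, neg_mul, div_mul_cancel₀ _ hy, Valuation.map_neg]
    have h2 : v (tFun W₁) ^ 2 * v (xFun W₁) ^ 3 = v (xFun W₁) ^ 2 := by
      rw [← hy2, ← mul_pow, hty]
    have h3 : v (xFun W₁) ^ 3 ≤ v (xFun W₁) ^ 2 := by
      rw [← h2]
      exact le_mul_of_one_le_left' (one_le_pow_of_one_le' hcon 2)
    exact (pow_lt_pow_right₀ hx1 (by norm_num : 2 < 3)).not_ge h3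
  have hpoly (f : K[X][Y]) : v (aevalAeval (tFun W₁) (wFun W₁) f -
      algebraMap K _ (aevalAeval (0 : K) (0 : K) f)) < 1 := by
    induction f using bivariate_induction with
    | const c => simp
    | var_x => simpa only [aevalAeval_X, map_zero, sub_zero] using ht
    | var_y => simpa only [aevalAeval_Y, map_zero, sub_zero] using hw
    | add f g hf hg =>
      rw [map_add, map_add, map_add, add_sub_add_comm]
      exact v.map_add_lt hf hg
    | mul f g hf hg =>
      have : aevalAeval (tFun W₁) (wFun W₁) (f * g) -
          algebraMap K _ (aevalAeval (0 : K) (0 : K) (f * g)) =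
          (aevalAeval (tFun W₁) (wFun W₁) f - algebraMap K _ (aevalAeval (0 : K) (0 : K) f)) *
          (aevalAeval (tFun W₁) (wFun W₁) g - algebraMap K _ (aevalAeval (0 : K) (0 : K) g)) +
          (algebraMap K _ (aevalAeval (0 : K) (0 : K) f) *
          (aevalAeval (tFun W₁) (wFun W₁) g - algebraMap K _ (aevalAeval (0 : K) (0 : K) g)) +
          algebraMap K _ (aevalAeval (0 : K) (0 : K) g) *
          (aevalAeval (tFun W₁) (wFun W₁) f - algebraMap K _ (aevalAeval (0 : K) (0 : K) f))) := by
        simp only [map_mul]; ring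
      rw [this]
      refine v.map_add_lt ?_ (v.map_add_lt ?_ ?_)
      · rw [map_mul]; exact mul_lt_one_of_lt_of_le hf hg.le
      · rw [map_mul, mul_comm]; exact mul_lt_one_of_lt_of_le hg (hKv _)
      · rw [map_mul, mul_comm]; exact mul_lt_one_of_lt_of_le hf (hKv _)
  have hpoly' (f : K[X][Y]) : v (aevalAeval (tFun W₁) (wFun W₁) f) ≤ 1 := by
    rw [← sub_add_cancel (aevalAeval (tFun W₁) (wFun W₁) f)
      (algebraMap K _ (aevalAeval (0 : K) (0 : K) f))]
    exact v.map_add_le (hpoly f).le (hKv _)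
  obtain ⟨a, b, hb, h⟩ := hg
  have hb1 : v (aevalAeval (tFun W₁) (wFun W₁) b) = 1 := by
    rw [← sub_add_cancel (aevalAeval (tFun W₁) (wFun W₁) b)
      (algebraMap K _ (aevalAeval (0 : K) (0 : K) b)), Valuation.map_add_eq_of_lt_right, hKv1 hb]
    rw [hKv1 hb]
    exact hpoly b
  have h' := congrArg v h
  rw [map_mul, map_mul, hb1, mul_one, pow_one] at h'
  rw [h']
  exact mul_lt_one_of_lt_of_le ht (hpoly' a)

/-- Otherwise `V` is centred at `O`, where `w₂ ∘ φ` vanishes; but `(w₂ ∘ φ)(y₂ ∘ φ) = -1` and `y₂ ∘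
φ ∈ V`. By the valuative criterion the functions `x₁`, `y₁` are integral over the coordinate ring of
`E₂`. -/
theorem Isogeny.mem_valuationSubring (φ : Isogeny W₁ W₂)
    (V : ValuationSubring W₁.toAffine.FunctionField)
    (hV : ∀ a : W₂.toAffine.CoordinateRing, φ.pullback (algebraMap _ _ a) ∈ V) :
    xFun W₁ ∈ V ∧ yFun W₁ ∈ V := by
  have hK (c : K) : algebraMap K W₁.toAffine.FunctionField c ∈ V := by
    have := hV (algebraMap K _ c)
    rwa [← IsScalarTower.algebraMap_apply, AlgHom.commutes] at this
  have hx : xFun W₁ ∈ V := by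
    by_contra hx
    have h := valuation_lt_one_of_isBigOInfty V hK hx φ.wFun_infty
    have hy : V.valuation (φ.pullback (yFun W₂)) ≤ 1 :=
      (V.valuation_le_one_iff _).mpr (hV _)
    have hwy : φ.pullback (wFun W₂) * φ.pullback (yFun W₂) = -1 := by
      have := yFun_ne_zero W₂
      rw [← map_mul, wFun, neg_mul, one_div, inv_mul_cancel₀ this, map_neg, map_one]
    have := congrArg V.valuation hwy
    rw [map_mul, Valuation.map_neg, map_one] at this
    exact (mul_lt_one_of_lt_of_le h hy).ne this
  refine ⟨hx, ?_⟩
  have hy2 : yFun W₁ ^ 2 ∈ V := by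
    rw [yFun_sq]
    exact add_mem (add_mem (pow_mem hx 3) (mul_mem (hK _) hx)) (hK _)
  rcases V.mem_or_inv_mem (yFun W₁) with h | h
  · exact h
  · have := mul_mem hy2 h
    rwa [pow_two, mul_assoc, mul_inv_cancel₀ (yFun_ne_zero W₁), mul_one] at this

end Integrality

/-! ### Pushing ideals forward through the integral closure -/

section Pushforward

open Ideal

/-- An integral overring generated by finitely many functions. -/
theorem exists_finite_subalgebra (K : Type*) {R A L : Type*} [CommRing K] [CommRing R] [CommRing A]
    [CommRing L] [Algebra K R] [Algebra K A] [Algebra K L] [Algebra R L] [Algebra A L]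
    [IsScalarTower K R L] [IsScalarTower K A L] [Algebra.FiniteType K A]
    (hint : ∀ a : A, IsIntegral R (algebraMap A L a)) :
    ∃ B : Subalgebra R L, Module.Finite R B ∧ (∀ a : A, algebraMap A L a ∈ B) ∧
      B ≤ Algebra.adjoin R (Set.range (algebraMap A L)) := by
  obtain ⟨s, hs⟩ := Algebra.FiniteType.out (R := K) (A := A)
  refine ⟨Algebra.adjoin R (algebraMap A L '' s),
    Algebra.finite_adjoin_of_finite_of_isIntegral (s.finite_toSet.image _) ?_, fun a ↦ ?_,
    Algebra.adjoin_mono (Set.image_subset_range _ _)⟩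
  · rintro _ ⟨a, -, rfl⟩
    exact hint a
  · have ha : a ∈ Algebra.adjoin K (s : Set A) := hs ▸ Algebra.mem_top
    induction ha using Algebra.adjoin_induction with
    | mem a ha => exact Algebra.subset_adjoin ⟨a, ha, rfl⟩
    | algebraMap c =>
      rw [← IsScalarTower.algebraMap_apply K A L, IsScalarTower.algebraMap_apply K R L]
      exact Subalgebra.algebraMap_mem _ _
    | add a b _ _ ha hb => rw [map_add]; exact add_mem ha hb
    | mul a b _ _ ha hb => rw [map_mul]; exact mul_mem ha hb

variable {R A F L : Type*} [CommRing R] [IsDedekindDomain R]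
  [CommRing A] [IsDedekindDomain A] [Field F] [Field L] [Algebra R F] [IsFractionRing R F]
  [Algebra A L] [IsFractionRing A L] [Algebra F L] [Algebra R L] [IsScalarTower R F L]

omit [IsDedekindDomain A] in
theorem isFractionRing_of_le {R : Type*} [CommRing R] [Algebra R L]
    (B : Subalgebra R L) (hB : ∀ a : A, algebraMap A L a ∈ B) : IsFractionRing B L := by
  refine IsFractionRing.of_field B L fun z ↦ ?_
  obtain ⟨a, b, -, h⟩ := IsFractionRing.div_surjective (A := A) z
  exact ⟨⟨_, hB a⟩, ⟨_, hB b⟩, h.symm⟩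

/-- An overring of the Dedekind domain `A` is an intersection of valuation rings, and these are
integrally closed. -/
theorem isIntegrallyClosed_of_le {R : Type*} [CommRing R] [Algebra R L]
    (B : Subalgebra R L) (hB : ∀ a : A, algebraMap A L a ∈ B) : IsIntegrallyClosed B := by
  have := isFractionRing_of_le (A := A) B hB
  rw [isIntegrallyClosed_iff L]
  intro z hz
  have : z ∈ B.toSubring := by
    refine mem_overring_of_forall_valuationSubring (A := A) ?_ fun V hV ↦ ?_
    · rintro _ ⟨a, rfl⟩
      exact hB a
    · obtain ⟨q, hq, hqz⟩ := hz
      have : IsIntegral V z := by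
        let f : B →+* V := Subring.inclusion hV
        refine ⟨q.map f, hq.map f, ?_⟩
        rw [Polynomial.eval₂_map]
        exact hqz
      obtain ⟨w, hw⟩ := (IsIntegrallyClosed.isIntegral_iff (R := V) (K := L)).mp this
      rw [← hw]
      exact w.2
  exact ⟨⟨z, this⟩, rfl⟩

theorem isDedekindDomain_of_le (B : Subalgebra R L) [Module.Finite R B]
    (hB : ∀ a : A, algebraMap A L a ∈ B) : IsDedekindDomain B := by
  have := isIntegrallyClosed_of_le (A := A) B hB
  have : IsNoetherianRing B := IsNoetherianRing.of_finite R B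
  have : Ring.DimensionLEOne B := Ring.DimensionLEOne.of_isIntegral R B
  exact { }

theorem finiteDimensional_of_le (B : Subalgebra R L) [Module.Finite R B]
    (hB : ∀ a : A, algebraMap A L a ∈ B) : FiniteDimensional F L := by
  have := isFractionRing_of_le (A := A) B hB
  have := isIntegrallyClosed_of_le (A := A) B hB
  have : IsIntegralClosure B R L := IsIntegralClosure.of_isIntegrallyClosed B R L
  have hint (a : A) : IsAlgebraic F (algebraMap A L a) := by
    have : IsIntegral R (⟨_, hB a⟩ : B) := Algebra.IsIntegral.isIntegral _
    have : IsIntegral R (algebraMap A L a) := this.map B.val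
    exact (this.tower_top (A := F)).isAlgebraic
  have : Algebra.IsAlgebraic F L := by
    refine ⟨fun z ↦ ?_⟩
    obtain ⟨a, b, -, h⟩ := IsFractionRing.div_surjective (A := A) z
    rw [← h, div_eq_mul_inv]
    exact (hint a).mul (hint b).inv
  have := IsIntegralClosure.isLocalization R F L B
  exact Module.Finite.of_isLocalization R B (nonZeroDivisors R)

-- Both `s` and `t` in the relation `1 = s r + t` for denominators of `r` must lie in `M`, and in
-- `B`, which contains `r`, this relation shows that `M` generates the unit ideal.
omit [IsDedekindDomain R] in
theorem map_eq_top_of_not_regular (B : Subalgebra R L) (ι : A →+* B)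
    (hι : ∀ a, (ι a : L) = algebraMap A L a) {M : Ideal A} {r : R}
    (hr : ¬ ∃ s ∉ M, ∃ t, algebraMap R L r * algebraMap A L s = algebraMap A L t) :
    M.map ι = ⊤ := by
  push Not at hr
  obtain ⟨s, t, u, v, hs, ht, hut⟩ := exists_denominators (A := A) (algebraMap R L r)
  have hsM : s ∈ M := by
    by_contra h
    exact hr s h u (by rw [mul_comm]; exact hs)
  have htM : t ∈ M := by
    by_contra h
    exact hr t h v (by rw [mul_comm]; exact ht)
  rw [Ideal.eq_top_iff_one]
  have : (1 : B) = ι s * algebraMap R B r + ι t := by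
    apply Subtype.ext
    push_cast
    rw [hι, hι, ← map_one (algebraMap A L), ← hut, map_add, ← hs]
  rw [this]
  exact add_mem (Ideal.mul_mem_right _ _ (Ideal.mem_map_of_mem _ hsM)) (Ideal.mem_map_of_mem _ htM)

-- The hypothesis says that `B` lies in the local ring of `A` at `M`. Denominators outside `M` are
-- invertible modulo `M`, so `B` modulo `M B` is again the residue field of `M`.
omit [IsDedekindDomain R] [IsDedekindDomain A] in
theorem map_isMaximal_of_regular (B : Subalgebra R L) (ι : A →+* B)
    (hι : ∀ a, (ι a : L) = algebraMap A L a) {M : Ideal A} [hM : M.IsMaximal]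
    (hr : ∀ b : B, ∃ s ∉ M, ∃ t, (b : L) * algebraMap A L s = algebraMap A L t) :
    (M.map ι).IsMaximal ∧
      ∀ b : B, (∃ s ∉ M, ∃ t ∈ M, (b : L) * algebraMap A L s = algebraMap A L t) → b ∈ M.map ι := by
  have hinj : Function.Injective (algebraMap A L) := IsFractionRing.injective A L
  have hinv {s : A} (hs : s ∉ M) : ∃ e, ∃ μ ∈ M, s * e = 1 - μ := by
    have h := (Ideal.isMaximal_iff.mp hM).2 (Ideal.span {s} ⊔ M) s le_sup_right hs
      (Ideal.mem_sup_left (Ideal.mem_span_singleton_self s))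
    obtain ⟨a, ha, μ, hμ, h⟩ := Submodule.mem_sup.mp h
    obtain ⟨e, rfl⟩ := Ideal.mem_span_singleton'.mp ha
    exact ⟨e, μ, hμ, by linear_combination h⟩
  have hval (b : B) {s t : A} (h : (b : L) * algebraMap A L s = algebraMap A L t) :
      b * ι s = ι t := by
    apply Subtype.ext
    push_cast
    rw [hι, hι, h]
  have hmem (b : B) (h : ∃ s ∉ M, ∃ t ∈ M, (b : L) * algebraMap A L s = algebraMap A L t) :
      b ∈ M.map ι := by
    obtain ⟨s, hs, t, ht, h⟩ := h
    obtain ⟨e, μ, hμ, he⟩ := hinv hs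
    have h1 := hval b h
    have h2 : ι s * ι e = 1 - ι μ := by rw [← map_mul, he, map_sub, map_one]
    have : b = ι t * ι e + ι μ * b := by linear_combination ι e * h1 - b * h2
    rw [this]
    exact add_mem (Ideal.mul_mem_right _ _ (Ideal.mem_map_of_mem _ ht))
      (Ideal.mul_mem_right _ _ (Ideal.mem_map_of_mem _ hμ))
  have hmem' (b : B) (h : b ∈ M.map ι) :
      ∃ s ∉ M, ∃ t ∈ M, (b : L) * algebraMap A L s = algebraMap A L t := by
    rw [Ideal.map] at h
    induction h using Submodule.span_induction with
    | mem b hb =>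
      obtain ⟨a, ha, rfl⟩ := hb
      exact ⟨1, (Ideal.ne_top_iff_one _).mp hM.ne_top, a, ha, by rw [hι, map_one, mul_one]⟩
    | zero => exact ⟨1, (Ideal.ne_top_iff_one _).mp hM.ne_top, 0, zero_mem _, by simp⟩
    | add b c _ _ hb hc =>
      obtain ⟨s, hs, t, ht, h⟩ := hb
      obtain ⟨s', hs', t', ht', h'⟩ := hc
      refine ⟨s * s', fun hh ↦ (hM.isPrime.mem_or_mem hh).elim hs hs', t * s' + t' * s,
        add_mem (M.mul_mem_right _ ht) (M.mul_mem_right _ ht'), ?_⟩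
      rw [Subalgebra.coe_add, map_mul, map_add, map_mul, map_mul]
      linear_combination algebraMap A L s' * h + algebraMap A L s * h'
    | smul a b _ hb =>
      obtain ⟨s, hs, t, ht, h⟩ := hb
      obtain ⟨s', hs', t', h'⟩ := hr a
      refine ⟨s' * s, fun hh ↦ (hM.isPrime.mem_or_mem hh).elim hs' hs, t' * t,
        M.mul_mem_left _ ht, ?_⟩
      rw [smul_eq_mul, map_mul, map_mul, Subalgebra.coe_mul]
      linear_combination (a : L) * algebraMap A L s' * h + algebraMap A L t * h'
  refine ⟨Ideal.isMaximal_iff.mpr ⟨fun h ↦ ?_, fun J b hJ hb hbJ ↦ ?_⟩, hmem⟩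
  · obtain ⟨s, hs, t, ht, h⟩ := hmem' 1 h
    rw [OneMemClass.coe_one, one_mul] at h
    exact hs (hinj h ▸ ht)
  · obtain ⟨s, hs, t, h⟩ := hr b
    have ht : t ∉ M := fun ht ↦ hb (hmem b ⟨s, hs, t, ht, h⟩)
    obtain ⟨e, μ, hμ, he⟩ := hinv ht
    have h1 := hval b h
    have h2 : ι t * ι e = 1 - ι μ := by rw [← map_mul, he, map_sub, map_one]
    have : 1 = b * (ι s * ι e) + ι μ := by linear_combination -ι e * h1 - h2
    rw [this]
    exact add_mem (J.mul_mem_right _ hbJ) (hJ (Ideal.mem_map_of_mem _ hμ))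

/-- The norm of ideals of the ring `A`, when `A` is contained in the integral closure of `R`: a
maximal ideal of `A` that lies over a maximal ideal of `R` is sent to this ideal, and a maximal
ideal of `A` that does not lie over `R` is sent to the unit ideal. -/
theorem exists_idealNorm (K R A F L : Type*) [Field K] [IsAlgClosed K] [CommRing R]
    [IsDedekindDomain R] [CommRing A] [IsDedekindDomain A] [Field F] [Field L] [Algebra R F]
    [IsFractionRing R F] [Algebra A L] [IsFractionRing A L] [Algebra F L] [Algebra R L]
    [IsScalarTower R F L] [Algebra K R] [Algebra K A] [Algebra K L] [IsScalarTower K R L]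
    [IsScalarTower K A L] [Algebra.FiniteType K R] [Algebra.FiniteType K A]
    (hint : ∀ a : A, IsIntegral R (algebraMap A L a)) :
    FiniteDimensional F L ∧ ∃ N : Ideal A →* Ideal R,
      (∀ a, ∃ n, N (span {a}) = span {n} ∧
        algebraMap R F n = Algebra.norm F (algebraMap A L a)) ∧
      (∀ M : Ideal A, M.IsMaximal → ∀ P : Ideal R, P.IsMaximal → P ≠ ⊥ →
        (∀ r : R, ∃ s ∉ M, ∃ t, algebraMap R L r * algebraMap A L s = algebraMap A L t) →
        (∀ r ∈ P, ∃ s ∉ M, ∃ t ∈ M, algebraMap R L r * algebraMap A L s = algebraMap A L t) →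
        N M = P) ∧
      ∀ M : Ideal A, ∀ r : R,
        (¬ ∃ s ∉ M, ∃ t, algebraMap R L r * algebraMap A L s = algebraMap A L t) → N M = ⊤ := by
  obtain ⟨B, hfin, hB, hBle⟩ := exists_finite_subalgebra K hint
  have hdim : FiniteDimensional F L := finiteDimensional_of_le (A := A) B hB
  have := isFractionRing_of_le (A := A) B hB
  have := isDedekindDomain_of_le (A := A) B hB
  have : IsIntegralClosure B R L := IsIntegralClosure.of_isIntegrallyClosed B R L
  have hRL : Function.Injective (algebraMap R L) := by
    rw [IsScalarTower.algebraMap_eq R F L]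
    exact (algebraMap F L).injective.comp (IsFractionRing.injective R F)
  have : Module.IsTorsionFree R B := by
    have : FaithfulSMul R B := (faithfulSMul_iff_algebraMap_injective R B).mpr fun a b h ↦
      hRL (congrArg Subtype.val h)
    infer_instance
  have : Algebra.FiniteType K B := Algebra.FiniteType.trans (R := K) (S := R) inferInstance inferInstance
  have hsurj (Q : Ideal B) (hQ : Q.IsMaximal) : Function.Surjective (algebraMap R (B ⧸ Q)) := by
    intro z
    obtain ⟨c, rfl⟩ := algebraMap_quotient_surjective (K := K) Q z
    exact ⟨algebraMap K R c, (IsScalarTower.algebraMap_apply K R (B ⧸ Q) c).symm⟩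
  let ι : A →+* B := (algebraMap A L).codRestrict B.toSubring hB
  have hι (a : A) : (ι a : L) = algebraMap A L a := rfl
  -- Ideals are extended from `A` to the integral closure `B` and then pushed down by the relative
  -- norm. Passing from `A` to `B` discards the points that do not lie over `R`.
  refine ⟨hdim, (relNorm R : Ideal B →*₀ Ideal R).toMonoidHom.comp (Ideal.mapHom ι).toMonoidHom, ?_, ?_, ?_⟩
  · intro a
    refine ⟨Algebra.intNorm R B (ι a), ?_, Algebra.algebraMap_intNorm _⟩
    change relNorm R (Ideal.map ι (span {a})) = _
    rw [Ideal.map_span, Set.image_singleton, relNorm_singleton]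
  · intro M hM P hP hP0 hr hPM
    have hreg (b : B) : ∃ s ∉ M, ∃ t, (b : L) * algebraMap A L s = algebraMap A L t := by
      obtain ⟨b, hbB⟩ := b
      have hb := hBle hbB
      change ∃ s ∉ M, ∃ t, b * algebraMap A L s = algebraMap A L t
      clear hbB
      induction hb using Algebra.adjoin_induction with
      | mem b hb =>
        obtain ⟨a, rfl⟩ := hb
        exact ⟨1, (Ideal.ne_top_iff_one _).mp hM.ne_top, a, by rw [map_one, mul_one]⟩
      | algebraMap r => exact hr r
      | add b c _ _ hb hc =>
        obtain ⟨s, hs, t, h⟩ := hb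
        obtain ⟨s', hs', t', h'⟩ := hc
        refine ⟨s * s', fun hh ↦ (hM.isPrime.mem_or_mem hh).elim hs hs', t * s' + t' * s, ?_⟩
        rw [map_mul, map_add, map_mul, map_mul]
        linear_combination algebraMap A L s' * h + algebraMap A L s * h'
      | mul b c _ _ hb hc =>
        obtain ⟨s, hs, t, h⟩ := hb
        obtain ⟨s', hs', t', h'⟩ := hc
        refine ⟨s * s', fun hh ↦ (hM.isPrime.mem_or_mem hh).elim hs hs', t * t', ?_⟩
        rw [map_mul, map_mul]
        linear_combination c * algebraMap A L s' * h + algebraMap A L t * h'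
    obtain ⟨hmax, hmem⟩ := map_isMaximal_of_regular B ι hι hreg
    have hle : P ≤ (M.map ι).under R := fun r hr ↦ hmem _ (hPM r hr)
    have heq : P = (M.map ι).under R := hP.eq_of_le (Ideal.comap_ne_top _ hmax.ne_top) hle
    change relNorm R (M.map ι) = _
    rw [relNorm_eq_under_of_surjective hsurj _ (heq ▸ hP0), ← heq]
  · intro M r hr
    change relNorm R (M.map ι) = _
    rw [map_eq_top_of_not_regular B ι hι hr, ← Ideal.one_eq_top, map_one, Ideal.one_eq_top]

end Pushforward

/-! ### The logarithmic derivative of a norm -/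

section NormDerivation

variable {K F L : Type*} [Field K] [Field F] [Field L] [Algebra K F] [Algebra K L] [Algebra F L]

/-- The first order deformation of a field along a derivation. -/
def derivationDeform (D : Derivation K F F) : F →+* F[ε] where
  toFun g := TrivSqZeroExt.inl g + TrivSqZeroExt.inr (D g)
  map_one' := by simp
  map_zero' := by simp
  map_add' g h := by ext <;> simp
  map_mul' g h := by ext <;> simp [mul_comm]

/-- The norm of a function with constant logarithmic derivative. -/
theorem derivation_norm [FiniteDimensional F L] (D : Derivation K L L) (D' : Derivation K F F)
    (hD : ∀ g, D (algebraMap F L g) = algebraMap F L (D' g)) {f : L} {c : F}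
    (hf : D f = algebraMap F L c * f) :
    D' (Algebra.norm F f) = Module.finrank F L * c * Algebra.norm F f := by
  classical
  let b := Module.finBasis F L
  set n := Module.finrank F L
  let M := Algebra.leftMulMatrix b f
  -- The connection matrix of `D` in the basis `b`. Computing `D (f b_j)` in two ways gives `D' M +
  -- Γ M = c M + M Γ`, where `M` is the matrix of multiplication by `f`.
  let Γ : Matrix (Fin n) (Fin n) F := Matrix.of fun i j ↦ b.repr (D (b j)) i
  have hM (j : Fin n) : f * b j = ∑ i, algebraMap F L (M i j) * b i := by
    simp_rw [← Algebra.smul_def]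
    rw [← b.sum_repr (f * b j)]
    simp only [M, Algebra.leftMulMatrix_eq_repr_mul]
  have hΓ (j : Fin n) : D (b j) = ∑ i, algebraMap F L (Γ i j) * b i := by
    simp_rw [← Algebra.smul_def]
    exact (b.sum_repr _).symm
  have key (i j : Fin n) : D' (M i j) + ∑ k, Γ i k * M k j = c * M i j + ∑ k, M i k * Γ k j := by
    have h1 : D (f * b j) = ∑ i, (D' (M i j) + ∑ k, Γ i k * M k j) • b i := by
      rw [hM, map_sum]
      simp only [add_smul, Finset.sum_add_distrib, Finset.sum_smul]
      simp only [Derivation.leibniz, smul_eq_mul, hΓ, hD, Finset.sum_add_distrib,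
        Finset.mul_sum, Algebra.smul_def, map_mul]
      rw [add_comm, Finset.sum_comm (γ := Fin n)]
      congr 1
      · exact Finset.sum_congr rfl fun i _ ↦ mul_comm _ _
      · exact Finset.sum_congr rfl fun i _ ↦ Finset.sum_congr rfl fun k _ ↦ by ring
    have h2 : D (f * b j) = ∑ i, (c * M i j + ∑ k, M i k * Γ k j) • b i := by
      rw [Derivation.leibniz, hf, smul_eq_mul, smul_eq_mul, hΓ]
      have : b j * (algebraMap F L c * f) = algebraMap F L c * (f * b j) := by ring
      rw [this, hM]
      simp only [add_smul, Finset.sum_add_distrib, Finset.sum_smul]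
      simp only [Finset.mul_sum, Algebra.smul_def, map_mul, mul_left_comm f, hM]
      rw [add_comm, Finset.sum_comm (γ := Fin n)]
      congr 1
      · exact Finset.sum_congr rfl fun i _ ↦ by ring
      · exact Finset.sum_congr rfl fun i _ ↦ Finset.sum_congr rfl fun k _ ↦ by ring
    have h3 := congrArg b.equivFun (h1.symm.trans h2)
    simp only [← b.equivFun_symm_apply, LinearEquiv.apply_symm_apply] at h3
    exact congrFun h3 i
  let σ := derivationDeform D'
  -- Over the dual numbers the relation `key` reads `(1 + εΓ)(M + ε D' M) = (1 + εc) M (1 + εΓ)`.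
  -- Taking determinants and cancelling `det G` leaves `det M + ε D'(det M) = (1 + εc)^n det M`.
  let G : Matrix (Fin n) (Fin n) F[ε] := 1 + Matrix.of fun i j ↦ TrivSqZeroExt.inr (Γ i j)
  let c' : F[ε] := 1 + TrivSqZeroExt.inr c
  have hmat : G * σ.mapMatrix M =
      c' • ((TrivSqZeroExt.inlHom F F).mapMatrix M * G) := by
    refine Matrix.ext fun i j ↦ ?_
    have := key i j
    simp only [G, add_mul, mul_add, one_mul, mul_one]
    simp only [c', Matrix.add_apply, Matrix.smul_apply, Matrix.mul_apply, Matrix.of_apply, RingHom.mapMatrix_apply, Matrix.map_apply, σ,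
      derivationDeform, smul_eq_mul]
    ext
    · simp [TrivSqZeroExt.fst_sum]
    · simp [TrivSqZeroExt.snd_sum, TrivSqZeroExt.fst_sum, mul_comm] at this ⊢
      linear_combination this
  have hdet := congrArg Matrix.det hmat
  rw [Matrix.det_mul, Matrix.det_smul, Matrix.det_mul, ← RingHom.map_det, ← RingHom.map_det] at hdet
  have hG : G.det.fst = 1 := by
    have hG1 : (TrivSqZeroExt.fstHom F F F).toRingHom.mapMatrix G = 1 := by
      refine Matrix.ext fun i j ↦ ?_
      by_cases h : i = j <;> simp [G, h, Matrix.one_apply]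
    change (TrivSqZeroExt.fstHom F F F).toRingHom G.det = 1
    rw [RingHom.map_det, hG1, Matrix.det_one]
  have hdet' : G.det * (σ M.det - c' ^ n * TrivSqZeroExt.inlHom F F M.det) = 0 := by
    rw [Fintype.card_fin] at hdet
    linear_combination hdet
  have := congrArg TrivSqZeroExt.snd (dual_cancel (by rw [hG]; exact one_ne_zero) hdet')
  rw [Algebra.norm_eq_matrix_det b f]
  simp [σ, derivationDeform, c'] at this
  linear_combination this

end NormDerivation

/-! ### The norm along an isogeny -/

section IsogenyNorm

open Ideal Affine.CoordinateRing

variable {K : Type*} [Field K] {W₁ W₂ : WeierstrassCurve K}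

theorem algebraMap_mem_of_mem (V : ValuationSubring W₁.toAffine.FunctionField)
    (hK : ∀ c : K, algebraMap K _ c ∈ V) (hx : xFun W₁ ∈ V) (hy : yFun W₁ ∈ V)
    (a : W₁.toAffine.CoordinateRing) : algebraMap _ W₁.toAffine.FunctionField a ∈ V := by
  obtain ⟨f, rfl⟩ := AdjoinRoot.mk_surjective a
  change polyFun W₁ f ∈ V
  rw [polyFun_eq_aevalAeval]
  induction f using bivariate_induction with
  | const c => simpa using hK c
  | var_x => simpa only [aevalAeval_X] using hx
  | var_y => simpa only [aevalAeval_Y] using hy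
  | add f g hf hg => rw [map_add]; exact add_mem hf hg
  | mul f g hf hg => rw [map_mul]; exact mul_mem hf hg

variable [W₁.IsShortNF] [W₁.IsElliptic] [W₂.IsShortNF] [W₂.IsElliptic] [IsAlgClosed K]

/-- The norm of functions and ideals along an isogeny. -/
theorem Isogeny.exists_norm (φ : Isogeny W₁ W₂) :
    ∃ N : Ideal W₁.toAffine.CoordinateRing →* Ideal W₂.toAffine.CoordinateRing,
      (∀ P, N (pointIdeal P) = pointIdeal (φ.toFun P)) ∧
      ∀ a ≠ 0, ∃ n ≠ 0, N (span {a}) = span {n} ∧ ∀ m c : K,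
        (∀ g, invDer W₁ (φ.pullback g) = algebraMap K _ m * φ.pullback (invDer W₂ g)) →
        invDer W₁ (algebraMap _ _ a) = algebraMap K _ c * algebraMap _ _ a →
        algebraMap K _ m * invDer W₂ (algebraMap _ _ n) =
          algebraMap K _ (φ.degree * c) * algebraMap _ _ n := by
  let : Algebra W₂.toAffine.FunctionField W₁.toAffine.FunctionField :=
    φ.pullback.toRingHom.toAlgebra
  let : Algebra W₂.toAffine.CoordinateRing W₁.toAffine.FunctionField :=
    (φ.pullback.toRingHom.comp (algebraMap _ _)).toAlgebra
  have : IsScalarTower W₂.toAffine.CoordinateRing W₂.toAffine.FunctionField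
    W₁.toAffine.FunctionField := .of_algebraMap_eq fun _ ↦ rfl
  have : IsScalarTower K W₂.toAffine.CoordinateRing W₁.toAffine.FunctionField :=
    .of_algebraMap_eq fun c ↦ by
      change _ = φ.pullback (algebraMap _ _ (algebraMap _ _ c))
      rw [← IsScalarTower.algebraMap_apply, AlgHom.commutes]
  have hint (a : W₁.toAffine.CoordinateRing) : IsIntegral W₂.toAffine.CoordinateRing
      (algebraMap _ W₁.toAffine.FunctionField a) := by
    by_contra h
    obtain ⟨V, hV, hVa⟩ := Subring.exists_le_valuationSubring_of_isIntegrallyClosedIn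
      (R := (integralClosure W₂.toAffine.CoordinateRing W₁.toAffine.FunctionField).toSubring) h
    have hV' (b : W₂.toAffine.CoordinateRing) : φ.pullback (algebraMap _ _ b) ∈ V :=
      hV (Subalgebra.algebraMap_mem (integralClosure W₂.toAffine.CoordinateRing _) b)
    obtain ⟨hx, hy⟩ := φ.mem_valuationSubring V hV'
    refine hVa (algebraMap_mem_of_mem V (fun c ↦ ?_) hx hy a)
    have := hV' (algebraMap K _ c)
    rwa [← IsScalarTower.algebraMap_apply, AlgHom.commutes] at this
  have hdeg : φ.degree = Module.finrank W₂.toAffine.FunctionField W₁.toAffine.FunctionField := by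
    refine (Algebra.finrank_eq_of_equiv_equiv (AlgEquiv.ofInjectiveField φ.pullback).toRingEquiv
      (RingEquiv.refl _) ?_).symm
    ext
    rfl
  obtain ⟨hdim, N, hN, hNP, hNtop⟩ := exists_idealNorm K W₂.toAffine.CoordinateRing
    W₁.toAffine.CoordinateRing W₂.toAffine.FunctionField W₁.toAffine.FunctionField hint
  refine ⟨N, fun P ↦ ?_, fun a ha ↦ ?_⟩
  · rcases P with _ | ⟨x, y, h⟩
    · change N ⊤ = ⊤
      rw [← Ideal.one_eq_top, map_one, Ideal.one_eq_top]
    · rcases φ.toFun_cases h with ⟨u, v, hn, hφ, hu, hv⟩ | ⟨hφ, hh⟩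
      · rw [hφ]
        have hval (r : W₂.toAffine.CoordinateRing) (f : K[X][Y]) (hf : Affine.CoordinateRing.mk W₂.toAffine f = r) :
            HasVal (xFun W₁) (yFun W₁) x y (algebraMap _ W₁.toAffine.FunctionField r)
              (aevalAeval u v f) := by
          have : algebraMap _ W₁.toAffine.FunctionField r = aevalAeval (φ.pullback (xFun W₂))
              (φ.pullback (yFun W₂)) f := by
            rw [← algHom_aevalAeval, ← polyFun_eq_aevalAeval, ← hf]
            rfl
          rw [this]
          exact hu.comp_polynomial hv f
        refine hNP _ (isMaximal_XYIdeal W₁ h.1) _ (isMaximal_XYIdeal W₂ hn.1)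
          (pointIdeal_ne_bot (.some u v hn)) (fun r ↦ ?_) (fun r hr ↦ ?_)
        · obtain ⟨f, rfl⟩ := AdjoinRoot.mk_surjective r
          exact (hasVal_iff_exists_mem W₁ h.1).mp ⟨_, hval _ f rfl⟩
        · obtain ⟨f, rfl⟩ := AdjoinRoot.mk_surjective r
          have hf : aevalAeval u v f = 0 := (mk_mem_XYIdeal_iff W₂ hn.1 f).mp hr
          have h0 := hval _ f rfl
          rw [hf] at h0
          obtain ⟨s, hs, t, ht⟩ := (hasVal_iff_exists_mem W₁ h.1).mp ⟨_, h0⟩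
          refine ⟨s, hs, t, (hasVal_zero_iff_mem W₁ h.1 t).mp ?_, ht⟩
          rw [← ht]
          obtain ⟨q, rfl⟩ := AdjoinRoot.mk_surjective s
          have := h0.mul (HasVal.of_aevalAeval (xFun W₁) (yFun W₁) x y q)
          rwa [zero_mul, ← polyFun_eq_aevalAeval] at this
      -- If `φ(P) = O`, then `x₂ ∘ φ` or `y₂ ∘ φ` is not regular at `P`, so the norm is the unit
      -- ideal, which is the ideal of `O`.
      · rw [hφ]
        rcases hh with hh | hh
        · exact hNtop _ (Affine.CoordinateRing.mk W₂.toAffine (C X))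
            (fun hc ↦ hh ((hasVal_iff_exists_mem W₁ h.1).mpr hc))
        · exact hNtop _ (Affine.CoordinateRing.mk W₂.toAffine Y)
            (fun hc ↦ hh ((hasVal_iff_exists_mem W₁ h.1).mpr hc))
  · obtain ⟨n, hn, hnorm⟩ := hN a
    refine ⟨n, ?_, hn, fun m c hm hc ↦ ?_⟩
    · rintro rfl
      rw [map_zero, eq_comm, Algebra.norm_eq_zero_iff] at hnorm
      exact ha ((map_eq_zero_iff _ (IsFractionRing.injective _ _)).mp hnorm)
    -- Along `φ` the derivation of `K(E₁)` extends `m` times that of `K(E₂)`, which is allowed to be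
    -- zero.
    · have := derivation_norm (F := W₂.toAffine.FunctionField) (invDer W₁)
        (algebraMap K W₂.toAffine.FunctionField m • invDer W₂)
        (f := algebraMap _ _ a) (c := algebraMap K _ c) (fun g ↦ ?_) ?_
      · rw [← hnorm, ← hdeg] at this
        change algebraMap K _ m * invDer W₂ _ = _ at this
        rw [this, map_mul, map_natCast]
      · change invDer W₁ (φ.pullback g) = φ.pullback (algebraMap K _ m * invDer W₂ g)
        rw [hm, map_mul, AlgHom.commutes]
      · have : algebraMap W₂.toAffine.FunctionField W₁.toAffine.FunctionField
            (algebraMap K _ c) = algebraMap K _ c := φ.pullback.commutes c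
        rw [hc, this]

end IsogenyNorm

/-! ### Isogenies are homomorphisms with a proper kernel -/

section IsogenyHom

open Ideal Affine.CoordinateRing

variable {K : Type*} [Field K] [IsAlgClosed K] {W₁ W₂ : WeierstrassCurve K} [W₁.IsShortNF]
  [W₁.IsElliptic] [W₂.IsShortNF] [W₂.IsElliptic] (φ : Isogeny W₁ W₂)

namespace Isogeny

/-- The norm carries the ideal relation that expresses `P + Q` to the relation that expresses `φ(P)
+ φ(Q)`. -/
theorem toFun_add [DecidableEq K] (P Q : W₁.toAffine.Point) :
    φ.toFun (P + Q) = φ.toFun P + φ.toFun Q := by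
  obtain ⟨N, hN, hN'⟩ := φ.exists_norm
  obtain ⟨a, b, ha, hb, h⟩ := (add_eq_iff_pointIdeal P Q (P + Q)).mp rfl
  obtain ⟨n, hn, hna, -⟩ := hN' a ha
  obtain ⟨n', hn', hnb, -⟩ := hN' b hb
  refine ((add_eq_iff_pointIdeal _ _ _).mpr ⟨n, n', hn, hn', ?_⟩).symm
  rw [← hN, ← hN, ← hN, ← hna, ← hnb, ← map_mul, ← map_mul, h, map_mul]

theorem toFun_neg [DecidableEq K] (P : W₁.toAffine.Point) : φ.toFun (-P) = -φ.toFun P := by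
  rw [eq_neg_iff_add_eq_zero, ← toFun_add, neg_add_cancel, toFun_zero]

theorem toFun_nsmul [DecidableEq K] (n : ℕ) (P : W₁.toAffine.Point) :
    φ.toFun (n • P) = n • φ.toFun P := by
  induction n with
  | zero => rw [zero_smul, zero_smul, toFun_zero]
  | succ n ih => rw [add_smul, add_smul, toFun_add, ih, one_smul, one_smul]

omit [W₁.IsElliptic] in
/-- A nonzero function does not vanish at all points. -/
theorem _root_.DualWeil.exists_aevalAeval_ne_zero {f : K[X][Y]} (hf : polyFun W₁ f ≠ 0) :
    ∃ x y, W₁.toAffine.Equation x y ∧ aevalAeval x y f ≠ 0 := by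
  by_contra! h
  -- In a finitely generated `K`-algebra that is a domain, the maximal ideals, which are the points,
  -- intersect in zero.
  have : IsJacobsonRing W₁.toAffine.CoordinateRing := isJacobsonRing_of_finiteType (A := K)
  have hmem : Affine.CoordinateRing.mk W₁.toAffine f ∈ (⊥ : Ideal W₁.toAffine.CoordinateRing).jacobson := by
    rw [Ideal.jacobson, Submodule.mem_sInf]
    rintro M ⟨-, hM⟩
    obtain ⟨x, y, hxy, rfl⟩ := exists_eq_XYIdeal W₁ M
    exact (mk_mem_XYIdeal_iff W₁ hxy f).mpr (h x y hxy)
  rw [IsJacobsonRing.out this Ideal.isPrime_bot.isRadical, Ideal.mem_bot] at hmem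
  exact hf (by rw [polyFun, hmem, map_zero])

/-- Some affine point avoids the zeros of the denominators of both `x₂ ∘ φ` and `y₂ ∘ φ`, and its
image is affine. -/
theorem exists_toFun_ne_zero : ∃ P, φ.toFun P ≠ 0 := by
  obtain ⟨a, b, hb, hab⟩ := exists_polyFun_div W₁ (φ.pullback (xFun W₂))
  obtain ⟨c, d, hd, hcd⟩ := exists_polyFun_div W₁ (φ.pullback (yFun W₂))
  have hbd : polyFun W₁ (b * d) ≠ 0 := by
    rw [polyFun, map_mul, map_mul]
    exact mul_ne_zero hb hd
  obtain ⟨x, y, hxy, hne⟩ := exists_aevalAeval_ne_zero hbd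
  rw [map_mul] at hne
  have hs := specializes_of_equation W₁ hxy
  have hu := HasVal.div hs (HasVal.of_aevalAeval (xFun W₁) (yFun W₁) x y a)
    (HasVal.of_aevalAeval (xFun W₁) (yFun W₁) x y b) (left_ne_zero_of_mul hne)
  have hv := HasVal.div hs (HasVal.of_aevalAeval (xFun W₁) (yFun W₁) x y c)
    (HasVal.of_aevalAeval (xFun W₁) (yFun W₁) x y d) (right_ne_zero_of_mul hne)
  rw [← polyFun_eq_aevalAeval, ← polyFun_eq_aevalAeval, ← hab] at hu
  rw [← polyFun_eq_aevalAeval, ← polyFun_eq_aevalAeval, ← hcd] at hv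
  refine ⟨.some x y (Affine.equation_iff_nonsingular.mp hxy), ?_⟩
  rw [φ.toFun_some_of_hasVal _ hu hv]
  exact fun h ↦ Affine.Point.some_ne_zero _ h

end Isogeny

end IsogenyHom

/-! ### Poles at affine points -/

section LinearCoeff

variable {K : Type*} [Field K] {W : WeierstrassCurve K} [W.IsShortNF]

/-- The local ring is a valuation ring. In `1 = s g + t` with denominators `s`, `t` of `g`, both lie
in the maximal ideal, so `s g = u` is a unit and `1/g = s/u` vanishes. -/
theorem hasVal_inv_zero_of_not_hasVal [IsAlgClosed K] [W.IsElliptic] {x y : K}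
    (h : W.toAffine.Equation x y) {g : W.toAffine.FunctionField}
    (hg : ¬ ∃ v, HasVal (xFun W) (yFun W) x y g v) :
    HasVal (xFun W) (yFun W) x y g⁻¹ 0 := by
  have hM := isMaximal_XYIdeal W h
  set M := Affine.CoordinateRing.XYIdeal W.toAffine x (C y) with hMdef
  have hg' := hg
  rw [hasVal_iff_exists_mem W h] at hg'
  push Not at hg'
  obtain ⟨s, t, u, r, hs, ht, hut⟩ := exists_denominators (A := W.toAffine.CoordinateRing) g
  have hsM : s ∈ M := by
    by_contra hc
    exact hg' s hc u (by rw [mul_comm, hs])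
  have htM : t ∈ M := by
    by_contra hc
    exact hg' t hc r (by rw [mul_comm, ht])
  have huM : u ∉ M := fun hu ↦
    (Ideal.ne_top_iff_one M).mp hM.ne_top (hut ▸ add_mem hu htM)
  have hsp := specializes_of_equation W h
  obtain ⟨f, hf⟩ := AdjoinRoot.mk_surjective u
  have hu0 : aevalAeval x y f ≠ 0 :=
    fun hc ↦ huM (hf ▸ (mk_mem_XYIdeal_iff W h f).mpr hc)
  have hu := HasVal.of_aevalAeval (xFun W) (yFun W) x y f
  have hfu : polyFun W f = algebraMap _ _ u := by rw [← hf]; rfl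
  rw [← polyFun_eq_aevalAeval, hfu] at hu
  have h0 := (hasVal_zero_iff_mem W h s).mpr hsM
  have hne := HasVal.ne_zero hsp hu hu0
  have := HasVal.div hsp h0 hu hu0
  rw [zero_div] at this
  have hg0 : g ≠ 0 := by
    rintro rfl
    exact hg ⟨0, by simpa using HasVal.const (ξ := xFun W) (η := yFun W) (x := x) (y := y) (0 : K)⟩
  convert this using 1
  rw [eq_div_iff hne, ← hs, mul_comm, mul_assoc, mul_inv_cancel₀ hg0, mul_one]

end LinearCoeff

/-! ### The coefficient `m` and the invariant derivation -/

section LinearCoeff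

variable {K : Type*} [Field K] {W₁ W₂ : WeierstrassCurve K} [W₁.IsShortNF]
  [W₂.IsShortNF]

omit [W₁.IsShortNF] in
theorem two_ne_zero_of_isElliptic (W : WeierstrassCurve K) [W.IsShortNF] [W.IsElliptic] :
    (2 : K) ≠ 0 := by
  intro h
  have := W.isUnit_Δ.ne_zero
  rw [Δ_of_isShortNF] at this
  exact this (by linear_combination (-8 * (4 * W.a₄ ^ 3 + 27 * W.a₆ ^ 2)) * h)

namespace Isogeny

variable (φ : Isogeny W₁ W₂)

-- The coefficient is the value of `(t₂ ∘ φ)/t₁` at `O`: subtracting it leaves a function that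
-- vanishes at `O` and is again divisible by `t₁`.
omit [W₂.IsShortNF] in
theorem existsUnique_hasLinearCoeff : ∃! m : K, φ.HasLinearCoeff m := by
  obtain ⟨r, m, hr, hrm⟩ := isBigOInfty_iff.mp φ.tFun_infty
  have h0 : HasVal (tFun W₁) (wFun W₁) (0 : K) 0 (r - algebraMap K _ m) 0 := by
    simpa using hrm.sub (HasVal.const m)
  obtain ⟨r', v', hr', hv'⟩ := h0.isBigOInfty
  refine ⟨m, isBigOInfty_iff.mpr ⟨r', v', ?_, hv'⟩, fun m' hm' ↦ ?_⟩
  · linear_combination hr + tFun W₁ * hr'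
  · obtain ⟨s, w, hs, hw⟩ := isBigOInfty_iff.mp hm'
    have : algebraMap K W₁.toAffine.FunctionField (m - m') = tFun W₁ * (s - r') := by
      refine mul_left_cancel₀ (tFun_ne_zero W₁) ?_
      rw [map_sub]
      linear_combination hs - hr - tFun W₁ * hr'
    have h1 := HasVal.const (ξ := tFun W₁) (η := wFun W₁) (x := (0 : K)) (y := 0) (m - m')
    rw [this] at h1
    have h2 := (HasVal.fst (tFun W₁) (wFun W₁) (0 : K) 0).mul (hw.sub hv')
    have h3 := h1.unique (specializes_infty W₁) h2
    linear_combination -h3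

/-- A derivation along `φ` is determined by its value on `x₂`, because differentiating the curve
equation gives its value on `y₂`. So any two of them are proportional. -/
theorem exists_invDer_pullback_eq [W₂.IsElliptic] : ∃ μ : W₁.toAffine.FunctionField, ∀ g,
    invDer W₁ (φ.pullback g) = μ * φ.pullback (invDer W₂ g) := by
  have hy : φ.pullback (yFun W₂) ≠ 0 := (_root_.map_ne_zero _).mpr (yFun_ne_zero W₂)
  have h2 : (2 : W₁.toAffine.FunctionField) ≠ 0 := by
    have := (map_ne_zero (algebraMap K W₁.toAffine.FunctionField)).mpr (two_ne_zero_of_isElliptic W₂)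
    rwa [map_ofNat] at this
  have h2y := mul_ne_zero h2 hy
  refine ⟨invDer W₁ (φ.pullback (xFun W₂)) / (2 * φ.pullback (yFun W₂)),
    invDer_eq_of_eq_on φ.pullback (invDer W₁) _ ?_ ?_⟩
  · rw [invDer_xFun, map_mul, map_ofNat, div_mul_cancel₀ _ h2y]
  · have := congrArg (invDer W₁) φ.pullback_yFun_sq
    simp only [map_add, Derivation.leibniz, pow_succ, pow_zero, one_mul, smul_eq_mul,
      Derivation.map_algebraMap, mul_zero, add_zero] at this
    rw [invDer_yFun, map_add, map_mul, map_ofNat, map_pow, AlgHom.commutes, div_mul_eq_mul_div,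
      eq_div_iff h2y]
    linear_combination this

/-- The local criterion at a point where the image is the point at infinity. -/
theorem hasVal_of_infty {ξ η μ : W₁.toAffine.FunctionField} {x y d : K}
    (hs : Specializes ξ η x y) (hμ : ∀ g, invDer W₁ (φ.pullback g) = μ * φ.pullback (invDer W₂ g))
    (ht : HasVal ξ η x y (φ.pullback (tFun W₂)) 0) (hw : HasVal ξ η x y (φ.pullback (wFun W₂)) 0)
    (hd : HasVal ξ η x y (invDer W₁ (φ.pullback (tFun W₂))) d) : HasVal ξ η x y μ d := by
  have h1 : HasVal ξ η x y (φ.pullback (invDer W₂ (tFun W₂))) 1 := by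
    have := (HasVal.one.sub (((ht.mul hw).const_mul W₂.a₄).const_mul 2)).sub
      (((hw.pow 2).const_mul W₂.a₆).const_mul 3)
    rw [invDer_tFun]
    convert this using 1
    · simp only [map_sub, map_mul, map_one, map_pow, AlgHom.commutes, map_ofNat]
      ring
    · ring
  have := hd.div hs h1 one_ne_zero
  rw [hμ, div_one, mul_div_cancel_right₀ _ (h1.ne_zero hs one_ne_zero)] at this
  exact this

/-- If only `x₂` had a pole, then `y²/x³ = 1 + A/x² + B/x³` would have both values 0 and 1. So `y₂`
has a pole and `w₂ = -1/y₂` vanishes; then `w = t³ + A t w² + B w³` excludes a pole of `t₂` and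
forces its value to be 0. -/
theorem hasVal_tFun_wFun [IsAlgClosed K] [W₁.IsElliptic] {x y : K}
    (h : W₁.toAffine.Equation x y)
    (hn : (¬ ∃ u, HasVal (xFun W₁) (yFun W₁) x y (φ.pullback (xFun W₂)) u) ∨
      ¬ ∃ v, HasVal (xFun W₁) (yFun W₁) x y (φ.pullback (yFun W₂)) v) :
    HasVal (xFun W₁) (yFun W₁) x y (φ.pullback (tFun W₂)) 0 ∧
      HasVal (xFun W₁) (yFun W₁) x y (φ.pullback (wFun W₂)) 0 := by
  have hs := specializes_of_equation W₁ h
  have hx0 : φ.pullback (xFun W₂) ≠ 0 := (_root_.map_ne_zero _).mpr (xFun_ne_zero W₂)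
  have hy : ¬ ∃ v, HasVal (xFun W₁) (yFun W₁) x y (φ.pullback (yFun W₂)) v := by
    rintro ⟨v, hv⟩
    have hx := hasVal_inv_zero_of_not_hasVal h (hn.resolve_right (not_not.mpr ⟨v, hv⟩))
    have h1 := (hv.pow 2).mul (hx.pow 3)
    have h2 := (HasVal.one.add ((hx.pow 2).const_mul W₂.a₄)).add ((hx.pow 3).const_mul W₂.a₆)
    rw [φ.pullback_yFun_sq] at h1
    have h3 := h1.unique hs (by convert h2 using 1; field_simp)
    norm_num at h3
  have hw : HasVal (xFun W₁) (yFun W₁) x y (φ.pullback (wFun W₂)) 0 := by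
    have := (hasVal_inv_zero_of_not_hasVal h hy).neg
    rw [neg_zero] at this
    rwa [wFun, map_neg, map_div₀, map_one, one_div]
  refine ⟨?_, hw⟩
  have hwt := congrArg φ.pullback (wFun_eq W₂)
  simp only [map_add, map_mul, map_pow, AlgHom.commutes] at hwt
  by_cases ht : ∃ τ, HasVal (xFun W₁) (yFun W₁) x y (φ.pullback (tFun W₂)) τ
  · obtain ⟨τ, hτ⟩ := ht
    have h1 := ((hτ.pow 3).add ((hτ.const_mul W₂.a₄).mul (hw.pow 2))).add
      ((hw.pow 3).const_mul W₂.a₆)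
    rw [← hwt] at h1
    have h2 := h1.unique hs hw
    have h3 : τ = 0 := by
      have : τ ^ 3 = 0 := by linear_combination h2
      exact pow_eq_zero_iff (by norm_num) |>.mp this
    rwa [h3] at hτ
  · exfalso
    have ht0 : φ.pullback (tFun W₂) ≠ 0 := (_root_.map_ne_zero _).mpr (tFun_ne_zero W₂)
    have hi := hasVal_inv_zero_of_not_hasVal h ht
    have h1 := ((hw.mul (hi.pow 3)).sub (((hw.pow 2).mul (hi.pow 2)).const_mul W₂.a₄)).sub
      (((hw.pow 3).mul (hi.pow 3)).const_mul W₂.a₆)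
    have h2 := h1.unique hs (w := 1) (by
      convert HasVal.one (ξ := xFun W₁) (η := yFun W₁) (x := x) (y := y) using 1
      generalize φ.pullback (wFun W₂) = w at *
      generalize φ.pullback (tFun W₂) = t at *
      field_simp
      linear_combination hwt)
    norm_num at h2

/-- The pullback of the invariant derivation. -/
theorem invDer_pullback [IsAlgClosed K] [W₁.IsElliptic] [W₂.IsElliptic] {m : K}
    (hm : φ.HasLinearCoeff m) (g : W₂.toAffine.FunctionField) :
    invDer W₁ (φ.pullback g) = algebraMap K _ m * φ.pullback (invDer W₂ g) := by
  obtain ⟨μ, hμ⟩ := φ.exists_invDer_pullback_eq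
  -- With `t₂ ∘ φ = m t + t² r`, the derivative has the value `m` at `O`, since `D t` is 1 there and
  -- `D r` is regular.
  have hinf : HasVal (tFun W₁) (wFun W₁) (0 : K) 0 μ m := by
    refine φ.hasVal_of_infty (specializes_infty W₁) hμ φ.tFun_infty.hasVal φ.wFun_infty.hasVal ?_
    obtain ⟨r, v, hr, hv⟩ := isBigOInfty_iff.mp hm
    obtain ⟨v', hv'⟩ := hv.invDer_infty
    obtain ⟨w, hw⟩ := (HasVal.fst (tFun W₁) (wFun W₁) (0 : K) 0).invDer_infty
    have ht := HasVal.fst (tFun W₁) (wFun W₁) (0 : K) 0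
    have hw1 := HasVal.snd (tFun W₁) (wFun W₁) (0 : K) 0
    have hDt : HasVal (tFun W₁) (wFun W₁) (0 : K) 0 (invDer W₁ (tFun W₁)) 1 := by
      have := (HasVal.one.sub (((ht.mul hw1).const_mul W₁.a₄).const_mul 2)).sub
        (((hw1.pow 2).const_mul W₁.a₆).const_mul 3)
      rw [invDer_tFun]
      convert this using 1
      · simp only [map_ofNat]
        ring
      · ring
    have h1 := (hDt.const_mul m).add (((ht.mul hDt).mul hv).const_mul 2 |>.add ((ht.pow 2).mul hv'))
    have : φ.pullback (tFun W₂) = algebraMap K _ m * tFun W₁ + tFun W₁ ^ 2 * r := by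
      linear_combination hr
    rw [this]
    convert h1 using 1
    · simp only [map_add, Derivation.leibniz, pow_succ, pow_zero, one_mul, smul_eq_mul,
        Derivation.map_algebraMap, mul_zero, add_zero, map_ofNat]
      ring
    · ring
  -- Regularity of `μ` at affine points: at an affine image point `D x₂` or `D y₂` is nonzero
  -- because the point is nonsingular, and at an image `O` the function `D t₂` is 1. Dividing by it
  -- exhibits `μ` as regular.
  obtain ⟨a, ha⟩ := exists_eq_algebraMap_of_forall_hasVal W₁ (g := μ) fun x y h ↦ by
    have hs := specializes_of_equation W₁ h
    rcases φ.toFun_cases (Affine.equation_iff_nonsingular.mp h) with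
      ⟨u, v, hn, -, hu, hv⟩ | ⟨-, hn⟩
    · obtain ⟨u', hu'⟩ := hu.invDer_affine h
      obtain ⟨v', hv'⟩ := hv.invDer_affine h
      rw [hμ, invDer_xFun, map_mul, map_ofNat] at hu'
      rw [hμ, invDer_yFun, map_add, map_mul, map_pow, map_ofNat, AlgHom.commutes] at hv'
      have h1 : HasVal (xFun W₁) (yFun W₁) x y (2 * φ.pullback (yFun W₂)) (2 * v) := by
        simpa only [map_ofNat] using hv.const_mul 2
      have h2 : HasVal (xFun W₁) (yFun W₁) x y (3 * φ.pullback (xFun W₂) ^ 2 + algebraMap K _ W₂.a₄)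
          (3 * u ^ 2 + W₂.a₄) := by
        simpa only [map_ofNat] using ((hu.pow 2).const_mul 3).add (HasVal.const W₂.a₄)
      have hor : 2 * v ≠ 0 ∨ 3 * u ^ 2 + W₂.a₄ ≠ 0 := by
        have := ((Affine.nonsingular_iff _ _).mp hn).2
        simp only [a₁_of_isShortNF, a₂_of_isShortNF, a₃_of_isShortNF] at this
        rcases this with h | h
        · right; contrapose! h; linear_combination -h
        · left; contrapose! h; linear_combination h
      rcases hor with h0 | h0
      · have := hu'.div hs h1 h0
        rw [mul_div_cancel_right₀ _ (h1.ne_zero hs h0)] at this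
        exact ⟨_, this⟩
      · have := hv'.div hs h2 h0
        rw [mul_div_cancel_right₀ _ (h2.ne_zero hs h0)] at this
        exact ⟨_, this⟩
    · obtain ⟨ht, hw⟩ := φ.hasVal_tFun_wFun h hn
      obtain ⟨d, hd⟩ := ht.invDer_affine h
      exact ⟨d, φ.hasVal_of_infty hs hμ ht hw hd⟩
  rw [ha] at hinf
  rw [exists_eq_algebraMap_of_hasVal_infty hinf, ← IsScalarTower.algebraMap_apply] at ha
  rw [hμ, ha]

end Isogeny

end LinearCoeff

/-! ### The group law of the canonical lift -/

section LiftGroup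

variable {K : Type*} [Field K] {W : WeierstrassCurve K}

theorem dual_mul_eq {a c d : K[ε]} (ha : a.fst ≠ 0) (h : c * a = d) : d * a⁻¹ = c := by
  rw [← h, mul_assoc, mul_comm a, dual_isUnit ha, mul_one]

theorem dual_fst_two : (2 : K[ε]).fst = 2 := rfl

theorem dual_fst_three : (3 : K[ε]).fst = 3 := rfl

/-- The coordinates of the sum of two translates `(x₁, y₁) + O_k` and `(x₂, y₂) + O_j`. -/
theorem dual_slope {A x₁ y₁ x₂ y₂ l k j x₃ y₃ : K} {X₁ Y₁ X₂ Y₂ S : K[ε]}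
    (hc : l * (x₁ - x₂) = y₁ - y₂)
    (ht : l * (y₁ + y₂) = x₁ ^ 2 + x₁ * x₂ + x₂ ^ 2 + A)
    (hx₃ : x₃ = l ^ 2 - x₁ - x₂) (hy₃ : y₃ = l * (x₁ - x₃) - y₁)
    (hX₁ : X₁ = TrivSqZeroExt.inl x₁ - TrivSqZeroExt.inr (k * (2 * y₁)))
    (hY₁ : Y₁ = TrivSqZeroExt.inl y₁ - TrivSqZeroExt.inr (k * (3 * x₁ ^ 2 + A)))
    (hX₂ : X₂ = TrivSqZeroExt.inl x₂ - TrivSqZeroExt.inr (j * (2 * y₂)))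
    (hY₂ : Y₂ = TrivSqZeroExt.inl y₂ - TrivSqZeroExt.inr (j * (3 * x₂ ^ 2 + A)))
    (hS : S = TrivSqZeroExt.inl l + TrivSqZeroExt.inr ((x₃ - x₁) * k + (x₃ - x₂) * j)) :
    S * (X₁ - X₂) = Y₁ - Y₂ ∧
    S * (Y₁ + Y₂) = X₁ ^ 2 + X₁ * X₂ + X₂ ^ 2 + TrivSqZeroExt.inl A ∧
    S ^ 2 - X₁ - X₂ = TrivSqZeroExt.inl x₃ - TrivSqZeroExt.inr ((k + j) * (2 * y₃)) ∧
    S * (X₁ - (S ^ 2 - X₁ - X₂)) - Y₁ =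
      TrivSqZeroExt.inl y₃ - TrivSqZeroExt.inr ((k + j) * (3 * x₃ ^ 2 + A)) := by
  subst hX₁ hY₁ hX₂ hY₂ hS
  refine ⟨?_, ?_, ?_, ?_⟩
  · ext
    · simpa using hc
    · simp
      subst hx₃
      grind
  · ext
    · simpa using ht
    · simp
      subst hx₃
      grind
  · ext
    · simp [hx₃]
    · simp
      subst hy₃ hx₃
      grind
  · ext
    · simp [hy₃, hx₃]
    · simp
      subst hy₃ hx₃
      grind

namespace Lift

variable [W.IsShortNF]

theorem mk_equation {x y : K} (h : W.toAffine.Equation x y) (k : K) :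
    (TrivSqZeroExt.inl y - TrivSqZeroExt.inr (k * (3 * x ^ 2 + W.a₄)) : K[ε]) ^ 2 =
      (TrivSqZeroExt.inl x - TrivSqZeroExt.inr (k * (2 * y))) ^ 3 + TrivSqZeroExt.inl W.a₄ *
        (TrivSqZeroExt.inl x - TrivSqZeroExt.inr (k * (2 * y))) + TrivSqZeroExt.inl W.a₆ := by
  have := (equation_iff_short W).mp h
  ext
  · simpa using this
  · simp
    ring

/-- The point `P + O_k`. -/
def mk : W.toAffine.Point → K → Lift W
  | .zero, k => infty k
  | .some x y h, k => affine (TrivSqZeroExt.inl x - TrivSqZeroExt.inr (k * (2 * y)))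
      (TrivSqZeroExt.inl y - TrivSqZeroExt.inr (k * (3 * x ^ 2 + W.a₄))) (mk_equation h.1 k)

theorem ofPoint_eq_mk (P : W.toAffine.Point) : ofPoint P = mk P 0 := by
  rcases P with _ | ⟨x, y, h⟩
  · rfl
  · simp [ofPoint, mk]

theorem mk_zero (k : K) : mk (0 : W.toAffine.Point) k = infty k := rfl

theorem neg_mk (P : W.toAffine.Point) (k : K) : -mk P k = mk (-P) (-k) := by
  rcases P with _ | ⟨x, y, h⟩
  · rfl
  · rw [Affine.Point.neg_some]
    simp only [mk]
    change affine _ _ _ = _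
    rw [affine.injEq]
    constructor <;> ext <;> simp

variable [W.IsElliptic]

theorem toPoint_mk (P : W.toAffine.Point) (k : K) : (mk P k).toPoint = P := by
  rcases P with _ | ⟨x, y, h⟩
  · rfl
  · simp [mk, toPoint]

omit [W.IsElliptic] in
theorem nonsingular_or {x y : K} (h : W.toAffine.Nonsingular x y) :
    2 * y ≠ 0 ∨ 3 * x ^ 2 + W.a₄ ≠ 0 := by
  have := ((Affine.nonsingular_iff _ _).mp h).2
  simp only [a₁_of_isShortNF, a₂_of_isShortNF, a₃_of_isShortNF] at this
  rcases this with h | h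
  · right; contrapose! h; linear_combination -h
  · left; contrapose! h; linear_combination h

/-- The `ε`-part of the equation says that `(x.snd, y.snd)` is tangent to the curve at the
reduction, and the tangent line is spanned by the nonzero vector `(2y, 3x² + A)`. -/
theorem exists_eq_mk (P : Lift W) : ∃ k, P = mk P.toPoint k := by
  rcases P with ⟨x, y, h⟩ | k
  · have hn : W.toAffine.Nonsingular x.fst y.fst := by
      rw [nonsingular_iff_short]
      simpa using congrArg TrivSqZeroExt.fst h
    have h1 : 2 * y.fst * y.snd = (3 * x.fst ^ 2 + W.a₄) * x.snd := by
      have := congrArg TrivSqZeroExt.snd h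
      simp [pow_succ] at this
      linear_combination this
    have : ∃ k, x.snd = -(k * (2 * y.fst)) ∧ y.snd = -(k * (3 * x.fst ^ 2 + W.a₄)) := by
      rcases nonsingular_or hn with h0 | h0
      · refine ⟨-(x.snd / (2 * y.fst)), ?_, mul_left_cancel₀ h0 ?_⟩
        · rw [neg_mul, neg_neg, div_mul_cancel₀ _ h0]
        · rw [h1, neg_mul, neg_neg, ← mul_assoc, mul_div_cancel₀ _ h0, mul_comm]
      · refine ⟨-(y.snd / (3 * x.fst ^ 2 + W.a₄)), mul_left_cancel₀ h0 ?_, ?_⟩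
        · rw [← h1, neg_mul, neg_neg, ← mul_assoc, mul_div_cancel₀ _ h0, mul_comm]
        · rw [neg_mul, neg_neg, div_mul_cancel₀ _ h0]
    obtain ⟨k, hx, hy⟩ := this
    refine ⟨k, ?_⟩
    simp only [toPoint, mk, affine.injEq]
    constructor <;> ext <;> simp [hx, hy]
  · exact ⟨k, rfl⟩

-- Translation by `O_k` is the flow of an invariant vector field, so it commutes with addition. The
-- identification with `E(K) × K` replaces the case distinctions of the addition law in everything
-- that follows.
omit [W.IsElliptic] in
theorem mk_add_mk [DecidableEq K] (P Q : W.toAffine.Point) (k j : K) :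
    mk P k + mk Q j = mk (P + Q) (k + j) := by
  change add _ _ = _
  rcases P with _ | ⟨x₁, y₁, h₁⟩
  · change _ = mk (0 + Q) _
    rw [zero_add]
    rcases Q with _ | ⟨x₂, y₂, h₂⟩
    · rfl
    · simp only [mk, add, translate, affine.injEq]
      constructor <;> ext <;> simp [dual_fst_two, dual_fst_three] <;> ring
  rcases Q with _ | ⟨x₂, y₂, h₂⟩
  · change _ = mk (_ + 0) _
    rw [add_zero]
    simp only [mk, add, translate, affine.injEq]
    constructor <;> ext <;> simp [dual_fst_two, dual_fst_three] <;> ring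
  have e₁ := (equation_iff_short W).mp h₁.1
  have e₂ := (equation_iff_short W).mp h₂.1
  by_cases hxy : x₁ = x₂ ∧ y₁ = W.toAffine.negY x₂ y₂
  · rw [Affine.Point.add_of_Y_eq hxy.1 hxy.2, mk_zero]
    obtain ⟨rfl, hy⟩ := hxy
    simp only [Affine.negY, a₁_of_isShortNF, a₃_of_isShortNF, zero_mul, sub_zero] at hy
    obtain rfl : y₂ = -y₁ := by rw [hy, neg_neg]
    have hx0 : ¬ ((TrivSqZeroExt.inl x₁ - TrivSqZeroExt.inr (k * (2 * y₁)) : K[ε]) -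
        (TrivSqZeroExt.inl x₁ - TrivSqZeroExt.inr (j * (2 * -y₁)))).fst ≠ 0 := by simp
    have hy0 : ¬ ((TrivSqZeroExt.inl y₁ - TrivSqZeroExt.inr (k * (3 * x₁ ^ 2 + W.a₄)) : K[ε]) +
        (TrivSqZeroExt.inl (-y₁) - TrivSqZeroExt.inr (j * (3 * x₁ ^ 2 + W.a₄)))).fst ≠ 0 := by simp
    simp only [mk, add]
    rw [dif_neg hx0, dif_neg hy0]
    -- Opposite points: with `2y₁ ≠ 0` the reciprocal slope is `-2y₁(k + j)ε / 2y₁`. At a point of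
    -- order two the other expression gives `-(k + j)(3x₁² + A)ε / (3x₁² + A)`.
    split_ifs with h0
    · rw [infty.injEq]
      have h0' : y₁ + y₁ ≠ 0 := by simpa using h0
      rw [← two_mul] at h0'
      have h2 := left_ne_zero_of_mul h0'
      have hy1 := right_ne_zero_of_mul h0'
      simp [← two_mul]
      field_simp
      ring
    · rw [infty.injEq]
      have h0' : 2 * y₁ = 0 := by simpa [two_mul] using h0
      have h1 := (nonsingular_or h₁).resolve_left (not_not.mpr h0')
      have h2 : x₁ ^ 2 + x₁ * x₁ + x₁ ^ 2 + W.a₄ = 3 * x₁ ^ 2 + W.a₄ := by ring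
      simp [h2]
      field_simp
      ring
  · rw [Affine.Point.add_some hxy]
    have hres := Affine.nonsingular_add h₁ h₂ hxy
    simp only [Affine.negY, a₁_of_isShortNF, a₃_of_isShortNF, zero_mul, sub_zero] at hxy
    set l := W.toAffine.slope x₁ x₂ y₁ y₂ with hl
    -- The slope satisfies the chord equation `hcl` and the tangent equation `htl` at once, so
    -- either branch of the addition over `K[ε]` has the same slope.
    have hcl : l * (x₁ - x₂) = y₁ - y₂ := by
      by_cases hx : x₁ = x₂
      · have hy : y₁ ≠ -y₂ := fun h ↦ hxy ⟨hx, h⟩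
        have : (y₁ - y₂) * (y₁ + y₂) = 0 := by
          rw [← hx] at e₂
          linear_combination e₁ - e₂
        rcases mul_eq_zero.mp this with h | h
        · rw [h, hx, sub_self, mul_zero]
        · exact absurd (eq_neg_of_add_eq_zero_left h) hy
      · rw [hl, Affine.slope_of_X_ne hx, div_mul_cancel₀ _ (sub_ne_zero.mpr hx)]
    have htl : l * (y₁ + y₂) = x₁ ^ 2 + x₁ * x₂ + x₂ ^ 2 + W.a₄ := by
      by_cases hx : x₁ = x₂
      · have hy : y₁ ≠ W.toAffine.negY x₂ y₂ := by
          simp only [Affine.negY, a₁_of_isShortNF, a₃_of_isShortNF, zero_mul, sub_zero]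
          exact fun h ↦ hxy ⟨hx, h⟩
        rw [hl, Affine.slope_of_Y_ne hx hy]
        simp only [Affine.negY, a₁_of_isShortNF, a₂_of_isShortNF, a₃_of_isShortNF, zero_mul,
          sub_zero, mul_zero, add_zero, sub_neg_eq_add]
        have hyy : y₁ = y₂ := by rw [hx, sub_self, mul_zero] at hcl; exact (sub_eq_zero.mp hcl.symm)
        rw [← hyy, div_mul_cancel₀, ← hx]
        · ring
        · intro h
          exact hxy ⟨hx, by rw [← hyy]; exact eq_neg_of_add_eq_zero_left h⟩
      · refine mul_left_cancel₀ (sub_ne_zero.mpr hx) ?_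
        linear_combination (y₁ + y₂) * hcl + e₁ - e₂
    -- The `ε`-part of the lifted slope is the first order variation of `l` when both points move
    -- along the invariant vector field.
    obtain ⟨hC, hT, hX, hY⟩ := dual_slope (k := k) (j := j) hcl htl rfl rfl rfl rfl rfl rfl rfl
    have hX₃ : W.toAffine.addX x₁ x₂ l = l ^ 2 - x₁ - x₂ := by
      simp [Affine.addX]
    have hY₃ : W.toAffine.addY x₁ x₂ y₁ l = l * (x₁ - (l ^ 2 - x₁ - x₂)) - y₁ := by
      simp only [Affine.addY, Affine.negAddY, Affine.negY, hX₃, a₁_of_isShortNF, a₃_of_isShortNF]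
      ring
    simp only [mk, add]
    split_ifs with hx hy hy'
    · rw [affine.injEq, dual_mul_eq hx hC, hY, hX, ← hl, hX₃, hY₃]
      exact ⟨rfl, rfl⟩
    · rw [affine.injEq, dual_mul_eq hy hT, hY, hX, ← hl, hX₃, hY₃]
      exact ⟨rfl, rfl⟩
    all_goals
      exfalso
      have hx' : x₁ = x₂ := by simpa [sub_eq_zero] using hx
      exact hxy ⟨hx', eq_neg_of_add_eq_zero_left (by simpa using hy)⟩

theorem theta_mk (P : W.toAffine.Point) (k : K) : (mk P k).theta = k := by
  classical
  simp only [theta]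
  rw [toPoint_mk, ofPoint_eq_mk, neg_mk, mk_add_mk, add_neg_cancel, neg_zero, add_zero, mk_zero]

omit [W.IsElliptic] in
theorem mulNat_mk [DecidableEq K] (n : ℕ) (P : W.toAffine.Point) (k : K) :
    mulNat n (mk P k) = mk (n • P) (n * k) := by
  induction n with
  | zero => simp only [mulNat, Function.iterate_zero, id, zero_smul, Nat.cast_zero, zero_mul]; rfl
  | succ n ih =>
    rw [mulNat, Function.iterate_succ_apply', ← mulNat, ih, mk_add_mk, add_smul, one_smul,
      add_comm P]
    congr 1
    push_cast
    ring

theorem mk_eq_zero_iff (P : W.toAffine.Point) (k : K) : mk P k = 0 ↔ P = 0 ∧ k = 0 := by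
  constructor
  · intro h
    have h1 := congrArg toPoint h
    have h2 := congrArg theta h
    change _ = toPoint (mk 0 0) at h1
    change _ = theta (mk 0 0) at h2
    rw [toPoint_mk, toPoint_mk] at h1
    rw [theta_mk, theta_mk] at h2
    exact ⟨h1, h2⟩
  · rintro ⟨rfl, rfl⟩
    rfl

end Lift

end LiftGroup

/-! ### Existence and uniqueness of the extension -/

section Extension

variable {K : Type*} [Field K] {W₁ W₂ : WeierstrassCurve K} [W₁.IsShortNF] [W₁.IsElliptic]
  [W₂.IsShortNF] [W₂.IsElliptic] (φ : Isogeny W₁ W₂)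

namespace Isogeny

/-- The extension of an isogeny to the canonical lifts. -/
noncomputable def extend (m : K) (P : Lift W₁) : Lift W₂ :=
  Lift.mk (φ.toFun P.toPoint) (m * P.theta)

omit [W₂.IsElliptic] in
theorem extend_mk (m : K) (P : W₁.toAffine.Point) (k : K) :
    φ.extend m (Lift.mk P k) = Lift.mk (φ.toFun P) (m * k) := by
  rw [extend, Lift.toPoint_mk, Lift.theta_mk]

omit [W₂.IsElliptic] in
theorem extend_ofPoint (m : K) (P : W₁.toAffine.Point) :
    φ.extend m (Lift.ofPoint P) = Lift.ofPoint (φ.toFun P) := by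
  rw [Lift.ofPoint_eq_mk, extend_mk, mul_zero, Lift.ofPoint_eq_mk]

variable [IsAlgClosed K]

theorem extend_add (m : K) (P Q : Lift W₁) :
    φ.extend m (P + Q) = φ.extend m P + φ.extend m Q := by
  classical
  obtain ⟨k, hk⟩ := Lift.exists_eq_mk P
  obtain ⟨j, hj⟩ := Lift.exists_eq_mk Q
  rw [hk, hj, Lift.mk_add_mk, extend_mk, extend_mk, extend_mk, Lift.mk_add_mk, toFun_add, mul_add]

variable {φ} {m : K}

/-- Since `D(x₂ ∘ φ) = m (D x₂) ∘ φ`, the value of `x₂ ∘ φ` at `P + O_k` is the `x`-coordinate of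
`φ(P) + O_{mk}`, and similarly for `y₂`. The condition over the kernel holds for any homomorphism
extending `φ`. -/
theorem isExtension_extend (hm : φ.HasLinearCoeff m) : IsExtension φ m (φ.extend m) where
  map_infty k := φ.extend_mk m 0 k
  map_affine x y h hφ := by
    obtain ⟨k, hk⟩ := Lift.exists_eq_mk (Lift.affine x y h)
    generalize (Lift.affine x y h).toPoint = P at hφ hk
    rcases P with _ | ⟨x₀, y₀, h₀⟩
    · exact absurd rfl hφ
    rcases φ.toFun_cases h₀ with ⟨u, v, hn, he, hu, hv⟩ | ⟨he, -⟩
    swap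
    · exact absurd he hφ
    rw [hk, extend_mk, he]
    rw [Lift.mk, Lift.affine.injEq] at hk
    obtain ⟨rfl, rfl⟩ := hk
    refine ⟨_, _, _, rfl, ?_, ?_⟩
    · have hu' : HasVal (xFun W₁) (yFun W₁) x₀ y₀ (invDer W₁ (φ.pullback (xFun W₂)))
          (m * (2 * v)) := by
        rw [φ.invDer_pullback hm, invDer_xFun, map_mul, map_ofNat]
        simpa only [map_ofNat] using (hv.const_mul 2).const_mul m
      convert hu.hasValue_translate h₀.1 hu' k using 3
      ring
    · have hv' : HasVal (xFun W₁) (yFun W₁) x₀ y₀ (invDer W₁ (φ.pullback (yFun W₂)))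
          (m * (3 * u ^ 2 + W₂.a₄)) := by
        rw [φ.invDer_pullback hm, invDer_yFun, map_add, map_mul, map_pow, map_ofNat,
          AlgHom.commutes]
        simpa only [map_ofNat] using
          (((hu.pow 2).const_mul 3).add (HasVal.const W₂.a₄)).const_mul m
      convert hv.hasValue_translate h₀.1 hv' k using 3
      ring
  map_ker x y h T _ _ := by
    classical
    rw [extend_add, extend_ofPoint, Lift.ofPoint_eq_mk, Lift.ofPoint_eq_mk, toFun_neg]
    obtain ⟨k, hk⟩ := Lift.exists_eq_mk (φ.extend m (Lift.affine x y h))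
    rw [hk, Lift.mk_add_mk, Lift.mk_add_mk, add_neg_cancel_right, add_zero, add_zero]

/-- Outside the kernel the values of functions are unique. A translation by some `T ∉ ker φ` moves
the points over the kernel out of it. -/
theorem _root_.DualWeil.IsExtension.unique {F G : Lift W₁ → Lift W₂} (hF : IsExtension φ m F)
    (hG : IsExtension φ m G) : G = F := by
  classical
  have h1 (P : Lift W₁) (hP : φ.toFun P.toPoint ≠ 0) : G P = F P := by
    rcases P with ⟨x, y, h⟩ | k
    · obtain ⟨u, v, h', he, hu, hv⟩ := hF.map_affine x y h hP
      obtain ⟨u', v', h'', he', hu', hv'⟩ := hG.map_affine x y h hP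
      rw [he, he', Lift.affine.injEq]
      exact ⟨HasValue.unique h hu' hu, HasValue.unique h hv' hv⟩
    · exact absurd rfl hP
  funext P
  by_cases hP : φ.toFun P.toPoint = 0
  · rcases P with ⟨x, y, h⟩ | k
    · obtain ⟨T, hT⟩ := φ.exists_toFun_ne_zero
      rw [hF.map_ker x y h T hP hT, hG.map_ker x y h T hP hT, h1]
      obtain ⟨k, hk⟩ := Lift.exists_eq_mk (Lift.affine x y h)
      rw [hk, Lift.ofPoint_eq_mk, Lift.mk_add_mk, Lift.toPoint_mk, toFun_add, hP, zero_add]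
      exact hT
    · rw [hF.map_infty, hG.map_infty]
  · exact h1 P hP

end Isogeny

variable {W : WeierstrassCurve K} [W.IsShortNF] [W.IsElliptic]

/-- The infinitesimal part is killed by `p` in characteristic `p`, so being `p`-torsion is a
condition on the reduction only. -/
theorem Lift.mulNat_eq_zero_iff [DecidableEq K] {p : ℕ} [CharP K p] (P : W.toAffine.Point) (k : K) :
    mulNat p (mk P k) = 0 ↔ p • P = 0 := by
  rw [mulNat_mk, mk_eq_zero_iff, CharP.cast_eq_zero, zero_mul]
  simp

end Extension

/-! ### Constant logarithmic derivatives in characteristic `p` -/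

section LogDerivative

variable {K : Type*} [Field K] [IsAlgClosed K] {W : WeierstrassCurve K} [W.IsShortNF]

omit [IsAlgClosed K] in
theorem hasVal_div_algebraMap {x y : K} (h : W.toAffine.Equation x y)
    (a : W.toAffine.CoordinateRing) {b : W.toAffine.CoordinateRing}
    (hb : b ∉ Affine.CoordinateRing.XYIdeal W.toAffine x (C y)) :
    ∃ v, HasVal (xFun W) (yFun W) x y
      (algebraMap _ W.toAffine.FunctionField a / algebraMap _ W.toAffine.FunctionField b) v := by
  refine (hasVal_iff_exists_mem W h).mpr ⟨b, hb, a, div_mul_cancel₀ _ ?_⟩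
  rw [Ne, map_eq_zero_iff _ (IsFractionRing.injective _ _)]
  rintro rfl
  exact hb (zero_mem _)

omit [IsAlgClosed K] in
/-- In characteristic `p`, a function whose divisor is `p` times a point has a regular logarithmic
derivative at this point. -/
theorem exists_mul_eq_mul_invDer [W.IsElliptic] {p : ℕ} [CharP K p] {x y : K}
    (h : W.toAffine.Nonsingular x y)
    {f f' : W.toAffine.CoordinateRing} (hf0 : f ≠ 0)
    (hf : Ideal.span {f} = Affine.CoordinateRing.XYIdeal W.toAffine x (C y) ^ p)
    (hf' : invDer W (algebraMap _ _ f) = algebraMap _ _ f') :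
    ∃ g ∉ Affine.CoordinateRing.XYIdeal W.toAffine x (C y), ∃ g', g * f' = g' * f := by
  set I := Affine.CoordinateRing.XYIdeal W.toAffine x (C y) with hI
  have hmax : I.IsMaximal := isMaximal_XYIdeal W h.1
  have hinj := IsFractionRing.injective W.toAffine.CoordinateRing W.toAffine.FunctionField
  obtain ⟨π, hπ, s, hs, hsπ⟩ := exists_local_generator W h
  have hle : Ideal.span {s} * I ≤ Ideal.span {π} := by
    rw [Ideal.mul_le]
    intro a ha i hi
    obtain ⟨b, rfl⟩ := Ideal.mem_span_singleton'.mp ha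
    obtain ⟨r, hr⟩ := hsπ i hi
    exact Ideal.mem_span_singleton'.mpr ⟨b * r, by linear_combination -b * hr⟩
  -- With a local generator `π` of `I` this gives `s^p f = g π^p`, where `g` is a unit at the point.
  have hpow : s ^ p * f ∈ Ideal.span {π ^ p} := by
    have := Ideal.pow_right_mono hle p
    rw [mul_pow, Ideal.span_singleton_pow, Ideal.span_singleton_pow, ← hf] at this
    exact this (Ideal.mul_mem_mul (Ideal.mem_span_singleton_self _) (Ideal.mem_span_singleton_self _))
  obtain ⟨g, hg⟩ := Ideal.mem_span_singleton'.mp hpow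
  have hπp : π ^ p ∈ Ideal.span {f} := hf ▸ Ideal.pow_mem_pow hπ p
  obtain ⟨r, hr⟩ := Ideal.mem_span_singleton'.mp hπp
  have hsg : s ^ p = g * r := by
    refine mul_right_cancel₀ hf0 ?_
    rw [← hg, ← hr]
    ring
  have hgI : g ∉ I := fun hc ↦ hs (hmax.isPrime.mem_of_pow_mem p (hsg ▸ I.mul_mem_right _ hc))
  obtain ⟨g', hg', -⟩ := exists_invDer_coordinateRing (W := W) g
  refine ⟨g, hgI, g', hinj ?_⟩
  have : CharP W.toAffine.FunctionField p := charP_of_injective_algebraMap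
    (algebraMap K W.toAffine.FunctionField).injective p
  -- Because `p`-th powers have derivative zero, `s^p D f = (D g) π^p`. Hence `D f/f = D g/g`, and
  -- the denominator `g` does not vanish at the point.
  have hD (a : W.toAffine.FunctionField) : invDer W (a ^ p) = 0 := by
    rw [Derivation.leibniz_pow, ← Nat.cast_smul_eq_nsmul W.toAffine.FunctionField,
      CharP.cast_eq_zero, zero_smul]
  have h1 := congrArg (fun a ↦ invDer W (algebraMap _ _ a)) hg
  simp only [map_mul, map_pow, Derivation.leibniz, hD, smul_eq_mul, hf', hg'] at h1
  have h2 := congrArg (algebraMap _ W.toAffine.FunctionField) hg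
  rw [map_mul, map_mul, map_pow, map_pow] at h2
  have hs0 : algebraMap _ W.toAffine.FunctionField s ^ p ≠ 0 := by
    refine pow_ne_zero _ fun hc ↦ hs ?_
    rw [map_eq_zero_iff _ hinj] at hc
    exact hc ▸ zero_mem _
  refine mul_left_cancel₀ hs0 ?_
  rw [map_mul, map_mul]
  linear_combination (-algebraMap _ W.toAffine.FunctionField g) * h1 +
    algebraMap _ W.toAffine.FunctionField g' * h2

/-- A function whose divisor is `p` times that of a point of order `p` has a constant logarithmic
derivative. -/
theorem exists_invDer_eq_mul [W.IsElliptic] {p : ℕ} [CharP K p] (P : W.toAffine.Point)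
    {f : W.toAffine.CoordinateRing} (hf0 : f ≠ 0) (hf : Ideal.span {f} = pointIdeal P ^ p) :
    ∃ c : K, invDer W (algebraMap _ _ f) = algebraMap K _ c * algebraMap _ _ f := by
  have hinj := IsFractionRing.injective W.toAffine.CoordinateRing W.toAffine.FunctionField
  have hfL : algebraMap _ W.toAffine.FunctionField f ≠ 0 := by rwa [Ne, map_eq_zero_iff _ hinj]
  obtain ⟨f', hf', hord⟩ := exists_invDer_coordinateRing (W := W) f
  -- `D f/f` is regular at all affine points: where `f` does not vanish this is clear, and `f` can
  -- vanish only at `P`.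
  obtain ⟨g, hg⟩ := exists_eq_algebraMap_of_forall_hasVal W
    (g := algebraMap _ W.toAffine.FunctionField f' / algebraMap _ W.toAffine.FunctionField f)
      fun x y h ↦ by
    by_cases hfM : f ∈ Affine.CoordinateRing.XYIdeal W.toAffine x (C y)
    swap
    · exact hasVal_div_algebraMap h f' hfM
    have hmax := isMaximal_XYIdeal W h
    have hle : pointIdeal P ^ p ≤ Affine.CoordinateRing.XYIdeal W.toAffine x (C y) := by
      rw [← hf, Ideal.span_singleton_le_iff_mem]
      exact hfM
    have hle' := hmax.isPrime.le_of_pow_le hle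
    rcases P with _ | ⟨x', y', h'⟩
    · exact absurd (top_le_iff.mp hle') hmax.ne_top
    have heq := (isMaximal_XYIdeal W h'.1).eq_of_le hmax.ne_top hle'
    rw [pointIdeal, heq] at hf
    obtain ⟨g, hg, g', hgg⟩ :=
      exists_mul_eq_mul_invDer (Affine.equation_iff_nonsingular.mp h) hf0 hf hf'
    have hgL : algebraMap _ W.toAffine.FunctionField g ≠ 0 := by
      rw [Ne, map_eq_zero_iff _ hinj]
      rintro rfl
      exact hg (zero_mem _)
    obtain ⟨v, hv⟩ := hasVal_div_algebraMap h g' hg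
    refine ⟨v, ?_⟩
    convert hv using 1
    rw [div_eq_div_iff hfL hgL, ← map_mul, ← map_mul, mul_comm f' g, hgg]
  rw [div_eq_iff hfL, ← map_mul] at hg
  have hfg := hinj hg
  -- `D` raises the pole order by at most one, so `D f/f` has pole order at most one at infinity,
  -- and such functions are constant.
  have hgord : poleOrder W g ≤ 1 := by
    rw [hfg, poleOrder_mul] at hord
    have hfb : poleOrder W f ≠ ⊥ := fun hc ↦ hf0 (poleOrder_eq_bot_iff.mp hc)
    rw [add_comm] at hord
    exact (WithBot.add_le_add_iff_left hfb).mp hord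
  obtain ⟨c, rfl⟩ := exists_eq_algebraMap_of_poleOrder_le_one hgord
  refine ⟨c, ?_⟩
  rw [hf', hfg, map_mul, ← IsScalarTower.algebraMap_apply]

-- Two generators of the same ideal differ by a constant factor, so the logarithmic derivative
-- depends only on the divisor.
omit [IsAlgClosed K] in
theorem invDer_eq_mul_of_span_eq {f g : W.toAffine.CoordinateRing} {c : K}
    (h : Ideal.span {f} = Ideal.span {g})
    (hf : invDer W (algebraMap _ _ f) = algebraMap K _ c * algebraMap _ _ f) :
    invDer W (algebraMap _ _ g) = algebraMap K _ c * algebraMap _ _ g := by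
  obtain ⟨u, rfl⟩ := Ideal.span_singleton_eq_span_singleton.mp h
  obtain ⟨d, -, hd⟩ := exists_eq_algebraMap_of_isUnit u.isUnit
  rw [map_mul, hd, ← IsScalarTower.algebraMap_apply, Derivation.leibniz, Derivation.map_algebraMap,
    smul_zero, zero_add, hf, smul_eq_mul]
  ring

end LogDerivative

/-! ### Divisors of lines and of chain products -/

section Divisors

open Ideal Affine

variable {K : Type*} [Field K] {W : WeierstrassCurve K}

/-- The divisor of the function `g` on the affine curve is that of the ideal `I` minus that of the
ideal `J`. -/
def HasDivisor (g : W.toAffine.FunctionField) (I J : Ideal W.toAffine.CoordinateRing) : Prop :=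
  ∃ a b : W.toAffine.CoordinateRing, b ≠ 0 ∧ g * algebraMap _ _ b = algebraMap _ _ a ∧
    span {a} * J = span {b} * I

namespace HasDivisor

variable {g h : W.toAffine.FunctionField} {I J I' J' : Ideal W.toAffine.CoordinateRing}

theorem one (I : Ideal W.toAffine.CoordinateRing) :
    HasDivisor (1 : W.toAffine.FunctionField) I I :=
  ⟨1, 1, one_ne_zero, by simp, rfl⟩

theorem mul (hg : HasDivisor g I J) (hh : HasDivisor h I' J') :
    HasDivisor (g * h) (I * I') (J * J') := by
  obtain ⟨a, b, hb, h1, h2⟩ := hg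
  obtain ⟨a', b', hb', h1', h2'⟩ := hh
  refine ⟨a * a', b * b', mul_ne_zero hb hb', ?_, ?_⟩
  · rw [map_mul, map_mul, ← h1, ← h1']
    ring
  · rw [← span_singleton_mul_span_singleton, ← span_singleton_mul_span_singleton,
      mul_mul_mul_comm, h2, h2', mul_mul_mul_comm]

theorem exists_span_eq (hg : HasDivisor g I ⊤) :
    ∃ f : W.toAffine.CoordinateRing, g = algebraMap _ _ f ∧ span {f} = I := by
  obtain ⟨a, b, hb, h1, h2⟩ := hg
  rw [mul_top] at h2
  have : a ∈ span {b} := by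
    have h := mem_span_singleton_self a
    rw [h2] at h
    exact (Ideal.mul_le_inf.trans inf_le_left) h
  obtain ⟨f, rfl⟩ := mem_span_singleton'.mp this
  have hbL : algebraMap _ W.toAffine.FunctionField b ≠ 0 := by
    rwa [Ne, map_eq_zero_iff _ (IsFractionRing.injective _ _)]
  refine ⟨f, mul_right_cancel₀ hbL (by rw [h1, map_mul]), ?_⟩
  rw [mul_comm, ← span_singleton_mul_span_singleton] at h2
  exact (span_singleton_mul_right_inj hb).mp h2

variable [IsAlgClosed K] [W.IsShortNF] [W.IsElliptic]

theorem of_mul_right {X : Ideal W.toAffine.CoordinateRing} (hX : X ≠ ⊥)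
    (hg : HasDivisor g (I * X) (J * X)) : HasDivisor g I J := by
  obtain ⟨a, b, hb, h1, h2⟩ := hg
  refine ⟨a, b, hb, h1, ?_⟩
  rw [← mul_assoc, ← mul_assoc] at h2
  exact mul_right_cancel₀ hX h2

end HasDivisor

section Lines

variable [DecidableEq K]

/-- The equation of the line through two points. -/
noncomputable def linePoly : W.toAffine.Point → W.toAffine.Point → K[X][Y]
  | .some x₁ y₁ _, .some x₂ y₂ _ =>
    Y - C (Affine.linePolynomial x₁ y₁ (W.toAffine.slope x₁ x₂ y₁ y₂))
  | _, _ => 1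

omit [DecidableEq K] in
/-- The equation of the vertical line through a point. -/
noncomputable def verticalPoly : W.toAffine.Point → K[X][Y]
  | .some x₁ _ _ => C (X - C x₁)
  | .zero => 1

theorem aevalAeval_linePoly (P Q : W.toAffine.Point) (x y : K[ε]) :
    aevalAeval x y (linePoly P Q) = lineAt P Q x y := by
  rcases P with _ | ⟨x₁, y₁, h₁⟩ <;> rcases Q with _ | ⟨x₂, y₂, h₂⟩
  · exact map_one _
  · exact map_one _
  · exact map_one _
  · have hC (c : K) : algebraMap K K[ε] c = TrivSqZeroExt.inl c := rfl
    simp [linePoly, lineAt, Affine.linePolynomial, hC]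
    ring

omit [DecidableEq K] in
theorem aevalAeval_verticalPoly (P : W.toAffine.Point) (x y : K[ε]) :
    aevalAeval x y (verticalPoly P) = verticalAt P x := by
  rcases P with _ | ⟨x₁, y₁, h₁⟩
  · exact map_one _
  · have hC (c : K) : algebraMap K K[ε] c = TrivSqZeroExt.inl c := rfl
    simp [verticalPoly, verticalAt, hC]

omit [DecidableEq K] in
theorem verticalPoly_ne_zero (P : W.toAffine.Point) : polyFun W (verticalPoly P) ≠ 0 := by
  rw [polyFun, Ne, map_eq_zero_iff _ (IsFractionRing.injective _ _)]
  rcases P with _ | ⟨x₁, y₁, h₁⟩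
  · rw [verticalPoly, map_one]
    exact one_ne_zero
  · exact CoordinateRing.XClass_ne_zero x₁

omit [DecidableEq K] in
theorem span_verticalPoly (P : W.toAffine.Point) :
    span {CoordinateRing.mk W.toAffine (verticalPoly P)} = pointIdeal P * pointIdeal (-P) := by
  rcases P with _ | ⟨x₁, y₁, h₁⟩
  · change _ = ⊤ * ⊤
    rw [verticalPoly, map_one, span_singleton_one, mul_top]
  · rw [Affine.Point.neg_some, mul_comm]
    exact (CoordinateRing.XYIdeal_neg_mul h₁).symm

theorem span_linePoly {P Q : W.toAffine.Point} (hP : P ≠ 0) (hQ : Q ≠ 0) (hPQ : P + Q ≠ 0) :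
    span {CoordinateRing.mk W.toAffine (verticalPoly (P + Q))} * (pointIdeal P * pointIdeal Q) =
      span {CoordinateRing.mk W.toAffine (linePoly P Q)} * pointIdeal (P + Q) := by
  rcases P with _ | ⟨x₁, y₁, h₁⟩
  · exact absurd rfl hP
  rcases Q with _ | ⟨x₂, y₂, h₂⟩
  · exact absurd rfl hQ
  have hxy : ¬ (x₁ = x₂ ∧ y₁ = W.toAffine.negY x₂ y₂) := fun h ↦
    hPQ (Affine.Point.add_of_Y_eq h.1 h.2)
  rw [Affine.Point.add_some hxy]
  exact CoordinateRing.XYIdeal_mul_XYIdeal h₁.1 h₂.1 hxy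

/-- The function `ℓ_{i,j} / v_{i+j}`, or `v_i` if `i + j = p`. -/
noncomputable def chainFun (p : ℕ) (P : W.toAffine.Point) (i j : ℕ) : W.toAffine.FunctionField :=
  if i + j = p then polyFun W (verticalPoly (i • P))
  else polyFun W (linePoly (i • P) (j • P)) / polyFun W (verticalPoly ((i + j) • P))

theorem nsmul_ne_zero_of_lt {p : ℕ} [hp : Fact p.Prime] {P : W.toAffine.Point} (hP : P ≠ 0)
    (hpP : p • P = 0) {i : ℕ} (hi : 0 < i) (hip : i < p) : i • P ≠ 0 := by
  have h := addOrderOf_eq_prime hpP hP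
  rw [Ne, ← addOrderOf_dvd_iff_nsmul_eq_zero, h]
  exact Nat.not_dvd_of_pos_of_lt hi hip

/-- If `i + j = p`, then `jP = -iP` and the vertical line through `iP` has these two zeros.
Otherwise `iP`, `jP` and `(i + j)P` are all affine, and the chord quotient applies. -/
theorem hasDivisor_chainFun {p : ℕ} [hp : Fact p.Prime] {P : W.toAffine.Point} (hP : P ≠ 0)
    (hpP : p • P = 0) {i j : ℕ} (hi : 0 < i) (hj : 0 < j) (hij : i + j ≤ p) :
    HasDivisor (chainFun p P i j) (pointIdeal (i • P) * pointIdeal (j • P))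
      (pointIdeal ((i + j) • P)) := by
  rw [chainFun]
  split_ifs with h
  · have hj : j • P = -(i • P) := by
      rw [eq_neg_iff_add_eq_zero, ← add_smul, add_comm, h, hpP]
    rw [h, hpP, hj]
    refine ⟨CoordinateRing.mk W.toAffine (verticalPoly (i • P)), 1, one_ne_zero,
      by rw [map_one, mul_one]; rfl, ?_⟩
    rw [span_verticalPoly, pointIdeal_zero, mul_top, span_singleton_one, top_mul]
  · refine ⟨CoordinateRing.mk W.toAffine (linePoly (i • P) (j • P)),
      CoordinateRing.mk W.toAffine (verticalPoly ((i + j) • P)), fun hc ↦ ?_,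
      div_mul_cancel₀ _ (verticalPoly_ne_zero _), ?_⟩
    · exact verticalPoly_ne_zero ((i + j) • P) (by rw [polyFun, hc, map_zero])
    · have hlt := lt_of_le_of_ne hij h
      rw [add_smul]
      refine (span_linePoly (nsmul_ne_zero_of_lt hP hpP hi (by lia))
        (nsmul_ne_zero_of_lt hP hpP hj (by lia)) ?_).symm
      rw [← add_smul]
      exact nsmul_ne_zero_of_lt hP hpP (by lia) hlt

omit [DecidableEq K] in
theorem _root_.DualWeil.ChainDecomp.pos {n : ℕ} (c : ChainDecomp n) : 0 < n := by
  induction c with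
  | one => exact one_pos
  | step c d hc hd => exact add_pos hc hd

/-- Telescoping: the zeros at `iP` and `jP` of the factor for `i + j ↦ i, j` cancel the poles of the
two subproducts. For `n = p` no affine pole remains, since `pP = O`. -/
theorem hasDivisor_chain [IsAlgClosed K] [W.IsShortNF] [W.IsElliptic] {p : ℕ} [hp : Fact p.Prime]
    {P : W.toAffine.Point} (hP : P ≠ 0) (hpP : p • P = 0) {n : ℕ} (c : ChainDecomp n)
    (hn : n ≤ p) :
    HasDivisor (c.prod (chainFun p P)) (pointIdeal P ^ n) (pointIdeal (n • P)) := by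
  induction c with
  | one => rw [pow_one, one_smul]; exact HasDivisor.one _
  | @step i j c d hc hd =>
    have h := (hasDivisor_chainFun hP hpP c.pos d.pos hn).mul ((hc (by lia)).mul (hd (by lia)))
    rw [← pow_add, mul_comm (_ * _)] at h
    exact h.of_mul_right (mul_ne_zero (pointIdeal_ne_bot _) (pointIdeal_ne_bot _))

end Lines

end Divisors

/-! ### Evaluation of the pairing -/

section PairingValue

variable {K : Type*} [Field K] {W : WeierstrassCurve K}

namespace HasValue

variable {R : Type*} [CommRing R] [Algebra K R] {x y u v : R} {g h : W.toAffine.FunctionField}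

theorem one : HasValue (1 : W.toAffine.FunctionField) x y 1 :=
  ⟨1, 1, by simp, by simp, by simp⟩

theorem polyFun (f : K[X][Y]) : HasValue (polyFun W f) x y (aevalAeval x y f) :=
  ⟨f, 1, by rw [map_one]; exact isUnit_one, by simp [DualWeil.polyFun], by simp⟩

theorem mul (hg : HasValue g x y u) (hh : HasValue h x y v) : HasValue (g * h) x y (u * v) := by
  obtain ⟨a, b, hb, h₁, h₂⟩ := hg
  obtain ⟨c, d, hd, h₃, h₄⟩ := hh
  refine ⟨a * c, b * d, ?_, ?_, ?_⟩
  · rw [map_mul]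
    exact hb.mul hd
  · have hm (p q : K[X][Y]) : DualWeil.polyFun W (p * q) =
        DualWeil.polyFun W p * DualWeil.polyFun W q := by simp only [DualWeil.polyFun, map_mul]
    rw [hm, hm, mul_mul_mul_comm, h₁, h₃]
  · rw [map_mul, map_mul]
    linear_combination (v * aevalAeval x y d) * h₂ + aevalAeval x y a * h₄

end HasValue

theorem _root_.DualWeil.ChainDecomp.prod_mul_inv {n : ℕ} (c : ChainDecomp n) (f g : ℕ → ℕ → K[ε]) :
    (c.prod fun i j ↦ f i j * (g i j)⁻¹) = c.prod f * (c.prod g)⁻¹ := by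
  induction c with
  | one => simp [ChainDecomp.prod]
  | step c d hc hd =>
    simp only [ChainDecomp.prod, hc, hd, TrivSqZeroExt.mul_inv_rev]
    ring

theorem dual_isUnit_of_fst_ne_zero {a : K[ε]} (h : a.fst ≠ 0) : IsUnit a :=
  IsUnit.of_mul_eq_one a⁻¹ (by rw [mul_comm, dual_isUnit h])

variable [DecidableEq K] [W.IsShortNF]

omit [DecidableEq K] [W.IsShortNF] in
theorem eq_or_eq_neg_of_fst_verticalAt_eq_zero {P : W.toAffine.Point} {x₀ y₀ : K}
    {h₀ : W.toAffine.Nonsingular x₀ y₀} {X : K[ε]} (hX : X.fst = x₀) (hP : P ≠ 0)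
    (h : (verticalAt P X).fst = 0) : Affine.Point.some x₀ y₀ h₀ = P ∨ Affine.Point.some x₀ y₀ h₀ = -P := by
  rcases P with _ | ⟨x₁, y₁, h₁⟩
  · exact absurd rfl hP
  have hx : x₀ = x₁ := by
    rw [← hX]
    simpa [verticalAt, sub_eq_zero] using h
  subst hx
  rw [Affine.Point.neg_some]
  rcases Affine.Y_eq_of_X_eq h₀.1 h₁.1 rfl with rfl | rfl
  · exact .inl rfl
  · exact .inr rfl

/-- The value of one factor of the pairing. -/
theorem hasValue_hAt {p : ℕ} [hp : Fact p.Prime] {P T : W.toAffine.Point} (hP : P ≠ 0)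
    (hpP : p • P = 0) {S : Lift W} {x y : K[ε]} {h}
    (hS : S + -Lift.ofPoint T = .affine x y h) {x₀ y₀ : K} {h₀ : W.toAffine.Nonsingular x₀ y₀}
    (hx : x.fst = x₀) (hQ : p • Affine.Point.some x₀ y₀ h₀ ≠ 0) {i j : ℕ} (hi : 0 < i)
    (hij : i + j ≤ p) : HasValue (chainFun p P i j) x y (hAt p T P i j S) := by
  rw [hAt, hS, chainFun]
  simp only
  split_ifs with hij'
  · rw [← aevalAeval_verticalPoly (y := y)]
    exact HasValue.polyFun _
  -- The vertical line through `(i + j)P` vanishes only at `±(i + j)P`, which are `p`-torsion, while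
  -- the point of evaluation does not reduce to a `p`-torsion point.
  · have hne : (aevalAeval x y (verticalPoly ((i + j) • P))).fst ≠ 0 := by
      rw [aevalAeval_verticalPoly]
      intro hc
      rcases eq_or_eq_neg_of_fst_verticalAt_eq_zero (h₀ := h₀) hx
        (nsmul_ne_zero_of_lt hP hpP (by lia) (lt_of_le_of_ne hij hij')) hc with h | h
      · exact hQ (by rw [h, smul_comm, hpP, smul_zero])
      · exact hQ (by rw [h, smul_neg, smul_comm, hpP, smul_zero, neg_zero])
    rw [← aevalAeval_verticalPoly (y := y), ← aevalAeval_linePoly]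
    refine ⟨_, _, dual_isUnit_of_fst_ne_zero hne, div_mul_cancel₀ _ (verticalPoly_ne_zero _), ?_⟩
    rw [mul_assoc, dual_isUnit hne, mul_one]

theorem hasValue_chain {p : ℕ} [hp : Fact p.Prime] {P T : W.toAffine.Point} (hP : P ≠ 0)
    (hpP : p • P = 0) {S : Lift W} {x y : K[ε]} {h}
    (hS : S + -Lift.ofPoint T = .affine x y h) {x₀ y₀ : K} {h₀ : W.toAffine.Nonsingular x₀ y₀}
    (hx : x.fst = x₀) (hQ : p • Affine.Point.some x₀ y₀ h₀ ≠ 0) {n : ℕ} (c : ChainDecomp n)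
    (hn : n ≤ p) :
    HasValue (c.prod (chainFun p P)) x y (c.prod fun i j ↦ hAt p T P i j S) := by
  induction c with
  | one => exact HasValue.one
  | step c d hc hd =>
    exact (hasValue_hAt hP hpP hS hx hQ c.pos hn).mul ((hc (by lia)).mul (hd (by lia)))

variable [W.IsElliptic] [IsAlgClosed K]

omit [DecidableEq K] [W.IsElliptic] [IsAlgClosed K] in
theorem eq_of_pointIdeal_le {P : W.toAffine.Point} {x y : K} {h : W.toAffine.Nonsingular x y}
    (hle : pointIdeal P ≤ pointIdeal (.some x y h)) : P = .some x y h := by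
  rcases P with _ | ⟨x₁, y₁, h₁⟩
  · exact absurd (top_le_iff.mp hle) (isMaximal_XYIdeal W h.1).ne_top
  have h1 := hle ((mk_mem_XYIdeal_iff W h₁.1 (C (X - C x₁))).mpr (by simp))
  have h2 := hle ((mk_mem_XYIdeal_iff W h₁.1 (Y - C (C y₁))).mpr (by simp))
  have h1 := (mk_mem_XYIdeal_iff W h.1 _).mp h1
  have h2 := (mk_mem_XYIdeal_iff W h.1 _).mp h2
  simp [sub_eq_zero] at h1 h2
  subst h1 h2
  rfl

/-- The pairing in terms of the logarithmic derivative of a function with divisor `p` times the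
point. -/
theorem PairingData.e_eq {p : ℕ} [hp : Fact p.Prime] [CharP K p] (hp2 : p ≠ 2)
    (D : PairingData p W) {P : W.toAffine.Point} (hpP : p • P = 0) (k : K) {c : K}
    {f : W.toAffine.CoordinateRing} (hf : Ideal.span {f} = pointIdeal P ^ p)
    (hc : invDer W (algebraMap _ _ f) = algebraMap K _ c * algebraMap _ _ f) :
    D.e P k = 1 - TrivSqZeroExt.inr (k * c) := by
  rw [PairingData.e]
  split_ifs with h
  -- For `P = O` the function `f` is a nonzero constant, so `c = 0` and the formula agrees with the
  -- default value 1 of `e`.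
  · rcases h with rfl | rfl
    · rw [pointIdeal_zero, ← Ideal.one_eq_top, one_pow, Ideal.one_eq_top,
        Ideal.span_singleton_eq_top] at hf
      obtain ⟨d, hd, rfl⟩ := exists_eq_algebraMap_of_isUnit hf
      rw [← IsScalarTower.algebraMap_apply, Derivation.map_algebraMap, ← map_mul, eq_comm,
        _root_.map_eq_zero, mul_eq_zero, or_iff_left hd] at hc
      rw [hc, mul_zero, TrivSqZeroExt.inr_zero, sub_zero]
    · rw [zero_mul, TrivSqZeroExt.inr_zero, sub_zero]
  · push Not at h
    obtain ⟨hP, -⟩ := h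
    -- Since `p` is odd, `p(R - T) = -T ≠ O`. So `R - T` is not a multiple of `P`, and all factors
    -- are defined there.
    have hQ : p • (D.R + -D.T) ≠ 0 := by
      obtain ⟨q, hq⟩ := hp.out.odd_of_ne_two hp2
      have hT (n : ℕ) : (2 * n + 1) • D.T = D.T := by
        rw [add_smul, mul_comm, mul_smul, D.two_T, smul_zero, zero_add, one_smul]
      have hpT : p • D.T = D.T := (congrArg (· • D.T) hq).trans (hT q)
      rw [smul_add, D.p_R, zero_add, smul_neg, neg_ne_zero, hpT]
      exact D.T_ne_zero
    generalize hQQ : D.R + -D.T = Q at hQ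
    rcases Q with _ | ⟨x₀, y₀, h₀⟩
    · exact absurd (smul_zero p) hQ
    have hS (k : K) : Lift.infty k + Lift.ofPoint D.R + -Lift.ofPoint D.T =
        Lift.mk (.some x₀ y₀ h₀) k := by
      rw [← Lift.mk_zero, Lift.ofPoint_eq_mk, Lift.ofPoint_eq_mk, Lift.mk_add_mk, Lift.neg_mk,
        Lift.mk_add_mk, zero_add, hQQ, add_zero, neg_zero, add_zero]
    have hS0 : Lift.ofPoint D.R + -Lift.ofPoint D.T = Lift.mk (.some x₀ y₀ h₀) 0 := by
      rw [Lift.ofPoint_eq_mk, Lift.ofPoint_eq_mk, Lift.neg_mk, Lift.mk_add_mk, hQQ, neg_zero,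
        add_zero]
    have hdiv := hasDivisor_chain hP hpP D.C le_rfl
    rw [hpP, pointIdeal_zero] at hdiv
    obtain ⟨g, hg, hgs⟩ := hdiv.exists_span_eq
    have hDg := invDer_eq_mul_of_span_eq (hf.trans hgs.symm) hc
    obtain ⟨q, rfl⟩ := AdjoinRoot.mk_surjective g
    have hw := HasVal.of_aevalAeval (xFun W) (yFun W) x₀ y₀ q
    set w := aevalAeval x₀ y₀ q with hwdef
    -- The only affine zero of the product is `P`, which is `p`-torsion, unlike the point of
    -- evaluation.
    have hw0 : w ≠ 0 := by
      intro h0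
      have hmem := (mk_mem_XYIdeal_iff W h₀.1 q).mpr h0
      have hle : pointIdeal P ^ p ≤ pointIdeal (.some x₀ y₀ h₀) := by
        rw [← hgs, Ideal.span_singleton_le_iff_mem]
        exact hmem
      have := eq_of_pointIdeal_le (h := h₀) ((isMaximal_XYIdeal W h₀.1).isPrime.le_of_pow_le hle)
      exact hQ (this ▸ hpP)
    rw [← polyFun_eq_aevalAeval] at hw
    have hw' : HasVal (xFun W) (yFun W) x₀ y₀ (invDer W (polyFun W q)) (c * w) := by
      have : invDer W (polyFun W q) = algebraMap K _ c * polyFun W q := hDg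
      rw [this]
      exact hw.const_mul c
    -- The product of the values and the value of the product function agree by uniqueness of
    -- values; the latter is `w (1 - k c ε)` because `D` multiplies the function by `c`.
    have hval (k : K) {S : Lift W} (hS : S + -Lift.ofPoint D.T = Lift.mk (.some x₀ y₀ h₀) k) :
        (D.C.prod fun i j ↦ hAt p D.T P i j S) =
          TrivSqZeroExt.inl w - TrivSqZeroExt.inr (k * (c * w)) := by
      have h1 := hasValue_chain hP hpP hS (by simp) hQ D.C le_rfl
      rw [hg] at h1
      exact HasValue.unique (Lift.mk_equation h₀.1 k) h1 (hw.hasValue_translate h₀.1 hw' k)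
    rw [ChainDecomp.prod_mul_inv, hval k (hS k), hval 0 hS0, zero_mul, TrivSqZeroExt.inr_zero,
      sub_zero]
    refine dual_mul_eq (by simpa using hw0) ?_
    ext
    · simp
    · simp
      ring

end PairingValue

/-! ### Compatibility of the pairings with isogenies -/

section Compatibility

variable {K : Type*} [Field K] [IsAlgClosed K] [DecidableEq K] {W₁ W₂ : WeierstrassCurve K}
  [W₁.IsShortNF] [W₁.IsElliptic] [W₂.IsShortNF] [W₂.IsElliptic]

omit [IsAlgClosed K] [DecidableEq K] in
theorem one_sub_inr_pow (a : K) (n : ℕ) :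
    (1 - TrivSqZeroExt.inr a : K[ε]) ^ n = 1 - TrivSqZeroExt.inr (n * a) := by
  induction n with
  | zero => simp
  | succ n ih =>
    rw [pow_succ, ih]
    ext
    · simp
    · simp
      ring

omit [IsAlgClosed K] [DecidableEq K] in
theorem dual_inv_pow (a : K[ε]) (n : ℕ) : (a ^ n)⁻¹ = a⁻¹ ^ n := by
  induction n with
  | zero => simp
  | succ n ih => rw [pow_succ, TrivSqZeroExt.mul_inv_rev, ih, pow_succ, mul_comm]

/-- The pairing is compatible with isogenies. -/
theorem Isogeny.e_toFun {p : ℕ} [Fact p.Prime] [CharP K p] (hp2 : p ≠ 2) (φ : Isogeny W₁ W₂)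
    {m : K} (hm : φ.HasLinearCoeff m) (D₁ : PairingData p W₁) (D₂ : PairingData p W₂)
    {P : W₁.toAffine.Point} (hP : p • P = 0) (k : K) :
    D₂.e (φ.toFun P) (m * k) = D₁.e P k ^ φ.degree := by
  obtain ⟨N, hNP, hN⟩ := φ.exists_norm
  obtain ⟨f, hf0, hf⟩ := (nsmul_eq_zero_iff_pointIdeal P p).mp hP
  obtain ⟨c, hc⟩ := exists_invDer_eq_mul P hf0 hf.symm
  obtain ⟨n, hn0, hn, hnc⟩ := hN f hf0
  -- The norm `n` of `f` generates the `p`-th power of the ideal of `φ(P)`, so it computes the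
  -- pairing with `φ(P)`.
  rw [← hf, map_pow, hNP] at hn
  obtain ⟨d, hd⟩ := exists_invDer_eq_mul _ hn0 hn.symm
  have hmd := hnc m c (φ.invDer_pullback hm) hc
  have hn0' : algebraMap _ W₂.toAffine.FunctionField n ≠ 0 := by
    rwa [Ne, map_eq_zero_iff _ (IsFractionRing.injective _ _)]
  rw [hd, ← mul_assoc, ← map_mul] at hmd
  -- The resulting identity is `m d = (deg φ) c` for the constants `d` of `φ(P)` and `c` of `P`.
  have hmd := (algebraMap K W₂.toAffine.FunctionField).injective (mul_right_cancel₀ hn0' hmd)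
  rw [D₁.e_eq hp2 hP k hf.symm hc,
    D₂.e_eq hp2 (by rw [← toFun_nsmul, hP, toFun_zero]) (m * k) hn.symm hd, one_sub_inr_pow]
  congr 2
  linear_combination k * hmd

theorem Isogeny.ep_extend {p : ℕ} [Fact p.Prime] [CharP K p] (hp2 : p ≠ 2) (φ : Isogeny W₁ W₂)
    {m : K} (hm : φ.HasLinearCoeff m) (D₁ : PairingData p W₁) (D₂ : PairingData p W₂)
    {P Q : Lift W₁} (hP : p • P.toPoint = 0) (hQ : p • Q.toPoint = 0) :
    D₂.ep (φ.extend m P) (φ.extend m Q) = D₁.ep P Q ^ φ.degree := by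
  rw [PairingData.ep, PairingData.ep, extend, extend, Lift.toPoint_mk, Lift.toPoint_mk,
    Lift.theta_mk, Lift.theta_mk, φ.e_toFun hp2 hm D₁ D₂ hP, φ.e_toFun hp2 hm D₁ D₂ hQ, mul_pow,
    dual_inv_pow]

end Compatibility

end DualWeil

theorem mainTheorem4 {K : Type*} [Field K] [IsAlgClosed K] [DecidableEq K]
    (p : ℕ) [Fact p.Prime] [CharP K p] (hp2 : p ≠ 2) (hp3 : p ≠ 3)
    (W₁ W₂ : WeierstrassCurve K) [W₁.IsShortNF] [W₁.IsElliptic] [W₂.IsShortNF] [W₂.IsElliptic]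
    (φ : DualWeil.Isogeny W₁ W₂) :
    (∃! m : K, φ.HasLinearCoeff m) ∧
    ∀ m : K, φ.HasLinearCoeff m →
      ∃ F : DualWeil.Lift W₁ → DualWeil.Lift W₂,
        DualWeil.IsExtension φ m F ∧
        (∀ G : DualWeil.Lift W₁ → DualWeil.Lift W₂, DualWeil.IsExtension φ m G → G = F) ∧
        (∀ P : W₁.toAffine.Point,
          F (DualWeil.Lift.ofPoint P) = DualWeil.Lift.ofPoint (φ.toFun P)) ∧
        (∀ P Q : DualWeil.Lift W₁, F (P + Q) = F P + F Q) ∧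
        (∀ P : DualWeil.Lift W₁, DualWeil.Lift.mulNat p P = 0 →
          DualWeil.Lift.mulNat p (F P) = 0) ∧
        ∀ (D₁ : DualWeil.PairingData p W₁) (D₂ : DualWeil.PairingData p W₂),
          (∀ (P : W₁.toAffine.Point) (k : K), p • P = 0 →
            D₂.e (φ.toFun P) (m * k) = D₁.e P k ^ φ.degree) ∧
          ∀ P Q : DualWeil.Lift W₁,
            DualWeil.Lift.mulNat p P = 0 → DualWeil.Lift.mulNat p Q = 0 →
              D₂.ep (F P) (F Q) = D₁.ep P Q ^ φ.degree := by
  have htors {P : DualWeil.Lift W₁} (hP : DualWeil.Lift.mulNat p P = 0) : p • P.toPoint = 0 := by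
    obtain ⟨k, hk⟩ := DualWeil.Lift.exists_eq_mk P
    rw [hk] at hP
    exact (DualWeil.Lift.mulNat_eq_zero_iff _ _).mp hP
  refine ⟨φ.existsUnique_hasLinearCoeff, fun m hm ↦ ⟨φ.extend m,
    DualWeil.Isogeny.isExtension_extend hm,
    fun G hG ↦ (DualWeil.Isogeny.isExtension_extend hm).unique hG, φ.extend_ofPoint m,
    φ.extend_add m, fun P hP ↦ ?_, fun D₁ D₂ ↦ ⟨fun P k hP ↦ φ.e_toFun hp2 hm D₁ D₂ hP k,
    fun P Q hP hQ ↦ φ.ep_extend hp2 hm D₁ D₂ (htors hP) (htors hQ)⟩⟩⟩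
  refine (DualWeil.Lift.mulNat_eq_zero_iff _ _).mpr ?_
  rw [← φ.toFun_nsmul, htors hP, φ.toFun_zero]
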